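/- Let $\gamma>\tfrac12$, $\omega(v)=(1+v^2)^{\gamma}$ for $v\in\mathbb R$, and $F=C_\beta^2/\omega$, where $C_\beta>0$ is the constant such that $\int_{\mathbb R}F\,dv=1$. Let $V$ be the space of functions $h$ on $\mathbb R$ with $\int h^2\omega\,dv<\infty$ and $\int|\partial_v(h\omega)|^2\omega^{-1}dv<\infty$ (weak derivative), and let $V'$ be its dual with respect to the pairing $\int h_1h_2\,\omega\,dv$. For all real $A,B$ there is a constant $C>0$, depending only on $\gamma,A,B$, such that the following holds. Let $f_0:\mathbb R_x\times\mathbb R_v\to\mathbb R$ be measurable with $\|f_0\omega\|_{L^\infty}\le A$ and $\|f_0\|_{Y^2_\omega}^2=\iint f_0^2\,\omega\,dv\,dx\le B$. Let $T>0$, $\varepsilon>0$, $\theta(\varepsilon)=\varepsilon^{(2\gamma+1)/3}$, and let $f^\varepsilon$ be a weak solution on $(0,T)\times\mathbb R\times\mathbb R$ of $$\theta(\varepsilon)\,\partial_tf^\varepsilon+\varepsilon v\,\partial_xf^\varepsilon=\partial_v\Big(\frac1\omega\,\partial_v(\omega f^\varepsilon)\Big),\qquad f^\varepsilon|_{t=0}=f_0,$$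 in the class of functions $f^\varepsilon\in L^2((0,T)\times\mathbb R;V)$ with $\theta(\varepsilon)\partial_tf^\varepsilon+\varepsilon v\,\partial_xf^\varepsilon\in L^2((0,T)\times\mathbb R;V')$. Then $f^\varepsilon(t,x,\cdot)$ is integrable for almost every $(t,x)$, and with $\rho^\varepsilon=\int f^\varepsilon\,dv$ and $g^\varepsilon=f^\varepsilon F^{-1/2}$, $$\int_0^T\!\int_{\mathbb R}\Big(\int_{\mathbb R}\big|g^\varepsilon-\rho^\varepsilon F^{1/2}\big|^2dv\Big)^{\frac{2\gamma+1}{2\gamma-1}}dy\,ds\le C\,\varepsilon^{\frac{2\gamma+1}{3}} .$$ -/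

import Mathlib

open MeasureTheory Set
open scoped ENNReal

noncomputable section

namespace HeavyTail

/-- The weight `ω(v) = (1 + v²)^γ` (that is `(1 + v²)^(β/2)` with `β = 2γ`). -/
def weight (γ v : ℝ) : ℝ := (1 + v ^ 2) ^ γ

/-- The normalization constant: `C_β² ∫ dv / ω = 1`. -/
def normConst (γ : ℝ) : ℝ := (√(∫ v : ℝ, 1 / weight γ v))⁻¹

/-- The heavy-tailed equilibrium `F = C_β² / ω`, a probability density when `γ > 1/2`. -/
def equilibrium (γ v : ℝ) : ℝ := normConst γ ^ 2 / weight γ v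

/-- The squared norm `∫∫ |f₀|² ω dv dx` of `Y²_ω` for functions `f₀(x, v)`. -/
def normSqY2 (γ : ℝ) (f₀ : ℝ × ℝ → ℝ) : ℝ≥0∞ :=
  ∫⁻ q : ℝ × ℝ, ENNReal.ofReal (f₀ q ^ 2 * weight γ q.2)

/-- `u'` is the weak derivative of `u` on the real line. -/
def IsWeakDeriv (u u' : ℝ → ℝ) : Prop :=
  LocallyIntegrable u volume ∧ LocallyIntegrable u' volume ∧
    ∀ φ : ℝ → ℝ, ContDiff ℝ (⊤ : ℕ∞) φ → HasCompactSupport φ →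
      ∫ v, u v * deriv φ v = -∫ v, u' v * φ v

/-- The phase space `(0, T) × ℝ × ℝ` with coordinates `(t, x, v)`. -/
def slab (T : ℝ) : Set (ℝ × ℝ × ℝ) := Ioo 0 T ×ˢ univ

/-- `f ∈ L²((0, T) × ℝ, V)`, where `V` is the space of functions `h(v)` with
`∫ h² ω dv < ∞` and `∫ |∂ᵥ(h ω)|² / ω dv < ∞`; here `G` is the weak derivative `∂ᵥ(f ω)`. -/
def IsL2V (γ T : ℝ) (f G : ℝ × ℝ × ℝ → ℝ) : Prop :=
  AEStronglyMeasurable f (volume.restrict (slab T)) ∧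
  AEStronglyMeasurable G (volume.restrict (slab T)) ∧
  (∀ᵐ z : ℝ × ℝ ∂(volume.restrict (Ioo 0 T ×ˢ univ)),
    IsWeakDeriv (fun v => f (z.1, z.2, v) * weight γ v) (fun v => G (z.1, z.2, v))) ∧
  ∫⁻ p in slab T, ENNReal.ofReal (f p ^ 2 * weight γ p.2.2) < ⊤ ∧
  ∫⁻ p in slab T, ENNReal.ofReal (G p ^ 2 / weight γ p.2.2) < ⊤

/-- The partial derivative in `t` of a smooth function of `(t, x, v)`. -/
def dt (φ : ℝ × ℝ × ℝ → ℝ) (p : ℝ × ℝ × ℝ) : ℝ := fderiv ℝ φ p (1, 0, 0)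

/-- The partial derivative in `x` of a smooth function of `(t, x, v)`. -/
def dx (φ : ℝ × ℝ × ℝ → ℝ) (p : ℝ × ℝ × ℝ) : ℝ := fderiv ℝ φ p (0, 1, 0)

/-- The partial derivative in `v` of a smooth function of `(t, x, v)`. -/
def dv (φ : ℝ × ℝ × ℝ → ℝ) (p : ℝ × ℝ × ℝ) : ℝ := fderiv ℝ φ p (0, 0, 1)

/-- `θ ∂ₜ f + ε v ∂ₓ f ∈ L²((0, T) × ℝ, V')`: the distribution on `(0, T) × ℝ × ℝ`, paired through
`ω dv`, is bounded on test functions for the norm of `L²((0, T) × ℝ, V)` (in which the test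
functions are dense). -/
def TransportInDual (γ θ ε T : ℝ) (f : ℝ × ℝ × ℝ → ℝ) : Prop :=
  ∃ K : ℝ, ∀ ψ : ℝ × ℝ × ℝ → ℝ, ContDiff ℝ (⊤ : ℕ∞) ψ → HasCompactSupport ψ → tsupport ψ ⊆ slab T →
    |∫ p in slab T, f p * (θ * dt ψ p + ε * p.2.2 * dx ψ p) * weight γ p.2.2| ≤
      K * √(∫ p in slab T, (ψ p ^ 2 * weight γ p.2.2 +
        dv (fun q => ψ q * weight γ q.2.2) p ^ 2 / weight γ p.2.2))

/-- `f` is a solution, in the class `Y` (that is `f ∈ L²((0, T) × ℝ, V)` and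
`θ ∂ₜ f + ε v ∂ₓ f ∈ L²((0, T) × ℝ, V')`), of
`θ ∂ₜ f + ε v ∂ₓ f = ∂ᵥ(ω⁻¹ ∂ᵥ(ω f))` on `(0, T) × ℝ × ℝ` with `f = f₀` at `t = 0`.
The equation and the initial condition are tested against smooth functions with compact support
in `(-∞, T) × ℝ × ℝ`. -/
def IsSolution (γ θ ε T : ℝ) (f₀ : ℝ × ℝ → ℝ) (f : ℝ × ℝ × ℝ → ℝ) : Prop :=
  TransportInDual γ θ ε T f ∧
  ∃ G : ℝ × ℝ × ℝ → ℝ, IsL2V γ T f G ∧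
    ∀ φ : ℝ × ℝ × ℝ → ℝ, ContDiff ℝ (⊤ : ℕ∞) φ → HasCompactSupport φ →
      tsupport φ ⊆ Iio T ×ˢ univ →
      -(∫ p in slab T, f p * (θ * dt φ p + ε * p.2.2 * dx φ p))
          - θ * ∫ q : ℝ × ℝ, f₀ q * φ (0, q.1, q.2)
        = -∫ p in slab T, G p / weight γ p.2.2 * dv φ p

/-- The density `ρ(t, x) = ∫ f(t, x, v) dv`. -/
def density (f : ℝ × ℝ × ℝ → ℝ) (t x : ℝ) : ℝ := ∫ v : ℝ, f (t, x, v)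

/-- The rescaled unknown `g = f F^(-1/2)`. -/
def rescaled (γ : ℝ) (f : ℝ × ℝ × ℝ → ℝ) (t x v : ℝ) : ℝ :=
  f (t, x, v) * equilibrium γ v ^ (-(1 / 2) : ℝ)

end HeavyTail

end

open HeavyTail

set_option linter.unusedSectionVars false

namespace HeavyTail
open Filter Topology
open scoped ContDiff

/-! Put `u = ω f` and `G = ∂ᵥu`. The equation reads `ω⁻¹(θ ∂ₜ + ε v ∂ₓ)u = ∂ᵥ(G/ω)`. Constants solve
it, so the bound `|u| ≤ A` propagates from the initial datum (`IsKineticSolution.abs_le`).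
Multiplying by `u` bounds the dissipation: `∭ G²/ω` is at most a constant times `θ ∬ f₀² ω`
(`IsKineticSolution.lintegral_le`). The factor `θ = ε^((2γ+1)/3)` in front of `∂ₜ` is the whole
source of the rate.

At fixed `(t, x)` the two bounds combine into a weak Poincaré inequality. With `P = ∫ G²/ω dv`,
Cauchy–Schwarz gives `(u(v) - u(0))² ≤ |v| ω(v) P`, while the sup bound gives `(u(v) - u(0))² ≤
4A²`. After division by `ω` the integrand is at most `min(|v| P, 4A² |v|^(-2γ))`, whose integral is
of order `P^((2γ-1)/(2γ+1))`. The norm of `g - ρ F^(1/2)` is, up to normalization, the distance in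
`L²(dv/ω)` from `u` to its mean, which is minimal among constants, so replacing `u(0)` by the mean
costs nothing. Raising to the reciprocal power `(2γ+1)/(2γ-1)` makes the bound linear in `P`
(`lintegral_deviation_rpow_le`), and integration over `(t, x)` gives the claim.

The remaining work justifies testing the weak equation with functions of `u`. Extended by zero
outside `(0, T)`, the solution acquires the datum as a source `θ f₀ δ` at `t = 0`. The coefficients
depend on `v` alone, so convolution in `(t, x)` commutes with the equation exactly, away from the
final time (`IsKineticSolution.isRegularSolution`). Mollified solutions obey an entropy balance
(`IsRegularSolution.integral_entropyProduction`). A one-sided entropy with a moving barrier yields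
the maximum principle and the quadratic entropy yields the energy bound. The mollifier is removed by
almost everywhere convergence and Fatou's lemma. -/

/-! ### Weak derivatives and absolutely continuous functions on the line -/

theorem AbsolutelyContinuousOnInterval.comp_lipschitz {f g : ℝ → ℝ} {a b : ℝ}
    (hf : AbsolutelyContinuousOnInterval f a b) (hg : LipschitzWith 1 g) :
    AbsolutelyContinuousOnInterval (fun x => g (f x)) a b := by
  rw [absolutelyContinuousOnInterval_iff] at hf ⊢
  intro ε hε
  obtain ⟨δ, hδ, h⟩ := hf ε hε
  refine ⟨δ, hδ, fun E hE hE' => lt_of_le_of_lt (Finset.sum_le_sum fun i _ => ?_) (h E hE hE')⟩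
  simpa using hg.dist_le_mul (f (E.2 i).1) (f (E.2 i).2)

theorem absolutelyContinuousOnInterval_primitive {u' : ℝ → ℝ} (h : LocallyIntegrable u' volume)
    (c R : ℝ) : AbsolutelyContinuousOnInterval (fun v => c + ∫ s in (0 : ℝ)..v, u' s) (-R) R := by
  have h1 : AbsolutelyContinuousOnInterval (fun v => ∫ s in (0 : ℝ)..v, u' s) (-R) R := by
    apply IntervalIntegrable.absolutelyContinuousOnInterval_intervalIntegral
    · exact (h.integrableOn_isCompact isCompact_uIcc).intervalIntegrable
    · rcases le_total 0 R with hR | hR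
      · rw [uIcc_of_le (by linarith)]; constructor <;> linarith
      · rw [uIcc_of_ge (by linarith)]; constructor <;> linarith
  have h2 : AbsolutelyContinuousOnInterval (fun _ : ℝ => c) (-R) R :=
    ((LipschitzWith.const c).lipschitzOnWith (s := uIcc (-R) R)).absolutelyContinuousOnInterval
  exact h2.add h1

theorem ae_hasDerivAt_primitive {u' : ℝ → ℝ} (h : LocallyIntegrable u' volume) (c : ℝ) :
    ∀ᵐ v : ℝ, HasDerivAt (fun v => c + ∫ s in (0 : ℝ)..v, u' s) (u' v) v := by
  filter_upwards [LocallyIntegrable.ae_hasDerivAt_integral h] with v hv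
  exact (hv 0).const_add c

/-- Integration by parts for absolutely continuous functions, one of them vanishing at the ends. -/
theorem integral_mul_eq_neg_of_absolutelyContinuous {f g f' g' : ℝ → ℝ} {R : ℝ} (hR : 0 ≤ R)
    (hf : AbsolutelyContinuousOnInterval f (-R) R) (hg : AbsolutelyContinuousOnInterval g (-R) R)
    (hf' : ∀ᵐ v, HasDerivAt f (f' v) v) (hg' : ∀ᵐ v, HasDerivAt g (g' v) v)
    (h0 : ∀ v, R ≤ |v| → g v = 0) (h0' : ∀ v, R < |v| → g' v = 0) :
    ∫ v, g v * f' v = -∫ v, f v * g' v := by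
  have key := hf.integral_mul_deriv_eq_deriv_mul hg
  rw [h0 R (le_abs_self R), h0 (-R) (by simp [le_abs_self])] at key
  have e1 : ∫ v, g v * f' v = ∫ v in (-R)..R, deriv f v * g v := by
    rw [intervalIntegral.integral_of_le (by linarith), ← integral_Icc_eq_integral_Ioc,
      ← setIntegral_eq_integral_of_forall_compl_eq_zero (s := Icc (-R) R)]
    · refine setIntegral_congr_ae measurableSet_Icc ?_
      filter_upwards [hf'] with v hv _
      rw [hv.deriv, mul_comm]
    · intro v hv
      rw [h0 v (le_of_not_ge fun h => hv (abs_le.mp h)), zero_mul]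
  have e2 : ∫ v, f v * g' v = ∫ v in (-R)..R, f v * deriv g v := by
    rw [intervalIntegral.integral_of_le (by linarith), ← integral_Icc_eq_integral_Ioc,
      ← setIntegral_eq_integral_of_forall_compl_eq_zero (s := Icc (-R) R)]
    · refine setIntegral_congr_ae measurableSet_Icc ?_
      filter_upwards [hg'] with v hv _
      rw [hv.deriv]
    · intro v hv
      rw [h0' v (lt_of_not_ge fun h => hv (abs_le.mp h)), mul_zero]
  rw [e1, e2, key]; ring

theorem _root_.HasCompactSupport.exists_abs_lt {φ : ℝ → ℝ} (h : HasCompactSupport φ) :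
    ∃ R, 0 < R ∧ ∀ v, R ≤ |v| → φ v = 0 ∧ deriv φ v = 0 := by
  obtain ⟨R, hR⟩ := h.isCompact.isBounded.subset_ball (0 : ℝ)
  refine ⟨max R 1, by positivity, fun v hv => ?_⟩
  have hv' : v ∉ tsupport φ := fun hm => by
    have := hR hm
    rw [mem_ball_zero_iff, Real.norm_eq_abs] at this
    exact absurd (lt_of_lt_of_le this ((le_max_left _ _).trans hv)) (lt_irrefl _)
  exact ⟨image_eq_zero_of_notMem_tsupport hv',
    image_eq_zero_of_notMem_tsupport fun hm => hv' (tsupport_deriv_subset hm)⟩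

theorem isWeakDeriv_primitive {u' : ℝ → ℝ} (h : LocallyIntegrable u' volume) (c : ℝ) (φ : ℝ → ℝ)
    (hφ : ContDiff ℝ (⊤ : ℕ∞) φ) (hc : HasCompactSupport φ) :
    ∫ v, (c + ∫ s in (0 : ℝ)..v, u' s) * deriv φ v = -∫ v, u' v * φ v := by
  obtain ⟨R, hR, h0⟩ := hc.exists_abs_lt
  have h1 : ContDiff ℝ 1 φ := hφ.of_le (by exact_mod_cast le_top)
  have := integral_mul_eq_neg_of_absolutelyContinuous hR.le
    (absolutelyContinuousOnInterval_primitive h c R)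
    h1.contDiffOn.absolutelyContinuousOnInterval (ae_hasDerivAt_primitive h c)
    (Eventually.of_forall fun v => (h1.differentiable (by norm_num) v).hasDerivAt)
    (fun v hv => (h0 v hv).1) (fun v hv => (h0 v hv.le).2)
  simp_rw [mul_comm (u' _)]
  rw [this, neg_neg]

/-- A smooth compactly supported function of zero mean is the derivative of such a function. -/
theorem exists_deriv_eq_of_integral_eq_zero {ψ : ℝ → ℝ} (hψ : ContDiff ℝ (⊤ : ℕ∞) ψ)
    (hc : HasCompactSupport ψ) (h0 : ∫ v, ψ v = 0) :
    ∃ φ : ℝ → ℝ, ContDiff ℝ (⊤ : ℕ∞) φ ∧ HasCompactSupport φ ∧ deriv φ = ψ := by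
  obtain ⟨R, hR, hz⟩ := hc.exists_abs_lt
  have hd : ∀ v, HasDerivAt (fun v => ∫ s in (-R)..v, ψ s) (ψ v) v := fun v =>
    intervalIntegral.integral_hasDerivAt_right (hψ.continuous.intervalIntegrable _ _)
      (hψ.continuous.stronglyMeasurableAtFilter _ _) hψ.continuous.continuousAt
  have hd' : deriv (fun v => ∫ s in (-R)..v, ψ s) = ψ := funext fun v => (hd v).deriv
  refine ⟨fun v => ∫ s in (-R)..v, ψ s, ?_, ?_, hd'⟩
  · rw [contDiff_infty_iff_deriv, hd']
    exact ⟨fun v => (hd v).differentiableAt, hψ⟩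
  · refine HasCompactSupport.of_support_subset_isCompact (isCompact_Icc (a := -R) (b := R)) ?_
    intro v hv
    by_contra hn
    apply hv
    simp only [mem_Icc, not_and_or, not_le] at hn
    beta_reduce
    rcases hn with hn | hn
    · rw [intervalIntegral.integral_symm, intervalIntegral.integral_of_le hn.le, neg_eq_zero]
      refine setIntegral_eq_zero_of_forall_eq_zero fun s hs => (hz s ?_).1
      rw [abs_of_nonpos (by linarith [hs.2])]; linarith [hs.2]
    -- To the right of the support the primitive equals the full integral, which is zero: this is
    -- where the zero mean gives compact support.
    · rw [intervalIntegral.integral_of_le (by linarith), ← h0]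
      refine setIntegral_eq_integral_of_forall_compl_eq_zero fun s hs => (hz s ?_).1
      simp only [mem_Ioc, not_and_or, not_le, not_lt] at hs
      rcases hs with hs | hs
      · rw [abs_of_nonpos (by linarith)]; linarith
      · rw [abs_of_nonneg (by linarith)]; linarith

/-- A function with a weak derivative is almost everywhere a primitive of it. -/
theorem IsWeakDeriv.exists_primitive {u u' : ℝ → ℝ} (h : IsWeakDeriv u u') :
    ∃ c, u =ᵐ[volume] fun v => c + ∫ s in (0 : ℝ)..v, u' s := by
  obtain ⟨hu, hu', hw⟩ := h
  set U : ℝ → ℝ := fun v => ∫ s in (0 : ℝ)..v, u' s with hU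
  have hUc : Continuous U := intervalIntegral.continuous_primitive
    (fun a b => (hu'.integrableOn_isCompact isCompact_uIcc).intervalIntegrable) 0
  have hg : LocallyIntegrable (fun v => u v - U v) volume := hu.sub hUc.locallyIntegrable
  let b : ContDiffBump (0 : ℝ) := ⟨1, 2, one_pos, one_lt_two⟩
  set η : ℝ → ℝ := b.normed volume with hη
  have hη1 : ∫ v, η v = 1 := b.integral_normed
  have hηs : ContDiff ℝ (⊤ : ℕ∞) η := b.contDiff_normed
  have hηc : HasCompactSupport η := b.hasCompactSupport_normed
  have hint : ∀ {ψ : ℝ → ℝ}, Continuous ψ → HasCompactSupport ψ →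
      ∀ {w : ℝ → ℝ}, LocallyIntegrable w volume → Integrable (fun v => w v * ψ v) := by
    intro ψ h1 h2 w hw'
    have := hw'.integrable_smul_left_of_hasCompactSupport h1 h2
    refine this.congr (Eventually.of_forall fun v => ?_)
    simp [mul_comm]
  have hzero : ∀ φ : ℝ → ℝ, ContDiff ℝ (⊤ : ℕ∞) φ → HasCompactSupport φ →
      ∫ v, (u v - U v) * deriv φ v = 0 := by
    intro φ h1 h2
    have hd : Continuous (deriv φ) := h1.continuous_deriv (by exact_mod_cast le_top)
    simp_rw [sub_mul]
    rw [integral_sub (hint hd h2.deriv hu) (hint hd h2.deriv hUc.locallyIntegrable), hw φ h1 h2]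
    have := isWeakDeriv_primitive hu' 0 φ h1 h2
    simp only [zero_add] at this
    rw [this, sub_self]
  -- The difference `u - U` has zero weak derivative, hence is constant; its average against the
  -- normalized bump `η` identifies the constant.
  set c := ∫ v, (u v - U v) * η v with hc
  refine ⟨c, ?_⟩
  have hfin : ∀ᵐ v : ℝ, u v - U v - c = 0 := by
    refine ae_eq_zero_of_integral_contDiff_smul_eq_zero
      (hg.sub (continuous_const.locallyIntegrable)) fun ψ h1 h2 => ?_
    set m := ∫ v, ψ v with hm
    have hi : Integrable ψ volume := h1.continuous.integrable_of_hasCompactSupport h2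
    have hiη : Integrable η volume := hηs.continuous.integrable_of_hasCompactSupport hηc
    -- Subtracting `m η` makes the mean of an arbitrary test function vanish, so that the remainder
    -- is a derivative and `hzero` applies.
    obtain ⟨φ, p1, p2, p3⟩ := exists_deriv_eq_of_integral_eq_zero (ψ := fun v => ψ v - m * η v)
      (h1.sub (contDiff_const.mul hηs)) (h2.sub hηc.mul_left)
      (by rw [integral_sub hi (hiη.const_mul m), integral_const_mul, hη1]; simp [hm])
    have h3 := hzero φ p1 p2
    rw [p3] at h3
    have e : ∀ v, (u v - U v) * (ψ v - m * η v)
        = (u v - U v) * ψ v - m * ((u v - U v) * η v) := fun v => by ring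
    simp_rw [e] at h3
    rw [integral_sub (hint h1.continuous h2 hg) ((hint hηs.continuous hηc hg).const_mul m),
      integral_const_mul, ← hc] at h3
    have e' : ∀ v, ψ v • (u v - U v - c) = (u v - U v) * ψ v - c * ψ v := fun v => by
      simp only [smul_eq_mul]; ring
    simp_rw [e']
    rw [integral_sub (hint h1.continuous h2 hg) (hi.const_mul c), integral_const_mul, ← hm]
    linarith
  filter_upwards [hfin] with v hv
  simp only [hU] at hv ⊢
  linarith

/-- The weak formulation tested with a cut-off times a nonlinear function of a weakly
differentiable function. -/
theorem IsWeakDeriv.integral_comp_mul_eq_neg {a a' u u' P P' χ : ℝ → ℝ} (ha : IsWeakDeriv a a')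
    (hu : IsWeakDeriv u u') (hP : ∀ r, HasDerivAt P (P' r) r) (hP' : ∀ r, |P' r| ≤ 1) (m : ℝ)
    (hχ : ContDiff ℝ (⊤ : ℕ∞) χ) (hc : HasCompactSupport χ) :
    ∫ v, χ v * P (u v - m) * a' v
      = -∫ v, a v * (deriv χ v * P (u v - m) + χ v * (P' (u v - m) * u' v)) := by
  obtain ⟨R, hR, h0⟩ := hc.exists_abs_lt
  obtain ⟨ca, hca⟩ := ha.exists_primitive
  obtain ⟨cu, hcu⟩ := hu.exists_primitive
  have hLip : LipschitzWith 1 P := by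
    refine lipschitzWith_of_nnnorm_deriv_le (fun r => (hP r).differentiableAt) fun r => ?_
    rw [(hP r).deriv, ← NNReal.coe_le_coe]
    simpa using hP' r
  have h1 : ContDiff ℝ 1 χ := hχ.of_le (by exact_mod_cast le_top)
  -- Once `u` is replaced by its primitive representative, the Lipschitz function `P` preserves
  -- absolute continuity, and both factors can be integrated by parts classically.
  have hACb := h1.contDiffOn.absolutelyContinuousOnInterval.fun_mul
    (AbsolutelyContinuousOnInterval.comp_lipschitz
      (absolutelyContinuousOnInterval_primitive hu.2.1 (cu - m) R) hLip)
  have hdb : ∀ᵐ v : ℝ, HasDerivAt (fun v => χ v * P (cu - m + ∫ s in (0 : ℝ)..v, u' s))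
      (deriv χ v * P (cu - m + ∫ s in (0 : ℝ)..v, u' s)
        + χ v * (P' (cu - m + ∫ s in (0 : ℝ)..v, u' s) * u' v)) v := by
    filter_upwards [ae_hasDerivAt_primitive hu.2.1 (cu - m)] with v hv
    exact ((h1.differentiable (by norm_num) v).hasDerivAt).mul ((hP _).comp v hv)
  have key := integral_mul_eq_neg_of_absolutelyContinuous hR.le
    (absolutelyContinuousOnInterval_primitive ha.2.1 ca R) hACb
    (ae_hasDerivAt_primitive ha.2.1 ca) hdb
    (fun v hv => by simp [(h0 v hv).1]) (fun v hv => by simp [(h0 v hv.le).1, (h0 v hv.le).2])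
  have e1 : ∫ v, χ v * P (u v - m) * a' v
      = ∫ v, χ v * P (cu - m + ∫ s in (0 : ℝ)..v, u' s) * a' v := by
    refine integral_congr_ae ?_
    filter_upwards [hcu] with v hv
    rw [hv, add_sub_right_comm]
  rw [e1, key]
  congr 1
  refine integral_congr_ae ?_
  filter_upwards [hcu, hca] with v hv hv'
  rw [hv, hv', add_sub_right_comm]

/-! ### The weight and the weak Poincaré inequality -/

theorem weight_pos (γ v : ℝ) : 0 < weight γ v := Real.rpow_pos_of_pos (by positivity) _

theorem continuous_weight (γ : ℝ) : Continuous (weight γ) :=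
  (by fun_prop : Continuous fun v : ℝ => 1 + v ^ 2).rpow_const
    fun v => Or.inl (by positivity)

theorem weight_le_weight {γ : ℝ} (hγ : 0 ≤ γ) {v w : ℝ} (h : |v| ≤ |w|) :
    weight γ v ≤ weight γ w :=
  Real.rpow_le_rpow (by positivity) (by linarith [sq_le_sq.mpr h]) hγ

theorem abs_rpow_le_weight {γ : ℝ} (hγ : 0 ≤ γ) (v : ℝ) : |v| ^ (2 * γ) ≤ weight γ v := by
  rw [Real.rpow_mul (abs_nonneg v)]
  refine Real.rpow_le_rpow (by positivity) ?_ hγ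
  rw [Real.rpow_two, sq_abs]; linarith

theorem integrable_inv_weight {γ : ℝ} (hγ : 1 / 2 < γ) :
    Integrable (fun v => (weight γ v)⁻¹) volume := by
  have := integrable_rpow_neg_one_add_norm_sq (E := ℝ) (μ := volume) (r := 2 * γ)
    (by simp; linarith)
  refine this.congr (Eventually.of_forall fun v => ?_)
  simp only [weight, Real.norm_eq_abs, sq_abs]
  rw [← Real.rpow_neg (by positivity)]
  congr 1; ring

theorem integral_inv_weight_pos {γ : ℝ} (hγ : 1 / 2 < γ) : 0 < ∫ v, (weight γ v)⁻¹ := by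
  rw [integral_pos_iff_support_of_nonneg (fun v => (inv_pos.mpr (weight_pos γ v)).le)
    (integrable_inv_weight hγ)]
  have : Function.support (fun v => (weight γ v)⁻¹) = univ :=
    eq_univ_of_forall fun v => (inv_pos.mpr (weight_pos γ v)).ne'
  simp [this]

/-- The Cauchy–Schwarz inequality for square-integrable real functions. -/
theorem sq_integral_mul_le {α : Type*} [MeasurableSpace α] {μ : Measure α} {f g : α → ℝ}
    (hf : MemLp f 2 μ) (hg : MemLp g 2 μ) :
    (∫ x, f x * g x ∂μ) ^ 2 ≤ (∫ x, f x ^ 2 ∂μ) * ∫ x, g x ^ 2 ∂μ := by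
  have hf2 := hf.integrable_sq
  have hg2 := hg.integrable_sq
  have hfg : Integrable (fun x => f x * g x) μ := hf.integrable_mul hg
  -- The quadratic polynomial `r ↦ ∫ (r f + g)²` is nonnegative, so its discriminant is not
  -- positive.
  have h := discrim_le_zero (a := ∫ x, f x ^ 2 ∂μ) (b := 2 * ∫ x, f x * g x ∂μ)
    (c := ∫ x, g x ^ 2 ∂μ) fun r => by
      have e : ∫ x, (f x * r + g x) ^ 2 ∂μ
          = (∫ x, f x ^ 2 ∂μ) * (r * r) + 2 * (∫ x, f x * g x ∂μ) * r + ∫ x, g x ^ 2 ∂μ := by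
        have e1 : ∀ x, (f x * r + g x) ^ 2
            = f x ^ 2 * (r * r) + f x * g x * (2 * r) + g x ^ 2 := fun x => by ring
        simp_rw [e1]
        have i1 : Integrable (fun x => f x ^ 2 * (r * r) + f x * g x * (2 * r)) μ :=
          (hf2.mul_const _).add (hfg.mul_const _)
        rw [integral_add i1 hg2, integral_add (hf2.mul_const _) (hfg.mul_const _),
          integral_mul_const, integral_mul_const]
        ring
      rw [← e]
      exact integral_nonneg fun x => sq_nonneg _
  rw [discrim] at h
  nlinarith

theorem sq_setIntegral_le {G : ℝ → ℝ} {s : Set ℝ} (hs : volume s ≠ ⊤)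
    (hG : MemLp G 2 (volume.restrict s)) :
    (∫ v in s, G v) ^ 2 ≤ volume.real s * ∫ v in s, G v ^ 2 := by
  have : IsFiniteMeasure (volume.restrict s) := ⟨by simpa using hs.lt_top⟩
  have := sq_integral_mul_le (memLp_const (1 : ℝ)) hG
  simpa using this

/-- Growth of a primitive of a function of finite weighted energy. -/
theorem sq_primitive_le {γ : ℝ} (hγ : 0 ≤ γ) {G : ℝ → ℝ} (hG : AEStronglyMeasurable G volume)
    (hi : Integrable (fun v => G v ^ 2 / weight γ v)) (v : ℝ) :
    (∫ s in (0 : ℝ)..v, G s) ^ 2 ≤ |v| * weight γ v * ∫ s, G s ^ 2 / weight γ s := by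
  have hb : ∀ s ∈ uIoc 0 v, |s| ≤ |v| := by
    intro s hs
    rcases le_total 0 v with hv | hv
    · rw [uIoc_of_le hv] at hs
      rw [abs_of_nonneg hs.1.le, abs_of_nonneg hv]; exact hs.2
    · rw [uIoc_of_ge hv] at hs
      rw [abs_of_nonpos hs.2, abs_of_nonpos hv]; linarith [hs.1]
  have hle : ∀ s ∈ uIoc 0 v, G s ^ 2 ≤ weight γ v * (G s ^ 2 / weight γ s) := by
    intro s hs
    have h1 := weight_le_weight hγ (hb s hs)
    have h2 := weight_pos γ s
    rw [mul_div_assoc', le_div_iff₀ h2]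
    nlinarith [sq_nonneg (G s)]
  have hsq : IntegrableOn (fun s => G s ^ 2) (uIoc 0 v) := by
    refine Integrable.mono' (hi.integrableOn.const_mul (weight γ v)) (hG.restrict.pow 2) ?_
    filter_upwards [ae_restrict_mem measurableSet_uIoc] with s hs
    rw [Real.norm_of_nonneg (sq_nonneg _)]
    exact hle s hs
  have hmem : MemLp G 2 (volume.restrict (uIoc 0 v)) :=
    (memLp_two_iff_integrable_sq hG.restrict).2 hsq
  have hvol : volume.real (uIoc 0 v) = |v| := by
    simp [measureReal_def, Real.volume_uIoc]
  have h1 := sq_setIntegral_le (by simp [Real.volume_uIoc]) hmem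
  rw [hvol] at h1
  have h2 : ∫ s in uIoc 0 v, G s ^ 2 ≤ weight γ v * ∫ s, G s ^ 2 / weight γ s := by
    calc ∫ s in uIoc 0 v, G s ^ 2 ≤ ∫ s in uIoc 0 v, weight γ v * (G s ^ 2 / weight γ s) :=
          setIntegral_mono_on hsq (hi.integrableOn.const_mul _) measurableSet_uIoc hle
      _ ≤ ∫ s, weight γ v * (G s ^ 2 / weight γ s) :=
          setIntegral_le_integral (hi.const_mul _) (Eventually.of_forall fun s =>
            mul_nonneg (weight_pos γ v).le (div_nonneg (sq_nonneg _) (weight_pos γ s).le))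
      _ = _ := integral_const_mul _ _
  have h3 : (∫ s in (0 : ℝ)..v, G s) ^ 2 = (∫ s in uIoc 0 v, G s) ^ 2 := by
    rw [← sq_abs, intervalIntegral.abs_intervalIntegral_eq, sq_abs]
  rw [h3]
  calc _ ≤ _ := h1
    _ ≤ |v| * (weight γ v * ∫ s, G s ^ 2 / weight γ s) := by gcongr
    _ = _ := by ring

/-- Interpolation between linear growth and a power tail. -/
theorem integral_le_of_le_abs_of_le_rpow {γ : ℝ} (hγ : 1 / 2 < γ) {h : ℝ → ℝ} {P M : ℝ}
    (hP : 0 ≤ P) (hM : 0 ≤ M) (h0 : ∀ v, 0 ≤ h v)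
    (h1 : ∀ v, h v ≤ |v| * P) (h2 : ∀ v, v ≠ 0 → h v ≤ M * |v| ^ (-(2 * γ))) :
    ∫ v, h v ≤ (2 + 2 * M / (2 * γ - 1)) * P ^ ((2 * γ - 1) / (2 * γ + 1)) := by
  -- The case `P = 0` is separate because the splitting radius below is a negative power of `P`.
  rcases hP.eq_or_lt with rfl | hP
  · have : h = 0 := funext fun v => le_antisymm (by simpa using h1 v) (h0 v)
    rw [this]; simp only [Pi.zero_apply, integral_zero]
    have : 0 < 2 * γ - 1 := by linarith
    positivity
  -- This radius balances the inner contribution `R² P` against the tail `R^(1-2γ)`.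
  set R : ℝ := P ^ (-(1 / (2 * γ + 1))) with hRdef
  have hR : 0 < R := Real.rpow_pos_of_pos hP _
  have e1 : R ^ 2 * P = P ^ ((2 * γ - 1) / (2 * γ + 1)) := by
    rw [hRdef, ← Real.rpow_two, ← Real.rpow_mul hP.le]
    nth_rw 2 [← Real.rpow_one P]
    rw [← Real.rpow_add hP]
    congr 1; field_simp; ring
  have e2 : R ^ (1 - 2 * γ) = P ^ ((2 * γ - 1) / (2 * γ + 1)) := by
    rw [hRdef, ← Real.rpow_mul hP.le]
    congr 1; field_simp; ring
  set k : ℝ → ℝ := fun r => if r ≤ R then R * P else M * r ^ (-(2 * γ)) with hk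
  have hk1 : IntegrableOn k (Ioc 0 R) := by
    refine (integrableOn_const (C := R * P) (by simp)).congr_fun (fun r hr => ?_) measurableSet_Ioc
    simp [hk, hr.2]
  have hk2 : IntegrableOn k (Ioi R) := by
    have : IntegrableOn (fun r : ℝ => M * r ^ (-(2 * γ))) (Ioi R) :=
      (integrableOn_Ioi_rpow_of_lt (by linarith : -(2 * γ) < -1) hR).const_mul M
    refine this.congr_fun
      (fun r hr => ?_) measurableSet_Ioi
    simp [hk, not_le.mpr (mem_Ioi.mp hr)]
  have hk3 : IntegrableOn k (Ioi 0) := by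
    rw [← Ioc_union_Ioi_eq_Ioi hR.le]; exact hk1.union hk2
  have hne : ∀ᵐ v : ℝ, v ≠ 0 := by simp [ae_iff]
  have hkabs : Integrable (fun v => k |v|) := by
    have hg : Integrable ((Ioi 0).indicator k) := hk3.integrable_indicator measurableSet_Ioi
    refine (hg.add hg.comp_neg).congr ?_
    filter_upwards [hne] with v hv
    rcases lt_or_gt_of_ne hv with h | h
    · simp [indicator, h, abs_of_neg h, h.le]
    · simp [indicator, h, abs_of_pos h, h.le]
  have hle : h ≤ᵐ[volume] fun v => k |v| := by
    filter_upwards [hne] with v hv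
    simp only [hk]
    split_ifs with hvR
    · exact (h1 v).trans (by gcongr)
    · exact h2 v hv
  calc ∫ v, h v ≤ ∫ v, k |v| :=
        integral_mono_of_nonneg (Eventually.of_forall h0) hkabs hle
    _ = 2 * ∫ r in Ioi 0, k r := integral_comp_abs
    _ = 2 * (R ^ 2 * P + M * (R ^ (1 - 2 * γ) / (2 * γ - 1))) := by
        rw [← Ioc_union_Ioi_eq_Ioi hR.le,
          setIntegral_union (Ioc_disjoint_Ioi le_rfl) measurableSet_Ioi hk1 hk2]
        congr 2
        · rw [setIntegral_congr_fun (g := fun _ => R * P) measurableSet_Ioc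
            (fun r hr => by simp [hk, hr.2])]
          simp [hR.le]; ring
        · rw [setIntegral_congr_fun (g := fun r => M * r ^ (-(2 * γ))) measurableSet_Ioi
            (fun r hr => by simp [hk, not_le.mpr (mem_Ioi.mp hr)]), integral_const_mul,
            integral_Ioi_rpow_of_lt (by linarith) hR]
          congr 1
          rw [show -(2 * γ) + 1 = 1 - 2 * γ by ring, neg_div, ← div_neg, neg_sub]
    _ = _ := by rw [e1, e2]; ring


/-- The constant is the value at `0` of the continuous representative. The first bound is the growth
of a primitive; the second holds because this value also obeys the sup bound. -/
theorem IsWeakDeriv.exists_const_bound {u G : ℝ → ℝ} (h : IsWeakDeriv u G) {γ A : ℝ}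
    (hγ : 0 ≤ γ) (hA : ∀ᵐ v, |u v| ≤ A) (hi : Integrable (fun v => G v ^ 2 / weight γ v)) :
    ∃ c, (∀ᵐ v, (u v - c) ^ 2 ≤ |v| * weight γ v * ∫ s, G s ^ 2 / weight γ s) ∧
      ∀ᵐ v, (u v - c) ^ 2 ≤ 4 * A ^ 2 := by
  obtain ⟨c, hc⟩ := h.exists_primitive
  refine ⟨c, ?_, ?_⟩
  · filter_upwards [hc] with v hv
    rw [hv, add_sub_cancel_left]
    exact sq_primitive_le hγ h.2.1.aestronglyMeasurable hi v
  · have hcont : Continuous fun v => c + ∫ s in (0 : ℝ)..v, G s :=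
      continuous_const.add (intervalIntegral.continuous_primitive
        (fun a b => (h.2.1.integrableOn_isCompact isCompact_uIcc).intervalIntegrable) 0)
    -- A closed set of full measure is everything, which turns the almost everywhere bound into a
    -- bound at the single point `0`.
    have hall : {v : ℝ | |c + ∫ s in (0 : ℝ)..v, G s| ≤ A} = univ := by
      refine ((isClosed_le hcont.abs continuous_const).closure_eq).symm.trans
        (Measure.dense_of_ae (μ := volume) ?_).closure_eq
      filter_upwards [hc, hA] with v hv hv'
      rwa [← hv]
    have h0 : |c| ≤ A := by
      have : (0 : ℝ) ∈ {v : ℝ | |c + ∫ s in (0 : ℝ)..v, G s| ≤ A} := hall ▸ mem_univ _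
      simpa using this
    filter_upwards [hA] with v hv
    have : |u v - c| ≤ 2 * A := (abs_sub _ _).trans (by linarith)
    calc (u v - c) ^ 2 = |u v - c| ^ 2 := (sq_abs _).symm
      _ ≤ (2 * A) ^ 2 := by gcongr
      _ = _ := by ring

/-- A weak Poincaré inequality for bounded functions and the measure `dv / ω`. -/
theorem IsWeakDeriv.integral_sq_sub_le {u G : ℝ → ℝ} (h : IsWeakDeriv u G) {γ A : ℝ}
    (hγ : 1 / 2 < γ) (hA : ∀ᵐ v, |u v| ≤ A) (hi : Integrable (fun v => G v ^ 2 / weight γ v)) :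
    ∃ c, Integrable (fun v => (u v - c) ^ 2 / weight γ v) ∧
      ∫ v, (u v - c) ^ 2 / weight γ v ≤ (2 + 8 * A ^ 2 / (2 * γ - 1)) *
        (∫ s, G s ^ 2 / weight γ s) ^ ((2 * γ - 1) / (2 * γ + 1)) := by
  have hγ0 : 0 ≤ γ := by linarith
  obtain ⟨c, h1, h2⟩ := h.exists_const_bound hγ0 hA hi
  set P := ∫ s, G s ^ 2 / weight γ s with hPdef
  have hP : 0 ≤ P := integral_nonneg fun s => div_nonneg (sq_nonneg _) (weight_pos γ s).le
  have hmeas : AEStronglyMeasurable (fun v => (u v - c) ^ 2 / weight γ v) volume :=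
    (((h.1.aestronglyMeasurable.sub aestronglyMeasurable_const).pow 2).aemeasurable.div
      (continuous_weight γ).aemeasurable).aestronglyMeasurable
  refine ⟨c, ?_, ?_⟩
  · refine Integrable.mono' ((integrable_inv_weight hγ).const_mul (4 * A ^ 2)) hmeas ?_
    filter_upwards [h2] with v hv
    rw [Real.norm_of_nonneg (div_nonneg (sq_nonneg _) (weight_pos γ v).le), div_eq_mul_inv]
    have := weight_pos γ v
    gcongr
  -- The bounds on `u - c` hold only almost everywhere; their minimum `k` is an explicit continuous
  -- function satisfying the pointwise hypotheses of the interpolation lemma.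
  · set k : ℝ → ℝ := fun v => min (|v| * P) (4 * A ^ 2 / weight γ v)
    have hk0 : ∀ v, 0 ≤ k v := fun v => le_min (by positivity)
      (div_nonneg (by positivity) (weight_pos γ v).le)
    have hkc : Continuous k := (continuous_abs.mul continuous_const).min
      (continuous_const.div (continuous_weight γ) fun v => (weight_pos γ v).ne')
    have hki : Integrable k := by
      refine Integrable.mono' ((integrable_inv_weight hγ).const_mul (4 * A ^ 2))
        hkc.aestronglyMeasurable (Eventually.of_forall fun v => ?_)
      rw [Real.norm_of_nonneg (hk0 v), ← div_eq_mul_inv]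
      exact min_le_right _ _
    calc ∫ v, (u v - c) ^ 2 / weight γ v ≤ ∫ v, k v := by
          refine integral_mono_of_nonneg (Eventually.of_forall fun v =>
            div_nonneg (sq_nonneg _) (weight_pos γ v).le) hki ?_
          filter_upwards [h1, h2] with v hv hv'
          have := weight_pos γ v
          refine le_min ?_ (by gcongr)
          rw [div_le_iff₀ this]; linarith
      _ ≤ (2 + 2 * (4 * A ^ 2) / (2 * γ - 1)) * P ^ ((2 * γ - 1) / (2 * γ + 1)) := by
          refine integral_le_of_le_abs_of_le_rpow hγ hP (by positivity) hk0
            (fun v => min_le_left _ _) fun v hv => (min_le_right _ _).trans ?_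
          rw [div_eq_mul_inv, Real.rpow_neg (abs_nonneg v)]
          have h3 : 0 < |v| ^ (2 * γ) := Real.rpow_pos_of_pos (abs_pos.mpr hv) _
          gcongr
          exact abs_rpow_le_weight hγ0 v
      _ = _ := by ring

/-- Young's inequality applied to `|f| = (|f| √ω)(1/√ω)`; the condition `γ > 1/2` makes `1/ω`
integrable. -/
theorem integrable_of_sq_weight {γ : ℝ} (hγ : 1 / 2 < γ) {f : ℝ → ℝ}
    (hf : AEStronglyMeasurable f volume) (h : Integrable (fun v => f v ^ 2 * weight γ v)) :
    Integrable f := by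
  refine Integrable.mono' (h.add (integrable_inv_weight hγ)) hf (Eventually.of_forall fun v => ?_)
  have hw := weight_pos γ v
  rw [Real.norm_eq_abs, Pi.add_apply]
  have h1 : |f v| = (|f v| * √(weight γ v)) * (√(weight γ v))⁻¹ := by
    rw [mul_assoc, mul_inv_cancel₀ (Real.sqrt_pos.mpr hw).ne', mul_one]
  have h2 : (|f v| * √(weight γ v)) ^ 2 = f v ^ 2 * weight γ v := by
    rw [mul_pow, sq_abs, Real.sq_sqrt hw.le]
  have h3 : ((√(weight γ v))⁻¹) ^ 2 = (weight γ v)⁻¹ := by rw [inv_pow, Real.sq_sqrt hw.le]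
  rw [← h2, ← h3]
  conv_lhs => rw [h1]
  nlinarith [sq_nonneg (|f v| * √(weight γ v) - (√(weight γ v))⁻¹),
    sq_nonneg (|f v| * √(weight γ v)), sq_nonneg ((√(weight γ v))⁻¹)]

theorem equilibrium_eq (γ v : ℝ) :
    equilibrium γ v = ((∫ v, (weight γ v)⁻¹) * weight γ v)⁻¹ := by
  have h0 : 0 ≤ ∫ v, (weight γ v)⁻¹ := integral_nonneg fun v => (inv_pos.mpr (weight_pos γ v)).le
  simp only [equilibrium, normConst, one_div]
  rw [inv_pow, Real.sq_sqrt h0, mul_inv, div_eq_mul_inv]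

/-- With `I = ∫ 1/ω` one has `F = 1/(I ω)`, hence `F^(-1/2) = F^(1/2) I ω`: the deviation is
`F^(1/2)` times `I u - ρ`. -/
theorem sq_rescaled_sub {γ : ℝ} (hγ : 1 / 2 < γ) (v a ρ : ℝ) :
    |a * equilibrium γ v ^ (-(1 / 2) : ℝ) - ρ * equilibrium γ v ^ (1 / 2 : ℝ)| ^ 2
      = (((∫ v, (weight γ v)⁻¹) * (a * weight γ v) - ρ) ^ 2 / weight γ v) /
          ∫ v, (weight γ v)⁻¹ := by
  have hw := weight_pos γ v
  have hI := integral_inv_weight_pos hγ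
  set I := ∫ v, (weight γ v)⁻¹
  have hE : 0 < equilibrium γ v := by rw [equilibrium_eq]; positivity
  have hs : equilibrium γ v ^ (-(1 / 2) : ℝ)
      = equilibrium γ v ^ (1 / 2 : ℝ) * (I * weight γ v) := by
    rw [show (-(1 / 2) : ℝ) = 1 / 2 - 1 by norm_num, Real.rpow_sub_one hE.ne', div_eq_mul_inv]
    congr 1
    rw [equilibrium_eq, inv_inv]
  have hsq : (equilibrium γ v ^ (1 / 2 : ℝ)) ^ 2 = (I * weight γ v)⁻¹ := by
    rw [← Real.sqrt_eq_rpow, Real.sq_sqrt hE.le, equilibrium_eq]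
  rw [sq_abs, hs]
  calc _ = (equilibrium γ v ^ (1 / 2 : ℝ)) ^ 2 * (I * (a * weight γ v) - ρ) ^ 2 := by ring
    _ = _ := by rw [hsq]; field_simp

/-- The weak Poincaré inequality in terms of the deviation from the local equilibrium. -/
theorem lintegral_deviation_rpow_le {γ A : ℝ} (hγ : 1 / 2 < γ) {f G : ℝ → ℝ}
    (h : IsWeakDeriv (fun v => f v * weight γ v) G) (hA : ∀ᵐ v, |f v * weight γ v| ≤ A)
    (hf : Integrable f) (hi : Integrable (fun v => G v ^ 2 / weight γ v)) :
    (∫⁻ v, ENNReal.ofReal (|f v * equilibrium γ v ^ (-(1 / 2) : ℝ)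
        - (∫ v, f v) * equilibrium γ v ^ (1 / 2 : ℝ)| ^ 2)) ^ ((2 * γ + 1) / (2 * γ - 1))
      ≤ ENNReal.ofReal (((∫ v, (weight γ v)⁻¹) * (2 + 8 * A ^ 2 / (2 * γ - 1)))
          ^ ((2 * γ + 1) / (2 * γ - 1))) * ∫⁻ v, ENNReal.ofReal (G v ^ 2 / weight γ v) := by
  have hI := integral_inv_weight_pos hγ
  have hIi := integrable_inv_weight hγ
  obtain ⟨c, hci, hc⟩ := h.integral_sq_sub_le hγ hA hi
  set I := ∫ v, (weight γ v)⁻¹ with hIdef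
  set P := ∫ s, G s ^ 2 / weight γ s with hPdef
  set K := 2 + 8 * A ^ 2 / (2 * γ - 1) with hK
  set ρ := ∫ v, f v with hρ
  have hg1 : 0 < 2 * γ - 1 := by linarith
  have hg2 : 0 < 2 * γ + 1 := by linarith
  have hK0 : 0 ≤ K := by positivity
  have hP : 0 ≤ P := integral_nonneg fun s => div_nonneg (sq_nonneg _) (weight_pos γ s).le
  set X := ∫ v, (f v * weight γ v - c) ^ 2 / weight γ v with hX
  set d := ρ - I * c with hd
  have hdi : Integrable (fun v => f v - c * (weight γ v)⁻¹) := hf.sub (hIi.const_mul c)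
  have hdint : ∫ v, (f v - c * (weight γ v)⁻¹) = d := by
    rw [integral_sub hf (hIi.const_mul c), integral_const_mul]; ring
  -- Expansion of the square of `I u - ρ = I (u - c) - d`. After integration it yields `I X - d²`,
  -- so passing from `c` to the mean only decreases the integral.
  have e : ∀ v, ((I * (f v * weight γ v) - ρ) ^ 2 / weight γ v) / I
      = I * ((f v * weight γ v - c) ^ 2 / weight γ v)
        - 2 * d * (f v - c * (weight γ v)⁻¹) + d ^ 2 / I * (weight γ v)⁻¹ := by
    intro v
    have := weight_pos γ v
    rw [show ρ = d + I * c by rw [hd]; ring]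
    field_simp
    ring
  have hint : Integrable (fun v => ((I * (f v * weight γ v) - ρ) ^ 2 / weight γ v) / I) := by
    simp_rw [e]
    exact ((hci.const_mul I).sub (hdi.const_mul _)).add (hIi.const_mul _)
  have hval : ∫ v, ((I * (f v * weight γ v) - ρ) ^ 2 / weight γ v) / I = I * X - d ^ 2 := by
    simp_rw [e]
    have i1 : Integrable (fun v => I * ((f v * weight γ v - c) ^ 2 / weight γ v)
        - 2 * d * (f v - c * (weight γ v)⁻¹)) := (hci.const_mul I).sub (hdi.const_mul _)
    rw [integral_add i1 (hIi.const_mul _), integral_sub (hci.const_mul I) (hdi.const_mul _),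
      integral_const_mul, integral_const_mul, integral_const_mul, hdint, ← hIdef]
    field_simp
    ring
  have hnn : ∀ v, 0 ≤ ((I * (f v * weight γ v) - ρ) ^ 2 / weight γ v) / I := fun v =>
    div_nonneg (div_nonneg (sq_nonneg _) (weight_pos γ v).le) hI.le
  simp_rw [sq_rescaled_sub hγ]
  rw [← ofReal_integral_eq_lintegral_ofReal hint (Eventually.of_forall hnn),
    ← ofReal_integral_eq_lintegral_ofReal hi (Eventually.of_forall fun v =>
      div_nonneg (sq_nonneg _) (weight_pos γ v).le), hval,
    ENNReal.ofReal_rpow_of_nonneg (hval ▸ integral_nonneg hnn) (by positivity),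
    ← ENNReal.ofReal_mul (by positivity)]
  refine ENNReal.ofReal_le_ofReal ?_
  have hle : I * X - d ^ 2 ≤ I * K * P ^ ((2 * γ - 1) / (2 * γ + 1)) := by
    have : I * X ≤ I * (K * P ^ ((2 * γ - 1) / (2 * γ + 1))) := by gcongr
    nlinarith [sq_nonneg d]
  calc (I * X - d ^ 2) ^ ((2 * γ + 1) / (2 * γ - 1))
      ≤ (I * K * P ^ ((2 * γ - 1) / (2 * γ + 1))) ^ ((2 * γ + 1) / (2 * γ - 1)) :=
        Real.rpow_le_rpow (hval ▸ integral_nonneg hnn) hle (by positivity)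
    _ = (I * K) ^ ((2 * γ + 1) / (2 * γ - 1)) * P := by
        rw [Real.mul_rpow (by positivity) (by positivity), ← Real.rpow_mul hP]
        congr 1
        -- The outer exponent is the reciprocal of the one in the weak Poincaré inequality, which
        -- makes the bound linear in `P`.
        rw [show (2 * γ - 1) / (2 * γ + 1) * ((2 * γ + 1) / (2 * γ - 1)) = 1 by field_simp,
          Real.rpow_one]

/-! ### Entropy balance for solutions regular in time and space -/

/-- Solutions `u = ω f` of the kinetic equation that are differentiable in `(t, x)`, with transport
derivative `D`, weak `v`-derivative `G` and source `S`; the equation holds for times before `τ`. -/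
structure IsRegularSolution (γ θ ε τ : ℝ) (u D G S : (ℝ × ℝ) × ℝ → ℝ) : Prop where
  memLp_u : MemLp (fun p => u p / √(weight γ p.2)) 2 volume
  memLp_D : ∀ ψ : ℝ → ℝ, Continuous ψ → HasCompactSupport ψ →
    MemLp (fun p => ψ p.2 * (D p / √(weight γ p.2))) 2 volume
  memLp_G : MemLp (fun p => G p / √(weight γ p.2)) 2 volume
  memLp_S : MemLp (fun p => S p * √(weight γ p.2)) 2 volume
  hasLineDerivAt : ∀ᵐ v, ∀ z, HasLineDerivAt ℝ (fun z => u (z, v)) (D (z, v)) z (θ, ε * v)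
  weak_u : ∀ z, IsWeakDeriv (fun v => u (z, v)) (fun v => G (z, v))
  weak_G : ∀ z : ℝ × ℝ, z.1 < τ → IsWeakDeriv (fun v => G (z, v) / weight γ v)
    (fun v => D (z, v) / weight γ v - θ * S (z, v))

/-- A convex function `Φ` with derivatives `P`, `P'`, a shift `m(t)` and a time weight `χ(t)`,
such that the entropy `χ(t) Φ(u - m(t))` is quadratically controlled. -/
structure IsEntropy (τ M : ℝ) (Φ P P' χ χ' m m' : ℝ → ℝ) : Prop where
  hasDerivAt_Φ : ∀ r, HasDerivAt Φ (P r) r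
  hasDerivAt_P : ∀ r, HasDerivAt P (P' r) r
  continuous_P' : Continuous P'
  abs_P'_le : ∀ r, |P' r| ≤ 1
  hasDerivAt_χ : ∀ t, HasDerivAt χ (χ' t) t
  hasDerivAt_m : ∀ t, HasDerivAt m (m' t) t
  continuous_χ' : Continuous χ'
  continuous_m' : Continuous m'
  abs_χ_le : ∀ t, |χ t| ≤ M
  abs_χ'_le : ∀ t, |χ' t| ≤ M
  χ_eq_zero : ∀ t, τ ≤ t → χ t = 0
  abs_P_le : ∀ t r, |P (r - m t)| ≤ |r|
  abs_Φ_le : ∀ t r, |Φ (r - m t)| ≤ r ^ 2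
  abs_P_mul_le : ∀ t r, |P (r - m t) * m' t| ≤ M * r ^ 2

/-- The integrand of the entropy balance. -/
noncomputable def entropyProduction (γ θ : ℝ) (Φ P P' χ χ' m m' : ℝ → ℝ) (u G S : (ℝ × ℝ) × ℝ → ℝ)
    (p : (ℝ × ℝ) × ℝ) : ℝ :=
  -θ * (χ' p.1.1 * Φ (u p - m p.1.1) / weight γ p.2)
    + χ p.1.1 * P' (u p - m p.1.1) * (G p ^ 2 / weight γ p.2)
    + θ * (χ p.1.1 * (P (u p - m p.1.1) * m' p.1.1) / weight γ p.2)
    - θ * (χ p.1.1 * P (u p - m p.1.1) * S p)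

section
variable {γ θ ε τ M : ℝ} {Φ P P' χ χ' m m' : ℝ → ℝ} {u D G S : (ℝ × ℝ) × ℝ → ℝ}

theorem div_sqrt_mul_div_sqrt {w : ℝ} (hw : 0 < w) (a b : ℝ) : a / √w * (b / √w) = a * b / w := by
  rw [div_mul_div_comm, Real.mul_self_sqrt hw.le]

theorem div_sqrt_sq {w : ℝ} (hw : 0 < w) (a : ℝ) : (a / √w) ^ 2 = a ^ 2 / w := by
  rw [div_pow, Real.sq_sqrt hw.le]

theorem aestronglyMeasurable_of_div_sqrt {u : (ℝ × ℝ) × ℝ → ℝ}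
    (h : AEStronglyMeasurable (fun p => u p / √(weight γ p.2)) volume) :
    AEStronglyMeasurable u volume := by
  have h2 : AEStronglyMeasurable (fun p : (ℝ × ℝ) × ℝ => √(weight γ p.2)) volume :=
    (((continuous_weight γ).comp continuous_snd).sqrt).aestronglyMeasurable
  refine (h.mul h2).congr (Eventually.of_forall fun p => ?_)
  exact div_mul_cancel₀ _ (Real.sqrt_pos.mpr (weight_pos γ p.2)).ne'

theorem aestronglyMeasurable_of_mul_sqrt {u : (ℝ × ℝ) × ℝ → ℝ}
    (h : AEStronglyMeasurable (fun p => u p * √(weight γ p.2)) volume) :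
    AEStronglyMeasurable u volume := by
  have h2 : AEStronglyMeasurable (fun p : (ℝ × ℝ) × ℝ => (√(weight γ p.2))⁻¹) volume :=
    ((((continuous_weight γ).comp continuous_snd).sqrt).inv₀ fun p =>
      (Real.sqrt_pos.mpr (weight_pos γ p.2)).ne').aestronglyMeasurable
  refine (h.mul h2).congr (Eventually.of_forall fun p => ?_)
  exact mul_inv_cancel_right₀ (Real.sqrt_pos.mpr (weight_pos γ p.2)).ne' _

theorem aestronglyMeasurable_div_weight {h : (ℝ × ℝ) × ℝ → ℝ} (hh : AEStronglyMeasurable h volume) :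
    AEStronglyMeasurable (fun p => h p / weight γ p.2) volume :=
  (hh.aemeasurable.div ((continuous_weight γ).comp continuous_snd).aemeasurable).aestronglyMeasurable

theorem IsEntropy.continuous_P (h : IsEntropy τ M Φ P P' χ χ' m m') : Continuous P :=
  continuous_iff_continuousAt.mpr fun r => (h.hasDerivAt_P r).continuousAt

theorem IsEntropy.continuous_Φ (h : IsEntropy τ M Φ P P' χ χ' m m') : Continuous Φ :=
  continuous_iff_continuousAt.mpr fun r => (h.hasDerivAt_Φ r).continuousAt

theorem IsEntropy.continuous_χ (h : IsEntropy τ M Φ P P' χ χ' m m') : Continuous χ :=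
  continuous_iff_continuousAt.mpr fun r => (h.hasDerivAt_χ r).continuousAt

theorem IsEntropy.continuous_m (h : IsEntropy τ M Φ P P' χ χ' m m') : Continuous m :=
  continuous_iff_continuousAt.mpr fun r => (h.hasDerivAt_m r).continuousAt

theorem aestronglyMeasurable_time {k : ℝ → ℝ} (hk : Continuous k) :
    AEStronglyMeasurable (fun p : (ℝ × ℝ) × ℝ => k p.1.1) volume :=
  (hk.comp (continuous_fst.comp continuous_fst)).aestronglyMeasurable

theorem aestronglyMeasurable_velocity {k : ℝ → ℝ} (hk : Continuous k) :
    AEStronglyMeasurable (fun p : (ℝ × ℝ) × ℝ => k p.2) volume :=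
  (hk.comp continuous_snd).aestronglyMeasurable

/-- Here `a` stands for a value of the derivative of a velocity cut-off. The bound `C` is kept
explicit: fixed it gives integrability, and tending to zero it removes the cut-off. -/
theorem IsEntropy.norm_term_cutoff_le (e : IsEntropy τ M Φ P P' χ χ' m m')
    {C a : ℝ} (ha : |a| ≤ C) (p : (ℝ × ℝ) × ℝ) :
    ‖χ p.1.1 * a * P (u p - m p.1.1) * (G p / weight γ p.2)‖
      ≤ M * C * (|u p| * |G p| / weight γ p.2) := by
  have hw := weight_pos γ p.2
  have hM : 0 ≤ M := (abs_nonneg _).trans (e.abs_χ_le 0)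
  have hC : 0 ≤ C := (abs_nonneg _).trans ha
  rw [norm_mul, norm_mul, norm_mul, norm_div, Real.norm_of_nonneg hw.le, mul_div_assoc (|u p|),
    ← mul_assoc]
  gcongr
  · exact e.abs_χ_le _
  · exact ha
  · exact e.abs_P_le _ _
  · exact le_rfl

namespace IsRegularSolution
variable (h : IsRegularSolution γ θ ε τ u D G S) (e : IsEntropy τ M Φ P P' χ χ' m m')
include h

theorem meas_u : AEStronglyMeasurable u volume :=
  aestronglyMeasurable_of_div_sqrt h.memLp_u.1
theorem meas_G : AEStronglyMeasurable G volume :=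
  aestronglyMeasurable_of_div_sqrt h.memLp_G.1
theorem meas_S : AEStronglyMeasurable S volume :=
  aestronglyMeasurable_of_mul_sqrt h.memLp_S.1

theorem integrable_sq_u : Integrable (fun p => u p ^ 2 / weight γ p.2) volume :=
  h.memLp_u.integrable_sq.congr (Eventually.of_forall fun p => div_sqrt_sq (weight_pos γ p.2) _)
theorem integrable_sq_G : Integrable (fun p => G p ^ 2 / weight γ p.2) volume :=
  h.memLp_G.integrable_sq.congr (Eventually.of_forall fun p => div_sqrt_sq (weight_pos γ p.2) _)

theorem integrable_u_mul_G : Integrable (fun p => |u p| * |G p| / weight γ p.2) volume := by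
  refine (h.memLp_u.norm.integrable_mul h.memLp_G.norm).congr (Eventually.of_forall fun p => ?_)
  have hw := weight_pos γ p.2
  simp only [Pi.mul_apply, norm_div, Real.norm_eq_abs, abs_of_nonneg (Real.sqrt_nonneg _)]
  exact div_sqrt_mul_div_sqrt hw _ _

theorem integrable_u_mul_S : Integrable (fun p => |u p| * |S p|) volume := by
  refine (h.memLp_u.norm.integrable_mul h.memLp_S.norm).congr (Eventually.of_forall fun p => ?_)
  have hw := Real.sqrt_pos.mpr (weight_pos γ p.2)
  simp only [Pi.mul_apply, norm_div, norm_mul, Real.norm_eq_abs, abs_of_pos hw]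
  field_simp

theorem integrable_u_mul_D {ψ : ℝ → ℝ} (hψ : Continuous ψ) (hc : HasCompactSupport ψ) :
    Integrable (fun p => |u p| * |ψ p.2 * D p| / weight γ p.2) volume := by
  refine (h.memLp_u.norm.integrable_mul (h.memLp_D ψ hψ hc).norm).congr
    (Eventually.of_forall fun p => ?_)
  have hw := weight_pos γ p.2
  simp only [Pi.mul_apply]
  rw [← mul_div_assoc, norm_div, norm_div, Real.norm_eq_abs, Real.norm_eq_abs, Real.norm_eq_abs,
    abs_of_nonneg (Real.sqrt_nonneg _)]
  exact div_sqrt_mul_div_sqrt hw _ _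

include e

theorem meas_shift : AEStronglyMeasurable (fun p => u p - m p.1.1) volume :=
  h.meas_u.sub (aestronglyMeasurable_time e.continuous_m)

theorem meas_P : AEStronglyMeasurable (fun p => P (u p - m p.1.1)) volume :=
  e.continuous_P.comp_aestronglyMeasurable (h.meas_shift e)

theorem integrable_term_Φ {k : ℝ → ℝ} (hk : Continuous k) (hkM : ∀ t, |k t| ≤ M) :
    Integrable (fun p => k p.1.1 * Φ (u p - m p.1.1) / weight γ p.2) volume := by
  refine Integrable.mono' (h.integrable_sq_u.const_mul M) (aestronglyMeasurable_div_weight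
    ((aestronglyMeasurable_time hk).mul (e.continuous_Φ.comp_aestronglyMeasurable (h.meas_shift e))))
    (Eventually.of_forall fun p => ?_)
  have hw := weight_pos γ p.2
  have hM : 0 ≤ M := (abs_nonneg _).trans (hkM 0)
  rw [norm_div, norm_mul, Real.norm_eq_abs, Real.norm_eq_abs, Real.norm_eq_abs, abs_of_pos hw,
    ← mul_div_assoc]
  gcongr
  · exact hkM _
  · exact e.abs_Φ_le _ _

theorem integrable_term_P' :
    Integrable (fun p => χ p.1.1 * P' (u p - m p.1.1) * (G p ^ 2 / weight γ p.2)) volume := by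
  refine Integrable.mono' (h.integrable_sq_G.const_mul M)
    (((aestronglyMeasurable_time e.continuous_χ).mul
      (e.continuous_P'.comp_aestronglyMeasurable (h.meas_shift e))).mul
        h.integrable_sq_G.aestronglyMeasurable) (Eventually.of_forall fun p => ?_)
  have hM : 0 ≤ M := (abs_nonneg _).trans (e.abs_χ_le 0)
  have h0 : 0 ≤ G p ^ 2 / weight γ p.2 := div_nonneg (sq_nonneg _) (weight_pos γ p.2).le
  rw [norm_mul, norm_mul, Real.norm_of_nonneg h0]
  gcongr
  calc |χ p.1.1| * |P' (u p - m p.1.1)| ≤ M * 1 :=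
        mul_le_mul (e.abs_χ_le _) (e.abs_P'_le _) (abs_nonneg _) hM
    _ = M := mul_one M

theorem integrable_term_m :
    Integrable (fun p => χ p.1.1 * (P (u p - m p.1.1) * m' p.1.1) / weight γ p.2) volume := by
  refine Integrable.mono' (h.integrable_sq_u.const_mul (M * M)) (aestronglyMeasurable_div_weight
    ((aestronglyMeasurable_time e.continuous_χ).mul ((h.meas_P e).mul
      (aestronglyMeasurable_time e.continuous_m')))) (Eventually.of_forall fun p => ?_)
  have hw := weight_pos γ p.2
  have hM : 0 ≤ M := (abs_nonneg _).trans (e.abs_χ_le 0)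
  rw [norm_div, norm_mul, Real.norm_eq_abs, Real.norm_eq_abs, Real.norm_eq_abs, abs_of_pos hw,
    ← mul_div_assoc, mul_assoc]
  gcongr
  · exact e.abs_χ_le _
  · exact e.abs_P_mul_le _ _

theorem integrable_term_S :
    Integrable (fun p => χ p.1.1 * P (u p - m p.1.1) * S p) volume := by
  refine Integrable.mono' (h.integrable_u_mul_S.const_mul M)
    (((aestronglyMeasurable_time e.continuous_χ).mul (h.meas_P e)).mul h.meas_S)
    (Eventually.of_forall fun p => ?_)
  have hM : 0 ≤ M := (abs_nonneg _).trans (e.abs_χ_le 0)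
  rw [norm_mul, norm_mul, ← mul_assoc]
  gcongr
  · exact e.abs_χ_le _
  · exact e.abs_P_le _ _
  · exact le_rfl

theorem integrable_term_D {ψ : ℝ → ℝ} (hψ : Continuous ψ) (hc : HasCompactSupport ψ) :
    Integrable (fun p => χ p.1.1 * P (u p - m p.1.1) * (ψ p.2 * D p) / weight γ p.2) volume := by
  have hm : AEStronglyMeasurable (fun p => ψ p.2 * D p) volume := by
    refine aestronglyMeasurable_of_div_sqrt (γ := γ) ((h.memLp_D ψ hψ hc).1.congr
      (Eventually.of_forall fun p => ?_))
    simp only [mul_div_assoc]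
  refine Integrable.mono' ((h.integrable_u_mul_D hψ hc).const_mul M)
    (aestronglyMeasurable_div_weight
      (((aestronglyMeasurable_time e.continuous_χ).mul (h.meas_P e)).mul hm))
    (Eventually.of_forall fun p => ?_)
  have hw := weight_pos γ p.2
  have hM : 0 ≤ M := (abs_nonneg _).trans (e.abs_χ_le 0)
  rw [norm_div, norm_mul, norm_mul, Real.norm_of_nonneg hw.le, ← mul_div_assoc, ← mul_assoc]
  gcongr
  · exact e.abs_χ_le _
  · exact e.abs_P_le _ _
  · exact le_rfl

theorem meas_term_cutoff {k : ℝ → ℝ} (hk : Continuous k) : AEStronglyMeasurable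
    (fun p => χ p.1.1 * k p.2 * P (u p - m p.1.1) * (G p / weight γ p.2)) volume :=
  (((aestronglyMeasurable_time e.continuous_χ).mul (aestronglyMeasurable_velocity hk)).mul
    (h.meas_P e)).mul (aestronglyMeasurable_div_weight h.meas_G)

/-- Each term is dominated by a product of two of the square-integrable functions `u/√ω`, `G/√ω`, `S
√ω`, so no velocity cut-off is needed. The term in `D` is absent, and only that one requires a
cut-off. -/
theorem integrable_entropyProduction :
    Integrable (entropyProduction γ θ Φ P P' χ χ' m m' u G S) volume :=
  ((((h.integrable_term_Φ e e.continuous_χ' e.abs_χ'_le).const_mul (-θ)).add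
    (h.integrable_term_P' e)).add ((h.integrable_term_m e).const_mul θ)).sub
      ((h.integrable_term_S e).const_mul θ)

/-- Integration in `(t, x)` of the transport derivative of the entropy. -/
theorem integral_transport {ψ : ℝ → ℝ} (hψ : Continuous ψ) (hc : HasCompactSupport ψ) :
    ∫ p, (χ p.1.1 * P (u p - m p.1.1) * (ψ p.2 * D p) / weight γ p.2
      + ψ p.2 * (θ * (χ' p.1.1 * Φ (u p - m p.1.1) / weight γ p.2))
      - ψ p.2 * (θ * (χ p.1.1 * (P (u p - m p.1.1) * m' p.1.1) / weight γ p.2))) = 0 := by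
  obtain ⟨C, hC⟩ := hc.exists_bound_of_continuous hψ
  have hψm := aestronglyMeasurable_velocity hψ
  have hψb : ∀ᵐ p : (ℝ × ℝ) × ℝ, ‖ψ p.2‖ ≤ C := Eventually.of_forall fun p => hC _
  have i1 := h.integrable_term_D e hψ hc
  have i2 := ((h.integrable_term_Φ e e.continuous_χ' e.abs_χ'_le).const_mul θ).bdd_mul hψm hψb
  have i3 := ((h.integrable_term_m e).const_mul θ).bdd_mul hψm hψb
  have i4 := (h.integrable_term_Φ e e.continuous_χ e.abs_χ_le).bdd_mul hψm hψb
  have itot := (i1.add i2).sub i3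
  rw [Measure.volume_eq_prod] at itot i4
  -- At fixed `v` the transport field `(θ, ε v)` is constant, so the `(t, x)` integral is taken
  -- first.
  have key := integral_prod_symm _ itot
  rw [← Measure.volume_eq_prod] at key
  refine key.trans (integral_eq_zero_of_ae ?_)
  filter_upwards [h.hasLineDerivAt, itot.prod_left_ae, i4.prod_left_ae] with v hv j1 j2
  have hline : ∀ z : ℝ × ℝ, HasLineDerivAt ℝ
      (fun z => ψ v * (χ z.1 * Φ (u (z, v) - m z.1) / weight γ v))
      (χ z.1 * P (u (z, v) - m z.1) * (ψ v * D (z, v)) / weight γ v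
        + ψ v * (θ * (χ' z.1 * Φ (u (z, v) - m z.1) / weight γ v))
        - ψ v * (θ * (χ z.1 * (P (u (z, v) - m z.1) * m' z.1) / weight γ v))) z (θ, ε * v) := by
    intro z
    have hz := hv z
    unfold HasLineDerivAt at hz ⊢
    have ht : HasDerivAt (fun s : ℝ => (z + s • ((θ, ε * v) : ℝ × ℝ)).1) θ 0 := by
      simpa using ((hasDerivAt_id (0 : ℝ)).mul_const θ).const_add z.1
    have hz0 : z + (0 : ℝ) • ((θ, ε * v) : ℝ × ℝ) = z := by simp
    have a1 := (e.hasDerivAt_χ z.1).comp_of_eq (0 : ℝ) ht (by simp)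
    have a2 := (e.hasDerivAt_m z.1).comp_of_eq (0 : ℝ) ht (by simp)
    have a3 := (e.hasDerivAt_Φ (u (z, v) - m z.1)).comp_of_eq (0 : ℝ) (hz.sub a2)
      (by simp only [Pi.sub_apply, Function.comp_apply, hz0])
    have a4 := (((a1.mul a3).div_const (weight γ v)).const_mul (ψ v))
    refine a4.congr_deriv ?_
    simp only [Pi.sub_apply, Function.comp_apply, hz0]
    ring
  -- Integration by parts against the constant `1`: an integrable directional derivative of an
  -- integrable function has zero integral.
  have hfin := integral_bilinear_hasLineDerivAt_right_eq_neg_left_of_integrable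
    (μ := (volume : Measure (ℝ × ℝ)))
    (f := fun z => ψ v * (χ z.1 * Φ (u (z, v) - m z.1) / weight γ v))
    (f' := fun z => χ z.1 * P (u (z, v) - m z.1) * (ψ v * D (z, v)) / weight γ v
        + ψ v * (θ * (χ' z.1 * Φ (u (z, v) - m z.1) / weight γ v))
        - ψ v * (θ * (χ z.1 * (P (u (z, v) - m z.1) * m' z.1) / weight γ v)))
    (g := fun _ => (1 : ℝ)) (g' := fun _ => (0 : ℝ)) (v := (θ, ε * v))
    (B := ContinuousLinearMap.mul ℝ ℝ) (by simpa using j1) (by simp) (by simpa using j2)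
    (fun z _ => hline z) (fun z _ => by simp [HasLineDerivAt, hasDerivAt_const])
  simp only [ContinuousLinearMap.mul_apply', mul_zero, mul_one, integral_zero] at hfin
  simpa using hfin.symm

/-- The entropy balance with a velocity cut-off. -/
theorem integral_cutoff_entropyProduction {ψ : ℝ → ℝ} (hψ : ContDiff ℝ (⊤ : ℕ∞) ψ)
    (hc : HasCompactSupport ψ) :
    ∫ p, ψ p.2 * entropyProduction γ θ Φ P P' χ χ' m m' u G S p
      = -∫ p, χ p.1.1 * deriv ψ p.2 * P (u p - m p.1.1) * (G p / weight γ p.2) := by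
  obtain ⟨C, hC⟩ := hc.exists_bound_of_continuous hψ.continuous
  have hdc : Continuous (deriv ψ) := hψ.continuous_deriv (by exact_mod_cast le_top)
  obtain ⟨C', hC'⟩ := hc.deriv.exists_bound_of_continuous hdc
  have hψm := aestronglyMeasurable_velocity hψ.continuous
  have hψb : ∀ᵐ p : (ℝ × ℝ) × ℝ, ‖ψ p.2‖ ≤ C := Eventually.of_forall fun p => hC _
  have i1 := h.integrable_term_D e hψ.continuous hc
  have i2 := ((h.integrable_term_Φ e e.continuous_χ' e.abs_χ'_le).const_mul θ).bdd_mul hψm hψb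
  have i3 := ((h.integrable_term_m e).const_mul θ).bdd_mul hψm hψb
  have i4 := ((h.integrable_term_S e).const_mul θ).bdd_mul hψm hψb
  have i5 := (h.integrable_term_P' e).bdd_mul hψm hψb
  have i6 : Integrable
      (fun p => χ p.1.1 * deriv ψ p.2 * P (u p - m p.1.1) * (G p / weight γ p.2)) volume :=
    Integrable.mono' (h.integrable_u_mul_G.const_mul (M * C')) (h.meas_term_cutoff e hdc)
      (Eventually.of_forall fun p => e.norm_term_cutoff_le (hC' p.2) p)
  have hx := h.integral_transport e hψ.continuous hc
  -- At fixed `(t, x)` the equation is tested in `v` with `ψ P(u - m)`. It is available only for `t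
  -- < τ`; afterwards both sides vanish with `χ`.
  have hv : ∫ p, (χ p.1.1 * P (u p - m p.1.1) * (ψ p.2 * D p) / weight γ p.2
        - ψ p.2 * (θ * (χ p.1.1 * P (u p - m p.1.1) * S p)))
      = ∫ p, (-(χ p.1.1 * deriv ψ p.2 * P (u p - m p.1.1) * (G p / weight γ p.2))
        - ψ p.2 * (χ p.1.1 * P' (u p - m p.1.1) * (G p ^ 2 / weight γ p.2))) := by
    have k1 := i1.sub i4
    have k2 := i6.neg.sub i5
    rw [Measure.volume_eq_prod] at k1 k2
    refine (integral_prod _ k1).trans (Eq.trans ?_ (integral_prod _ k2).symm)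
    refine integral_congr_ae (Eventually.of_forall fun z => ?_)
    rcases le_or_gt τ z.1 with hz | hz
    · simp [e.χ_eq_zero _ hz]
    · have := (h.weak_G z hz).integral_comp_mul_eq_neg (h.weak_u z) e.hasDerivAt_P e.abs_P'_le
        (m z.1) hψ hc
      calc _ = ∫ v, χ z.1 * (ψ v * P (u (z, v) - m z.1) *
              (D (z, v) / weight γ v - θ * S (z, v))) :=
            integral_congr_ae (Eventually.of_forall fun v => by
              simp only [Pi.sub_apply]; ring)
        _ = ∫ v, χ z.1 * -(G (z, v) / weight γ v * (deriv ψ v * P (u (z, v) - m z.1)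
              + ψ v * (P' (u (z, v) - m z.1) * G (z, v)))) := by
            rw [integral_const_mul, integral_const_mul, this, integral_neg]
        _ = _ := integral_congr_ae (Eventually.of_forall fun v => by
              simp only [Pi.sub_apply, Pi.neg_apply]; ring)
  -- The production splits into the terms of the tested equation, minus a total transport derivative
  -- with zero integral, plus the dissipation. The dissipation cancels against the one in `hv`,
  -- leaving the cut-off error.
  have e1 : ∀ p, ψ p.2 * entropyProduction γ θ Φ P P' χ χ' m m' u G S p
      = (χ p.1.1 * P (u p - m p.1.1) * (ψ p.2 * D p) / weight γ p.2
          - ψ p.2 * (θ * (χ p.1.1 * P (u p - m p.1.1) * S p)))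
        - (χ p.1.1 * P (u p - m p.1.1) * (ψ p.2 * D p) / weight γ p.2
          + ψ p.2 * (θ * (χ' p.1.1 * Φ (u p - m p.1.1) / weight γ p.2))
          - ψ p.2 * (θ * (χ p.1.1 * (P (u p - m p.1.1) * m' p.1.1) / weight γ p.2)))
        + ψ p.2 * (χ p.1.1 * P' (u p - m p.1.1) * (G p ^ 2 / weight γ p.2)) := fun p => by
    simp only [entropyProduction]; ring
  simp_rw [e1]
  have j1 := i1.sub i4
  have j2 := (i1.add i2).sub i3
  have s1 := integral_add (j1.sub j2) i5
  have s2 := integral_sub j1 j2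
  have s3 := integral_sub i6.neg i5
  simp only [Pi.sub_apply, Pi.add_apply, Pi.neg_apply] at s1 s2 s3
  rw [s1, s2, hx, hv, s3, integral_neg]
  ring

/-- The entropy balance. -/
theorem integral_entropyProduction :
    ∫ p, entropyProduction γ θ Φ P P' χ χ' m m' u G S p = 0 := by
  let b : ContDiffBump (0 : ℝ) := ⟨1, 2, one_pos, one_lt_two⟩
  have hbc : HasCompactSupport b := b.hasCompactSupport
  have hb1 : ContDiff ℝ (⊤ : ℕ∞) b := b.contDiff
  have hdc : Continuous (deriv b) := hb1.continuous_deriv (by exact_mod_cast le_top)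
  obtain ⟨C, hC⟩ := hbc.deriv.exists_bound_of_continuous hdc
  -- Dilated cut-offs increase to the whole line in the limit `ψ n → 1`, while their derivatives are
  -- of size `1/(n+1)`; the error term therefore vanishes.
  set ψ : ℕ → ℝ → ℝ := fun n v => b (((n : ℝ) + 1)⁻¹ * v) with hψ
  have hn : ∀ n : ℕ, 0 < ((n : ℝ) + 1)⁻¹ := fun n => by positivity
  have hψs : ∀ n, ContDiff ℝ (⊤ : ℕ∞) (ψ n) := fun n => hb1.comp (contDiff_const.mul contDiff_id)
  have hψc : ∀ n, HasCompactSupport (ψ n) := fun n => by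
    have := hbc.comp_homeomorph (Homeomorph.mulLeft₀ _ (hn n).ne')
    exact this
  have hψd : ∀ n v, deriv (ψ n) v = ((n : ℝ) + 1)⁻¹ * deriv b (((n : ℝ) + 1)⁻¹ * v) := by
    intro n v
    have := (((hb1.differentiable (by simp)) (((n : ℝ) + 1)⁻¹ * v)).hasDerivAt).comp v
      ((hasDerivAt_id v).const_mul ((n : ℝ) + 1)⁻¹)
    have h2 := this.deriv
    simp only [mul_one] at h2
    rw [mul_comm]
    exact h2
  have hlim0 : Tendsto (fun n : ℕ => ((n : ℝ) + 1)⁻¹) atTop (𝓝 0) := by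
    simpa using tendsto_one_div_add_atTop_nhds_zero_nat (𝕜 := ℝ)
  have l1 : Tendsto (fun n => ∫ p, ψ n p.2 * entropyProduction γ θ Φ P P' χ χ' m m' u G S p)
      atTop (𝓝 (∫ p, entropyProduction γ θ Φ P P' χ χ' m m' u G S p)) := by
    have hI := h.integrable_entropyProduction e
    refine tendsto_integral_of_dominated_convergence _
      (fun n => (aestronglyMeasurable_velocity (hψs n).continuous).mul hI.aestronglyMeasurable)
      hI.norm (fun n => Eventually.of_forall fun p => ?_) (Eventually.of_forall fun p => ?_)
    · rw [norm_mul]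
      refine mul_le_of_le_one_left (norm_nonneg _) ?_
      rw [Real.norm_of_nonneg b.nonneg]
      exact b.le_one
    · have h1 : Tendsto (fun n : ℕ => ((n : ℝ) + 1)⁻¹ * p.2) atTop (𝓝 0) := by
        simpa using hlim0.mul_const p.2
      have h2 : Tendsto (fun n => ψ n p.2) atTop (𝓝 1) := by
        have h3 : b 0 = 1 := b.eventuallyEq_one.eq_of_nhds
        exact h3 ▸ (hb1.continuous.tendsto 0).comp h1
      simpa using h2.mul_const _
  have l2 : Tendsto (fun n => ∫ p, χ p.1.1 * deriv (ψ n) p.2 * P (u p - m p.1.1)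
      * (G p / weight γ p.2)) atTop (𝓝 0) := by
    have hbound : ∀ n v, |deriv (ψ n) v| ≤ ((n : ℝ) + 1)⁻¹ * C := fun n v => by
      rw [hψd, abs_mul, abs_of_pos (hn n)]
      have := hn n
      gcongr
      exact hC _
    have h0 := (hlim0.mul_const C).const_mul M |>.mul_const
      (∫ p, |u p| * |G p| / weight γ p.2)
    simp only [zero_mul, mul_zero] at h0
    refine squeeze_zero_norm (fun n => ?_) h0
    refine (norm_integral_le_of_norm_le (h.integrable_u_mul_G.const_mul (M * _))
      (Eventually.of_forall fun p => e.norm_term_cutoff_le (hbound n p.2) p)).trans ?_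
    rw [integral_const_mul]
  have l3 := l2.neg
  simp only [neg_zero] at l3
  refine tendsto_nhds_unique l1 (l3.congr fun n => ?_)
  exact (h.integral_cutoff_entropyProduction e (hψs n) (hψc n)).symm

end IsRegularSolution
end

/-! ### Averages against kernels in time and space -/

theorem hasCompactSupport_tensor {Y : Type*} [TopologicalSpace Y] [T2Space Y] {a : Y → ℝ} {b : ℝ → ℝ} (ha : HasCompactSupport a)
    (hb : HasCompactSupport b) : HasCompactSupport (fun q : Y × ℝ => a q.1 * b q.2) := by
  refine HasCompactSupport.of_support_subset_isCompact (ha.isCompact.prod hb.isCompact) ?_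
  intro q hq
  exact ⟨subset_tsupport _ (left_ne_zero_of_mul hq), subset_tsupport _ (right_ne_zero_of_mul hq)⟩

section
variable {Y : Type*} [MeasureSpace Y]

/-- The averages `∫ κ(z, y) h(y, v) dy` of a function `h` against a kernel. -/
noncomputable def average (κ : ℝ × ℝ → Y → ℝ) (h : Y × ℝ → ℝ) (p : (ℝ × ℝ) × ℝ) : ℝ :=
  ∫ y, κ p.1 y * h (y, p.2)

/-- Jointly measurable bounded kernels with integrable rows and columns. -/
structure IsAveragingKernel (κ : ℝ × ℝ → Y → ℝ) (K L B : ℝ) : Prop where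
  meas : StronglyMeasurable (fun q : (ℝ × ℝ) × Y => κ q.1 q.2)
  col : ∀ y, Integrable (fun z => κ z y) volume
  col_le : ∀ y, ∫ z, |κ z y| ≤ K
  row : ∀ z, Integrable (κ z) volume
  row_le : ∀ z, ∫ y, |κ z y| ≤ L
  bound : ∀ z y, |κ z y| ≤ B

variable {κ : ℝ × ℝ → Y → ℝ} {K L B : ℝ} {h : Y × ℝ → ℝ}

theorem average_mul_velocity (a : ℝ → ℝ) (p : (ℝ × ℝ) × ℝ) :
    average κ (fun q => h q * a q.2) p = average κ h p * a p.2 := by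
  simp only [average]
  rw [← integral_mul_const]
  simp_rw [mul_assoc]

theorem average_div_velocity (a : ℝ → ℝ) (p : (ℝ × ℝ) × ℝ) :
    average κ (fun q => h q / a q.2) p = average κ h p / a p.2 := by
  simp_rw [div_eq_mul_inv]
  exact average_mul_velocity (fun v => (a v)⁻¹) p

theorem IsAveragingKernel.abs (k : IsAveragingKernel κ K L B) :
    IsAveragingKernel (fun z y => |κ z y|) K L B where
  meas := by simpa only [Real.norm_eq_abs] using k.meas.norm
  col y := (k.col y).abs
  col_le y := by simpa using k.col_le y
  row z := (k.row z).abs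
  row_le z := by simpa using k.row_le z
  bound z y := by simpa using k.bound z y

theorem IsAveragingKernel.stronglyMeasurable_integrand (k : IsAveragingKernel κ K L B)
    (hm : StronglyMeasurable h) : StronglyMeasurable
    (fun x : ((ℝ × ℝ) × ℝ) × Y => κ x.1.1 x.2 * h (x.2, x.1.2)) :=
  (k.meas.comp_measurable (by fun_prop : Measurable
    fun x : ((ℝ × ℝ) × ℝ) × Y => (x.1.1, x.2))).mul
    (hm.comp_measurable (by fun_prop : Measurable
      fun x : ((ℝ × ℝ) × ℝ) × Y => (x.2, x.1.2)))

theorem average_mul_eq {z : ℝ × ℝ} (ψ : ℝ → ℝ) (v : ℝ) :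
    average κ h (z, v) * ψ v = ∫ y, κ z y * ψ v * h (y, v) := by
  rw [average, ← integral_mul_const]
  congr 1; funext y; ring

variable [SigmaFinite (volume : Measure Y)]

/-- Exchange of the outer and inner variables. -/
theorem measurePreserving_exchange : MeasurePreserving
    (fun x : ((ℝ × ℝ) × ℝ) × Y => ((x.2, x.1.2), x.1.1))
    (volume : Measure (((ℝ × ℝ) × ℝ) × Y)) (volume : Measure ((Y × ℝ) × (ℝ × ℝ))) := by
  have h1 : MeasurePreserving (MeasurableEquiv.prodAssoc : ((ℝ × ℝ) × ℝ) × Y ≃ᵐ _)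
      volume volume := volume_preserving_prodAssoc
  have h2 : MeasurePreserving (Prod.swap : (ℝ × ℝ) × (ℝ × Y) → (ℝ × Y) × (ℝ × ℝ))
      volume volume := Measure.measurePreserving_swap
  have h3 : MeasurePreserving (Prod.map (Prod.swap : ℝ × Y → Y × ℝ) (id : ℝ × ℝ → ℝ × ℝ))
      volume volume := Measure.measurePreserving_swap.prod (MeasurePreserving.id volume)
  exact h3.comp (h2.comp h1)

theorem measurableEmbedding_exchange : MeasurableEmbedding
    (fun x : ((ℝ × ℝ) × ℝ) × Y => ((x.2, x.1.2), x.1.1)) := by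
  let e : ((ℝ × ℝ) × ℝ) × Y ≃ᵐ (Y × ℝ) × (ℝ × ℝ) :=
    { toFun := fun x => ((x.2, x.1.2), x.1.1)
      invFun := fun x => ((x.2, x.1.2), x.1.1)
      left_inv := fun x => rfl
      right_inv := fun x => rfl
      measurable_toFun := (by fun_prop : Measurable
        fun x : ((ℝ × ℝ) × ℝ) × Y => ((x.2, x.1.2), x.1.1))
      measurable_invFun := (by fun_prop : Measurable
        fun x : (Y × ℝ) × (ℝ × ℝ) => ((x.2, x.1.2), x.1.1)) }
  exact e.measurableEmbedding

namespace IsAveragingKernel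
variable (k : IsAveragingKernel κ K L B)
include k

theorem stronglyMeasurable_average (hm : StronglyMeasurable h) :
    StronglyMeasurable (average κ h) :=
  (k.stronglyMeasurable_integrand hm).integral_prod_right

/-- Integrating first in the outer variable `z` costs only the column bound `K`, uniformly in `y`;
what is left is `|h|`. -/
theorem integrable_exchanged (hh : Integrable h volume) (hm : StronglyMeasurable h) : Integrable
    (fun x : (Y × ℝ) × (ℝ × ℝ) => κ x.2 x.1.1 * h x.1) (volume.prod volume) := by
  have hsm : StronglyMeasurable (fun x : (Y × ℝ) × (ℝ × ℝ) => κ x.2 x.1.1 * h x.1) :=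
    (k.meas.comp_measurable (by fun_prop : Measurable
      fun x : (Y × ℝ) × (ℝ × ℝ) => (x.2, x.1.1))).mul (hm.comp_measurable measurable_fst)
  rw [integrable_prod_iff hsm.aestronglyMeasurable]
  refine ⟨Eventually.of_forall fun q => (k.col q.1).mul_const (h q), ?_⟩
  refine Integrable.mono' (hh.norm.const_mul K)
    hsm.norm.integral_prod_right.aestronglyMeasurable (Eventually.of_forall fun q => ?_)
  rw [Real.norm_of_nonneg (integral_nonneg fun z => norm_nonneg _)]
  simp_rw [norm_mul]
  rw [integral_mul_const]
  gcongr
  exact k.col_le q.1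

theorem integrable_integrand (hh : Integrable h volume) (hm : StronglyMeasurable h) : Integrable
    (fun x : ((ℝ × ℝ) × ℝ) × Y => κ x.1.1 x.2 * h (x.2, x.1.2)) (volume.prod volume) :=
  (measurePreserving_exchange (Y := Y)).integrable_comp_of_integrable (k.integrable_exchanged hh hm)

theorem integrable_average (hh : Integrable h volume) (hm : StronglyMeasurable h) :
    Integrable (average κ h) volume :=
  (k.integrable_integrand hh hm).integral_prod_left

/-- Fubini with columns of constant mass. The energy estimate uses it with mass `1`, so that
mollifying the squared datum preserves its integral. -/
theorem integral_average (hh : Integrable h volume) (hm : StronglyMeasurable h) {c : ℝ}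
    (hc : ∀ y, ∫ z, κ z y = c) : ∫ p, average κ h p = c * ∫ q, h q := by
  have h1 := integral_prod _ (k.integrable_integrand hh hm)
  have h2 := (measurePreserving_exchange (Y := Y)).integral_comp measurableEmbedding_exchange
    (fun x : (Y × ℝ) × (ℝ × ℝ) => κ x.2 x.1.1 * h x.1)
  have h3 := integral_prod _ (k.integrable_exchanged hh hm)
  have h4 : ∫ p, average κ h p = ∫ q : Y × ℝ, ∫ z, κ z q.1 * h q :=
    h1.symm.trans (h2.trans h3)
  rw [h4]
  simp_rw [integral_mul_const, hc]
  rw [integral_const_mul]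

/-- The Cauchy–Schwarz inequality for averages. -/
theorem sq_average_le (hh : MemLp h 2 volume) : ∀ᵐ v, ∀ z,
    average κ h (z, v) ^ 2 ≤ (∫ y, |κ z y|) * average (fun z y => |κ z y|) (fun q => h q ^ 2) (z, v) := by
  have h2 : Integrable (fun q => h q ^ 2) (volume.prod volume) := hh.integrable_sq
  have h1 : AEStronglyMeasurable h (volume.prod volume) := hh.1
  filter_upwards [h2.prod_left_ae, h1.prodMk_right] with v hv hmv z
  -- Cauchy–Schwarz is applied to `|κ h| = √|κ| · (√|κ| |h|)`, so that the kernel acts as a measure.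
  have hsq : StronglyMeasurable (fun y => √|κ z y|) := by
    have h3 : StronglyMeasurable (κ z) := k.meas.comp_measurable measurable_prodMk_left
    exact Real.continuous_sqrt.comp_stronglyMeasurable
      (continuous_abs.comp_stronglyMeasurable h3)
  have m1 : MemLp (fun y => √|κ z y|) 2 volume := by
    rw [memLp_two_iff_integrable_sq hsq.aestronglyMeasurable]
    simp_rw [Real.sq_sqrt (abs_nonneg _)]
    exact (k.row z).abs
  have hi : Integrable (fun y => |κ z y| * h (y, v) ^ 2) volume := by
    refine hv.bdd_mul (c := B) ?_ (Eventually.of_forall fun y => by simpa using k.bound z y)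
    exact (k.row z).abs.aestronglyMeasurable
  have e : ∀ y, (√|κ z y| * |h (y, v)|) ^ 2 = |κ z y| * h (y, v) ^ 2 := fun y => by
    rw [mul_pow, Real.sq_sqrt (abs_nonneg _), sq_abs]
  have m2 : MemLp (fun y => √|κ z y| * |h (y, v)|) 2 volume := by
    refine (memLp_two_iff_integrable_sq (hsq.aestronglyMeasurable.mul hmv.norm)).2 ?_
    exact hi.congr (Eventually.of_forall fun y => (e y).symm)
  have key := sq_integral_mul_le m1 m2
  simp_rw [e, Real.sq_sqrt (abs_nonneg _)] at key
  have e2 : ∀ y, √|κ z y| * (√|κ z y| * |h (y, v)|) = |κ z y * h (y, v)| := fun y => by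
    rw [← mul_assoc, Real.mul_self_sqrt (abs_nonneg _), abs_mul]
  simp_rw [e2] at key
  refine le_trans ?_ key
  rw [← sq_abs]
  exact pow_le_pow_left₀ (abs_nonneg _) abs_integral_le_integral_abs 2

/-- Schur's test: the row bound controls the first Cauchy–Schwarz factor pointwise, the column bound
integrates the second. -/
theorem memLp_average (hh : MemLp h 2 volume) (hm : StronglyMeasurable h) :
    MemLp (average κ h) 2 volume := by
  have hsm := k.stronglyMeasurable_average hm
  rw [memLp_two_iff_integrable_sq hsm.aestronglyMeasurable]
  refine Integrable.mono' ((k.abs.integrable_average hh.integrable_sq (hm.pow 2)).const_mul L)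
    (hsm.pow 2).aestronglyMeasurable ?_
  have h1 := k.sq_average_le hh
  have h2 : ∀ᵐ p : (ℝ × ℝ) × ℝ ∂(volume.prod volume), ∀ z,
    average κ h (z, p.2) ^ 2
      ≤ (∫ y, |κ z y|) * average (fun z y => |κ z y|) (fun q => h q ^ 2) (z, p.2) :=
    Measure.quasiMeasurePreserving_snd.ae h1
  filter_upwards [h2] with p hp
  rw [Real.norm_of_nonneg (sq_nonneg _)]
  refine (hp p.1).trans ?_
  gcongr
  · exact integral_nonneg fun y => mul_nonneg (abs_nonneg _) (sq_nonneg _)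
  · exact k.row_le _

end IsAveragingKernel
end

section
variable {Y : Type*} [NormedAddCommGroup Y] [MeasureSpace Y] [BorelSpace Y]
  [SecondCountableTopology Y] [SigmaFinite (volume : Measure Y)] {κ : ℝ × ℝ → Y → ℝ}
  {h : Y × ℝ → ℝ} {z : ℝ × ℝ}

theorem integrable_tensor_mul (hh : LocallyIntegrable h volume) {a : Y → ℝ} {b : ℝ → ℝ}
    (hac : Continuous a) (ha : HasCompactSupport a) (hbc : Continuous b)
    (hb : HasCompactSupport b) :
    Integrable (fun q : Y × ℝ => a q.1 * b q.2 * h q) (volume.prod volume) :=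
  hh.integrable_smul_left_of_hasCompactSupport
    ((hac.comp continuous_fst).mul (hbc.comp continuous_snd)) (hasCompactSupport_tensor ha hb)

theorem integrable_average_mul (hh : LocallyIntegrable h volume) (hac : Continuous (κ z))
    (ha : HasCompactSupport (κ z)) {ψ : ℝ → ℝ} (hbc : Continuous ψ) (hb : HasCompactSupport ψ) :
    Integrable (fun v => average κ h (z, v) * ψ v) volume := by
  simp_rw [average_mul_eq]
  exact (integrable_tensor_mul hh hac ha hbc hb).integral_prod_right

theorem integral_average_mul (hh : LocallyIntegrable h volume) (hac : Continuous (κ z))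
    (ha : HasCompactSupport (κ z)) {ψ : ℝ → ℝ} (hbc : Continuous ψ) (hb : HasCompactSupport ψ) :
    ∫ v, average κ h (z, v) * ψ v = ∫ q, κ z q.1 * ψ q.2 * h q := by
  simp_rw [average_mul_eq]
  exact (integral_prod_symm _ (integrable_tensor_mul hh hac ha hbc hb)).symm

/-- A bump equal to `1` on a ball containing the given compact set reduces the claim to
`integrable_average_mul`. -/
theorem locallyIntegrable_average (hh : LocallyIntegrable h volume) (hac : Continuous (κ z))
    (ha : HasCompactSupport (κ z)) : LocallyIntegrable (fun v => average κ h (z, v)) volume := by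
  rw [locallyIntegrable_iff]
  intro s hs
  obtain ⟨R, hR⟩ := hs.isBounded.subset_closedBall (0 : ℝ)
  have hR1 : 0 < |R| + 1 := by positivity
  let b : ContDiffBump (0 : ℝ) := ⟨|R| + 1, |R| + 2, hR1, by linarith⟩
  have := integrable_average_mul hh hac ha (ψ := b) b.continuous b.hasCompactSupport
  refine (this.integrableOn (s := s)).congr_fun (fun v hv => ?_) hs.measurableSet
  have hvb : v ∈ Metric.closedBall (0 : ℝ) b.rIn :=
    Metric.closedBall_subset_closedBall (by change R ≤ |R| + 1; linarith [le_abs_self R]) (hR hv)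
  change _ * b v = _
  rw [b.one_of_mem_closedBall hvb, mul_one]

end

theorem memLp_two_locallyIntegrable {Y : Type*} [NormedAddCommGroup Y] [MeasureSpace Y]
    [BorelSpace Y] [SecondCountableTopology Y] [SigmaFinite (volume : Measure Y)]
    [IsLocallyFiniteMeasure (volume : Measure (Y × ℝ))] [LocallyCompactSpace Y]
    {u : Y × ℝ → ℝ} {a : ℝ → ℝ} (ha : Continuous a) (h0 : ∀ v, a v ≠ 0)
    (h : MemLp (fun q => u q * a q.2) 2 volume) : LocallyIntegrable u volume := by
  have h1 := h.locallyIntegrable (by norm_num)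
  have h2 : Continuous (fun q : Y × ℝ => (a q.2)⁻¹) :=
    (ha.comp continuous_snd).inv₀ fun q => h0 q.2
  have h3 := h1.mul_continuous h2
  refine h3.congr (Eventually.of_forall fun q => ?_)
  exact mul_inv_cancel_right₀ (h0 q.2) _

/-! ### Mollification of weak solutions in time and space -/

/-- Weak solutions of the kinetic equation for `u = ω f`, extended by zero outside the time
interval `(0, T)`, in the coordinates `((t, x), v)`, tested against tensor products. -/
structure IsKineticSolution (γ θ ε T : ℝ) (f₀ : ℝ × ℝ → ℝ) (u G : (ℝ × ℝ) × ℝ → ℝ) : Prop where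
  meas_u : StronglyMeasurable u
  meas_G : StronglyMeasurable G
  meas_f₀ : StronglyMeasurable f₀
  memLp_u : MemLp (fun p => u p / √(weight γ p.2)) 2 volume
  memLp_G : MemLp (fun p => G p / √(weight γ p.2)) 2 volume
  memLp_f₀ : MemLp (fun q => f₀ q * √(weight γ q.2)) 2 volume
  weak_u : ∀ᵐ z, IsWeakDeriv (fun v => u (z, v)) (fun v => G (z, v))
  equation : ∀ k : ℝ × ℝ → ℝ, ∀ ψ : ℝ → ℝ, ContDiff ℝ (⊤ : ℕ∞) k → HasCompactSupport k →
    tsupport k ⊆ Iio T ×ˢ univ → ContDiff ℝ (⊤ : ℕ∞) ψ → HasCompactSupport ψ →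
    (∫ p, u p / weight γ p.2 * ((θ * fderiv ℝ k p.1 (1, 0) + ε * p.2 * fderiv ℝ k p.1 (0, 1))
        * ψ p.2)) + θ * ∫ q : ℝ × ℝ, f₀ q * (k (0, q.1) * ψ q.2)
      = ∫ p, G p / weight γ p.2 * (k p.1 * deriv ψ p.2)

/-- The convolution kernel in `(t, x)`. -/
def convKernel (k : ℝ × ℝ → ℝ) (z y : ℝ × ℝ) : ℝ := k (z - y)

/-- The convolution kernel in `x`, acting on initial data. -/
def initialKernel (k : ℝ × ℝ → ℝ) (z : ℝ × ℝ) (y : ℝ) : ℝ := k (z - (0, y))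

section kernels
variable {k : ℝ × ℝ → ℝ} (hk : Continuous k) (hc : HasCompactSupport k)
include hk hc

theorem isAveragingKernel_convKernel :
    ∃ B, IsAveragingKernel (convKernel k) (∫ z, |k z|) (∫ z, |k z|) B := by
  obtain ⟨B, hB⟩ := hc.exists_bound_of_continuous hk
  have hi := hk.integrable_of_hasCompactSupport (μ := volume) hc
  refine ⟨B, ⟨?_, fun y => hi.comp_sub_right y, fun y => ?_, fun z => hi.comp_sub_left z, fun z => ?_,
    fun z y => hB _⟩⟩
  · exact (hk.comp (continuous_fst.sub continuous_snd)).stronglyMeasurable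
  · exact (integral_sub_right_eq_self (fun z => |k z|) y).le
  · exact (integral_sub_left_eq_self (fun z => |k z|) volume z).le

theorem hasCompactSupport_initialKernel (z : ℝ × ℝ) : HasCompactSupport (initialKernel k z) := by
  have h1 : IsCompact ((fun w : ℝ × ℝ => z.2 - w.2) '' tsupport k) :=
    hc.isCompact.image (by fun_prop)
  refine HasCompactSupport.of_support_subset_isCompact h1 fun y hy => ?_
  exact ⟨z - (0, y), subset_tsupport _ hy, by simp⟩

theorem continuous_initialKernel (z : ℝ × ℝ) : Continuous (initialKernel k z) :=
  hk.comp (by fun_prop)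

theorem continuous_integral_slice : Continuous (fun t : ℝ => ∫ y : ℝ, k (t, y)) := by
  obtain ⟨R, hR⟩ := hc.isCompact.isBounded.subset_closedBall (0 : ℝ × ℝ)
  have hz : ∀ t y, y ∉ Icc (-R) R → k (t, y) = 0 := fun t y hy => by
    refine image_eq_zero_of_notMem_tsupport fun hm => hy ?_
    have := hR hm
    rw [mem_closedBall_zero_iff, Prod.norm_def] at this
    exact abs_le.mp ((le_max_right _ _).trans this)
  have e : (fun t : ℝ => ∫ y : ℝ, k (t, y)) = fun t => ∫ y in Icc (-R) R, k (t, y) := by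
    funext t
    exact (setIntegral_eq_integral_of_forall_compl_eq_zero (hz t)).symm
  rw [e]
  exact continuous_parametric_integral_of_continuous (f := fun t y => k (t, y))
    (hk.comp (by fun_prop : Continuous fun p : ℝ × ℝ => (p.1, p.2))) isCompact_Icc

theorem hasCompactSupport_integral_slice : HasCompactSupport (fun t : ℝ => ∫ y : ℝ, k (t, y)) := by
  have h1 : IsCompact (Prod.fst '' tsupport k) := hc.isCompact.image continuous_fst
  refine HasCompactSupport.of_support_subset_isCompact h1 fun t ht => ?_
  by_contra hn
  refine ht (integral_eq_zero_of_ae (Eventually.of_forall fun y => ?_))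
  exact image_eq_zero_of_notMem_tsupport fun hm => hn ⟨(t, y), hm, rfl⟩

theorem integral_initialKernel (z : ℝ × ℝ) :
    ∫ y, initialKernel k z y = ∫ y, k (z.1, y) := by
  have := integral_sub_left_eq_self (fun y => k (z.1, y)) volume z.2
  rw [← this]
  refine integral_congr_ae (Eventually.of_forall fun y => ?_)
  simp [initialKernel, Prod.sub_def]

/-- A row at `z` integrates `|k|` over the slice at time `z.1` only. Its bound `L` is thus the
supremum of the time marginal of `|k|`, which is continuous with compact support. -/
theorem isAveragingKernel_initialKernel :
    ∃ L B, IsAveragingKernel (initialKernel k) (∫ z, |k z|) L B := by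
  obtain ⟨B, hB⟩ := hc.exists_bound_of_continuous hk
  have hc' : HasCompactSupport (fun z => |k z|) := hc.comp_left abs_zero
  obtain ⟨L, hL⟩ := (hasCompactSupport_integral_slice hk.abs hc').exists_bound_of_continuous
    (continuous_integral_slice hk.abs hc')
  have hi := hk.integrable_of_hasCompactSupport (μ := volume) hc
  refine ⟨L, B, ⟨?_, fun y => hi.comp_sub_right _, fun y => ?_, fun z => ?_, fun z => ?_,
    fun z y => hB _⟩⟩
  · exact (hk.comp (by fun_prop)).stronglyMeasurable
  · exact (integral_sub_right_eq_self (fun z => |k z|) _).le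
  · exact (continuous_initialKernel hk hc z).integrable_of_hasCompactSupport
      (hasCompactSupport_initialKernel hk hc z)
  · exact (integral_initialKernel hk.abs hc' z).le.trans ((le_abs_self _).trans (hL z.1))

theorem hasCompactSupport_convKernel (z : ℝ × ℝ) : HasCompactSupport (convKernel k z) :=
  hc.comp_homeomorph (Homeomorph.subLeft z)

theorem continuous_convKernel (z : ℝ × ℝ) : Continuous (convKernel k z) :=
  hk.comp (continuous_const.sub continuous_id)

end kernels

theorem average_convKernel_eq_convolution (k : ℝ × ℝ → ℝ) (h : (ℝ × ℝ) × ℝ → ℝ) (z : ℝ × ℝ)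
    (v : ℝ) : average (convKernel k) h (z, v)
      = convolution k (fun y => h (y, v)) (ContinuousLinearMap.lsmul ℝ ℝ) volume z := by
  rw [convolution_eq_swap]; rfl

/-- All derivatives fall on the kernel, so local integrability of the slice at velocity `v`
suffices. -/
theorem hasLineDerivAt_average {k : ℝ × ℝ → ℝ} (hk : ContDiff ℝ (⊤ : ℕ∞) k)
    (hc : HasCompactSupport k) {h : (ℝ × ℝ) × ℝ → ℝ} {v : ℝ}
    (hh : LocallyIntegrable (fun y => h (y, v)) volume) (z : ℝ × ℝ) (a b : ℝ) :
    HasLineDerivAt ℝ (fun z => average (convKernel k) h (z, v))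
      (a * average (convKernel fun z => fderiv ℝ k z (1, 0)) h (z, v)
        + b * average (convKernel fun z => fderiv ℝ k z (0, 1)) h (z, v)) z (a, b) := by
  have hk1 : ContDiff ℝ 1 k := hk.of_le (by exact_mod_cast le_top)
  have h1 := hc.hasFDerivAt_convolution_left (ContinuousLinearMap.lsmul ℝ ℝ) hk1 hh z
  have h2 := h1.hasLineDerivAt (a, b)
  simp_rw [average_convKernel_eq_convolution k]
  refine h2.congr_deriv ?_
  have hdc : Continuous (fderiv ℝ k) := hk.continuous_fderiv (by simp)
  have hint : ∀ w : ℝ × ℝ, Integrable (fun y => fderiv ℝ k (z - y) w * h (y, v)) volume := by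
    intro w
    have c1 : Continuous fun y => fderiv ℝ k (z - y) w :=
      (hdc.comp (continuous_const.sub continuous_id)).clm_apply continuous_const
    have c2 : HasCompactSupport fun y => fderiv ℝ k (z - y) w :=
      (hc.fderiv_apply ℝ w).comp_homeomorph (Homeomorph.subLeft z)
    exact hh.integrable_smul_left_of_hasCompactSupport c1 c2
  rw [convolution_eq_swap, ContinuousLinearMap.integral_apply]
  · simp only [average, convKernel]
    rw [← integral_const_mul, ← integral_const_mul, ← integral_add ((hint _).const_mul a)
      ((hint _).const_mul b)]
    refine integral_congr_ae (Eventually.of_forall fun y => ?_)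
    have e : ((a, b) : ℝ × ℝ) = a • ((1, 0) : ℝ × ℝ) + b • ((0, 1) : ℝ × ℝ) := by simp
    simp only [ContinuousLinearMap.precompL_apply, ContinuousLinearMap.lsmul_apply, smul_eq_mul]
    rw [e, map_add, map_smul, map_smul, smul_eq_mul, smul_eq_mul]
    ring
  · have := (hc.fderiv ℝ).convolutionExists_left ((ContinuousLinearMap.lsmul ℝ ℝ).precompL (ℝ × ℝ))
      hdc hh z
    exact this.integrable_swap

theorem fderiv_comp_sub_left {k : ℝ × ℝ → ℝ} (hk : ContDiff ℝ (⊤ : ℕ∞) k) (z y w : ℝ × ℝ) :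
    fderiv ℝ (convKernel k z) y w = -fderiv ℝ k (z - y) w := by
  have h1 : HasFDerivAt (fun y => z - y) (-ContinuousLinearMap.id ℝ (ℝ × ℝ)) y := by
    simpa using (hasFDerivAt_id y).const_sub z
  have h2 := ((hk.differentiable (by simp) (z - y)).hasFDerivAt).comp y h1
  have h3 : fderiv ℝ (convKernel k z) y = _ := h2.fderiv
  rw [h3]
  simp

theorem locallyIntegrable_of_div_sqrt {Y : Type*} [NormedAddCommGroup Y] [MeasureSpace Y]
    [BorelSpace Y] [SecondCountableTopology Y] [SigmaFinite (volume : Measure Y)]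
    [IsLocallyFiniteMeasure (volume : Measure (Y × ℝ))] [LocallyCompactSpace Y]
    {γ : ℝ} {u : Y × ℝ → ℝ} (h : MemLp (fun q => u q / √(weight γ q.2)) 2 volume) :
    LocallyIntegrable u volume :=
  memLp_two_locallyIntegrable (a := fun v => (√(weight γ v))⁻¹)
    ((continuous_weight γ).sqrt.inv₀ fun v => (Real.sqrt_pos.mpr (weight_pos γ v)).ne')
    (fun v => inv_ne_zero (Real.sqrt_pos.mpr (weight_pos γ v)).ne') h

/-- The mollified transport derivative. -/
noncomputable def transport (θ ε : ℝ) (k : ℝ × ℝ → ℝ) (u : (ℝ × ℝ) × ℝ → ℝ) (p : (ℝ × ℝ) × ℝ) : ℝ :=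
  θ * average (convKernel fun z => fderiv ℝ k z (1, 0)) u p
    + ε * p.2 * average (convKernel fun z => fderiv ℝ k z (0, 1)) u p

section regularization
variable {γ θ ε T δ : ℝ} {f₀ : ℝ × ℝ → ℝ} {u G : (ℝ × ℝ) × ℝ → ℝ} {k : ℝ × ℝ → ℝ}

theorem memLp_average_div_sqrt {κ : ℝ × ℝ → ℝ × ℝ → ℝ} {K L B : ℝ}
    (hκ : IsAveragingKernel κ K L B) (hm : StronglyMeasurable u)
    (hu : MemLp (fun p => u p / √(weight γ p.2)) 2 volume) :
    MemLp (fun p => average κ u p / √(weight γ p.2)) 2 volume := by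
  have hs : StronglyMeasurable (fun p : (ℝ × ℝ) × ℝ => u p / √(weight γ p.2)) :=
    (hm.measurable.div (((continuous_weight γ).comp continuous_snd).sqrt).measurable).stronglyMeasurable
  have := hκ.memLp_average hu hs
  refine (memLp_congr_ae (Eventually.of_forall fun p => ?_)).mp this
  exact average_div_velocity (fun v => √(weight γ v)) p

variable (h : IsKineticSolution γ θ ε T f₀ u G) (hk : ContDiff ℝ (⊤ : ℕ∞) k)
  (hc : HasCompactSupport k)
include h hk hc

/-- The factor `v` in the transport term is unbounded; the compactly supported `ψ` absorbs it, as `v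
ψ(v)` is again an admissible cut-off. -/
theorem IsKineticSolution.memLp_transport {ψ : ℝ → ℝ} (hψ : Continuous ψ)
    (hψc : HasCompactSupport ψ) :
    MemLp (fun p => ψ p.2 * (transport θ ε k u p / √(weight γ p.2))) 2 volume := by
  have hdc : Continuous (fderiv ℝ k) := hk.continuous_fderiv (by simp)
  have key : ∀ (w : ℝ × ℝ) (φ : ℝ → ℝ), Continuous φ → HasCompactSupport φ →
      MemLp (fun p => φ p.2 * (average (convKernel fun z => fderiv ℝ k z w) u p
        / √(weight γ p.2))) 2 volume := by
    intro w φ hφ hφc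
    obtain ⟨C, hC⟩ := hφc.exists_bound_of_continuous hφ
    obtain ⟨B, hB⟩ := isAveragingKernel_convKernel (hdc.clm_apply continuous_const)
      (hc.fderiv_apply ℝ w)
    refine (memLp_average_div_sqrt hB h.meas_u h.memLp_u).of_le_mul (c := C)
      ((aestronglyMeasurable_velocity hφ).mul
        (memLp_average_div_sqrt hB h.meas_u h.memLp_u).1) (Eventually.of_forall fun p => ?_)
    rw [norm_mul]
    gcongr
    exact hC _
  have k1 := (key (1, 0) ψ hψ hψc).const_mul θ
  have k2 := (key (0, 1) (fun v => v * ψ v) (continuous_id.mul hψ) hψc.mul_left).const_mul ε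
  refine (memLp_congr_ae (Eventually.of_forall fun p => ?_)).mp (k1.add k2)
  simp only [Pi.add_apply, transport]
  ring

/-- Averaging in `(t, x)` commutes with `∂ᵥ`; the proof is Fubini after pairing with a test function
of `v`. -/
theorem IsKineticSolution.weak_average (z : ℝ × ℝ) :
    IsWeakDeriv (fun v => average (convKernel k) u (z, v))
      (fun v => average (convKernel k) G (z, v)) := by
  have hu := locallyIntegrable_of_div_sqrt h.memLp_u
  have hG := locallyIntegrable_of_div_sqrt h.memLp_G
  have c1 := continuous_convKernel hk.continuous hc z
  have c2 := hasCompactSupport_convKernel hk.continuous hc z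
  refine ⟨locallyIntegrable_average hu c1 c2, locallyIntegrable_average hG c1 c2,
    fun φ hφ hφc => ?_⟩
  have hd : Continuous (deriv φ) := hφ.continuous_deriv (by exact_mod_cast le_top)
  rw [integral_average_mul hu c1 c2 hd hφc.deriv, integral_average_mul hG c1 c2 hφ.continuous hφc]
  rw [Measure.volume_eq_prod, integral_prod _ (integrable_tensor_mul hu c1 c2 hd hφc.deriv),
    integral_prod _ (integrable_tensor_mul hG c1 c2 hφ.continuous hφc), ← integral_neg]
  refine integral_congr_ae ?_
  filter_upwards [h.weak_u] with y hy
  have := hy.2.2 φ hφ hφc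
  calc _ = ∫ v, convKernel k z y * (u (y, v) * deriv φ v) :=
        integral_congr_ae (Eventually.of_forall fun v => by ring)
    _ = convKernel k z y * -∫ v, G (y, v) * φ v := by rw [integral_const_mul, this]
    _ = _ := by
        rw [mul_neg, ← integral_const_mul]
        congr 1
        exact integral_congr_ae (Eventually.of_forall fun v => by ring)

/-- The weak formulation is tested with `y ↦ k(z - y)` times `ψ(v)`. Derivatives in `y` are minus
those of `k`, which gives the mollified transport, and the trace of the test function at time `0`
gives the source. The condition on `z` keeps the support before the final time `T`. -/
theorem IsKineticSolution.weak_equation (hδ : tsupport k ⊆ Metric.closedBall 0 δ) {z : ℝ × ℝ}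
    (hz : z.1 < T - δ) :
    IsWeakDeriv (fun v => average (convKernel k) G (z, v) / weight γ v)
      (fun v => transport θ ε k u (z, v) / weight γ v
        - θ * average (initialKernel k) f₀ (z, v)) := by
  have hdc : Continuous (fderiv ℝ k) := hk.continuous_fderiv (by simp)
  have hw0 : ∀ v, weight γ v ≠ 0 := fun v => (weight_pos γ v).ne'
  have hwi : Continuous fun v => (weight γ v)⁻¹ := (continuous_weight γ).inv₀ hw0
  have hu := locallyIntegrable_of_div_sqrt h.memLp_u
  have hG := locallyIntegrable_of_div_sqrt h.memLp_G
  have hf₀ : LocallyIntegrable f₀ volume := memLp_two_locallyIntegrable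
    (continuous_weight γ).sqrt (fun v => (Real.sqrt_pos.mpr (weight_pos γ v)).ne') h.memLp_f₀
  have c1 := continuous_convKernel hk.continuous hc z
  have c2 := hasCompactSupport_convKernel hk.continuous hc z
  have d1 : ∀ w : ℝ × ℝ, Continuous (convKernel (fun z => fderiv ℝ k z w) z) := fun w =>
    continuous_convKernel (hdc.clm_apply continuous_const) (hc.fderiv_apply ℝ w) z
  have d2 : ∀ w : ℝ × ℝ, HasCompactSupport (convKernel (fun z => fderiv ℝ k z w) z) := fun w =>
    hasCompactSupport_convKernel (hdc.clm_apply continuous_const) (hc.fderiv_apply ℝ w) z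
  have i1 := continuous_initialKernel hk.continuous hc z
  have i2 := hasCompactSupport_initialKernel hk.continuous hc z
  have lu : ∀ w : ℝ × ℝ, LocallyIntegrable
      (fun v => average (convKernel fun z => fderiv ℝ k z w) u (z, v)) volume := fun w =>
    locallyIntegrable_average hu (d1 w) (d2 w)
  have eT : ∀ v, transport θ ε k u (z, v) / weight γ v
      = average (convKernel fun z => fderiv ℝ k z (1, 0)) u (z, v) * (θ * (weight γ v)⁻¹)
        + average (convKernel fun z => fderiv ℝ k z (0, 1)) u (z, v)
          * (ε * v * (weight γ v)⁻¹) := fun v => by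
    simp only [transport]; ring
  have hcT1 : Continuous fun v => θ * (weight γ v)⁻¹ := continuous_const.mul hwi
  have hcT2 : Continuous fun v => ε * v * (weight γ v)⁻¹ :=
    (continuous_const.mul continuous_id).mul hwi
  refine ⟨?_, ?_, fun ψ hψ hψc => ?_⟩
  · simp_rw [div_eq_mul_inv]
    exact (locallyIntegrable_average hG c1 c2).mul_continuous hwi
  · simp_rw [eT]
    exact (((lu _).mul_continuous hcT1).add ((lu _).mul_continuous hcT2)).sub
      ((locallyIntegrable_average hf₀ i1 i2).smul θ)
  have hd : Continuous (deriv ψ) := hψ.continuous_deriv (by exact_mod_cast le_top)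
  have hksm : ContDiff ℝ (⊤ : ℕ∞) (convKernel k z) := hk.comp (contDiff_const.sub contDiff_id)
  have hsupp : tsupport (convKernel k z) ⊆ Iio T ×ˢ univ := by
    have hsub : tsupport (convKernel k z) ⊆ (fun y => z - y) ⁻¹' tsupport k :=
      closure_minimal (fun y hy => subset_tsupport k hy)
        ((isClosed_tsupport k).preimage (continuous_const.sub continuous_id))
    intro y hy
    have := hδ (hsub hy)
    rw [mem_closedBall_zero_iff, Prod.norm_def] at this
    have h1 := (abs_le.mp ((le_max_left _ _).trans this)).1
    simp only [Prod.fst_sub] at h1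
    exact ⟨by simp only [mem_Iio]; linarith, mem_univ _⟩
  have heq := h.equation _ ψ hksm c2 hsupp hψ hψc
  have hT1 : Continuous fun v => θ * (weight γ v)⁻¹ * ψ v := hcT1.mul hψ.continuous
  have hT2 : Continuous fun v => ε * v * (weight γ v)⁻¹ * ψ v := hcT2.mul hψ.continuous
  have hTd : Continuous fun v => (weight γ v)⁻¹ * deriv ψ v := hwi.mul hd
  have e1 : ∫ v, average (convKernel k) G (z, v) / weight γ v * deriv ψ v
      = ∫ p, G p / weight γ p.2 * (convKernel k z p.1 * deriv ψ p.2) := by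
    calc _ = ∫ v, average (convKernel k) G (z, v) * ((weight γ v)⁻¹ * deriv ψ v) :=
          integral_congr_ae (Eventually.of_forall fun v => by ring)
      _ = _ := by
          rw [integral_average_mul hG c1 c2 hTd hψc.deriv.mul_left]
          exact integral_congr_ae (Eventually.of_forall fun v => by ring)
  have a1 := integrable_average_mul hu (d1 (1, 0)) (d2 (1, 0)) hT1 hψc.mul_left
  have a2 := integrable_average_mul hu (d1 (0, 1)) (d2 (0, 1)) hT2 hψc.mul_left
  have a3 := integrable_average_mul hf₀ i1 i2 hψ.continuous hψc
  have b1 := integrable_tensor_mul hu (d1 (1, 0)) (d2 (1, 0)) hT1 hψc.mul_left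
  have b2 := integrable_tensor_mul hu (d1 (0, 1)) (d2 (0, 1)) hT2 hψc.mul_left
  have e2 : ∫ v, (transport θ ε k u (z, v) / weight γ v
        - θ * average (initialKernel k) f₀ (z, v)) * ψ v
      = (∫ v, average (convKernel fun z => fderiv ℝ k z (1, 0)) u (z, v)
          * (θ * (weight γ v)⁻¹ * ψ v))
        + (∫ v, average (convKernel fun z => fderiv ℝ k z (0, 1)) u (z, v)
          * (ε * v * (weight γ v)⁻¹ * ψ v))
        - θ * ∫ v, average (initialKernel k) f₀ (z, v) * ψ v := by
    have hs := integral_sub (a1.add a2) (a3.const_mul θ)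
    simp only [Pi.add_apply] at hs
    rw [← integral_add a1 a2, ← integral_const_mul, ← hs]
    refine integral_congr_ae (Eventually.of_forall fun v => ?_)
    beta_reduce
    rw [eT]
    ring
  have e3 : ∫ p, u p / weight γ p.2 * ((θ * fderiv ℝ (convKernel k z) p.1 (1, 0)
        + ε * p.2 * fderiv ℝ (convKernel k z) p.1 (0, 1)) * ψ p.2)
      = -((∫ q, convKernel (fun z => fderiv ℝ k z (1, 0)) z q.1
            * (θ * (weight γ q.2)⁻¹ * ψ q.2) * u q)
        + ∫ q, convKernel (fun z => fderiv ℝ k z (0, 1)) z q.1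
            * (ε * q.2 * (weight γ q.2)⁻¹ * ψ q.2) * u q) := by
    rw [Measure.volume_eq_prod, ← integral_add b1 b2, ← integral_neg]
    refine integral_congr_ae (Eventually.of_forall fun q => ?_)
    simp only [fderiv_comp_sub_left hk, convKernel]
    ring
  have e4 : ∫ q : ℝ × ℝ, f₀ q * (convKernel k z (0, q.1) * ψ q.2)
      = ∫ q, initialKernel k z q.1 * ψ q.2 * f₀ q :=
    integral_congr_ae (Eventually.of_forall fun q => by
      simp only [convKernel, initialKernel]; ring)
  rw [e1, e2, ← heq, e3, e4,
    integral_average_mul hu (d1 (1, 0)) (d2 (1, 0)) hT1 hψc.mul_left,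
    integral_average_mul hu (d1 (0, 1)) (d2 (0, 1)) hT2 hψc.mul_left,
    integral_average_mul hf₀ i1 i2 hψ.continuous hψc]
  ring

/-- Mollification in `(t, x)` of a weak solution. -/
theorem IsKineticSolution.isRegularSolution (hδ : tsupport k ⊆ Metric.closedBall 0 δ) :
    IsRegularSolution γ θ ε (T - δ) (average (convKernel k) u) (transport θ ε k u)
      (average (convKernel k) G) (average (initialKernel k) f₀) where
  memLp_u := by
    obtain ⟨B, hB⟩ := isAveragingKernel_convKernel hk.continuous hc
    exact memLp_average_div_sqrt hB h.meas_u h.memLp_u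
  memLp_D ψ hψ hψc := h.memLp_transport hk hc hψ hψc
  memLp_G := by
    obtain ⟨B, hB⟩ := isAveragingKernel_convKernel hk.continuous hc
    exact memLp_average_div_sqrt hB h.meas_G h.memLp_G
  memLp_S := by
    obtain ⟨L, B, hB⟩ := isAveragingKernel_initialKernel hk.continuous hc
    have hs : StronglyMeasurable (fun p : ℝ × ℝ => f₀ p * √(weight γ p.2)) :=
      h.meas_f₀.mul (((continuous_weight γ).comp continuous_snd).sqrt).stronglyMeasurable
    refine (memLp_congr_ae (Eventually.of_forall fun p => ?_)).mp (hB.memLp_average h.memLp_f₀ hs)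
    exact average_mul_velocity (fun v => √(weight γ v)) p
  hasLineDerivAt := by
    have h2 : Integrable (fun p => (u p / √(weight γ p.2)) ^ 2) (volume.prod volume) :=
      h.memLp_u.integrable_sq
    filter_upwards [h2.prod_left_ae] with v hv z
    refine hasLineDerivAt_average hk hc ?_ z θ (ε * v)
    have hsm : StronglyMeasurable (fun y : ℝ × ℝ => u (y, v)) :=
      h.meas_u.comp_measurable measurable_prodMk_right
    have hmem : MemLp (fun y : ℝ × ℝ => u (y, v)) 2 volume := by
      rw [memLp_two_iff_integrable_sq hsm.aestronglyMeasurable]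
      refine (hv.mul_const (weight γ v)).congr (Eventually.of_forall fun y => ?_)
      simp only [div_sqrt_sq (weight_pos γ v)]
      exact div_mul_cancel₀ _ (weight_pos γ v).ne'
    exact hmem.locallyIntegrable (by norm_num)
  weak_u := h.weak_average hk hc
  weak_G _ hz := h.weak_equation hk hc hδ hz

end regularization

/-! ### Time weights and the one-sided entropy -/

/-- The primitive of a probability density supported in `(a, b)`. -/
theorem exists_step {η : ℝ → ℝ} {a b : ℝ} (hη : Continuous η) (h0 : ∀ t, 0 ≤ η t)
    (hs : ∀ t, t ∉ Ioo a b → η t = 0) (h1 : ∫ t, η t = 1) :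
    ∃ H : ℝ → ℝ, (∀ t, HasDerivAt H (η t) t) ∧ (∀ t, t ≤ a → H t = 0) ∧ (∀ t, b ≤ t → H t = 1) ∧
      ∀ t, 0 ≤ H t ∧ H t ≤ 1 := by
  have hd : ∀ t, HasDerivAt (fun t => ∫ s in a..t, η s) (η t) t := fun t =>
    intervalIntegral.integral_hasDerivAt_right (hη.intervalIntegrable _ _)
      (hη.stronglyMeasurableAtFilter _ _) hη.continuousAt
  have hle : ∀ t, t ≤ a → ∫ s in a..t, η s = 0 := fun t ht => by
    rw [intervalIntegral.integral_symm, intervalIntegral.integral_of_le ht, neg_eq_zero]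
    exact setIntegral_eq_zero_of_forall_eq_zero fun s hs' => hs s fun h => by
      linarith [hs'.2, h.1]
  have hi : Integrable η := by
    by_contra hn
    rw [integral_undef hn] at h1
    exact zero_ne_one h1
  have hge : ∀ t, b ≤ t → a ≤ t → ∫ s in a..t, η s = 1 := fun t ht hat => by
    rw [intervalIntegral.integral_of_le hat, ← h1]
    refine setIntegral_eq_integral_of_forall_compl_eq_zero fun s hs' => hs s fun h => hs' ?_
    exact ⟨h.1, h.2.le.trans ht⟩
  have hab : a < b := by
    by_contra hn
    have : η = fun _ => 0 := funext fun t => hs t fun h => hn (h.1.trans h.2)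
    simp [this] at h1
  refine ⟨_, hd, hle, fun t ht => hge t ht (hab.le.trans ht), fun t => ?_⟩
  rcases le_total t a with ht | ht
  · simp [hle t ht]
  · rw [intervalIntegral.integral_of_le ht]
    refine ⟨integral_nonneg h0, ?_⟩
    rw [← h1]
    exact setIntegral_le_integral hi (Eventually.of_forall h0)

/-- A decreasing time weight that vanishes after `T₂` and whose derivative controls `η`. -/
theorem exists_time_weight {η : ℝ → ℝ} {a b T₁ T₂ : ℝ} (hη : Continuous η) (h0 : ∀ t, 0 ≤ η t)
    (hs : ∀ t, t ∉ Ioo a b → η t = 0) (h1 : ∫ t, η t = 1) (hηb : ∃ C, ∀ t, η t ≤ C)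
    (hT : T₁ < T₂) :
    ∃ (M : ℝ) (χ χ' : ℝ → ℝ), (∀ t, HasDerivAt χ (χ' t) t) ∧ Continuous χ' ∧ (∀ t, |χ' t| ≤ M) ∧
      (∀ t, T₂ ≤ t → χ t = 0) ∧ (∀ t, 0 ≤ χ t ∧ χ t ≤ 6) ∧ (∀ t, t ≤ T₁ → 1 ≤ χ t) ∧
      (∀ t, χ' t ≤ -(η t * χ t / 6)) ∧ ∀ t, t ≤ T₁ → χ' t < 0 := by
  obtain ⟨H, H1, -, -, H4⟩ := exists_step hη h0 hs h1
  let φ : ContDiffBump ((T₁ + T₂) / 2) := ⟨(T₂ - T₁) / 4, (T₂ - T₁) / 2, by linarith, by linarith⟩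
  have φs : ∀ t, t ∉ Ioo T₁ T₂ → φ.normed volume t = 0 := fun t ht => by
    rw [← Function.notMem_support, φ.support_normed_eq, Real.ball_eq_Ioo]
    convert ht using 3
    · change (T₁ + T₂) / 2 - (T₂ - T₁) / 2 = T₁; ring
    · change (T₁ + T₂) / 2 + (T₂ - T₁) / 2 = T₂; ring
  have φc : Continuous (φ.normed volume) := φ.continuous_normed
  obtain ⟨J, J1, J2, J3, J4⟩ := exists_step φc φ.nonneg_normed φs φ.integral_normed
  obtain ⟨C, hC⟩ := φ.hasCompactSupport_normed.exists_bound_of_continuous φc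
  obtain ⟨C', hC'⟩ := hηb
  -- The term `-H` contributes `-η` to the derivative and `-arctan` makes the decrease strict. Since
  -- `0 ≤ H ≤ 1` and `|arctan| < π/2 < 2`, the constant `4` keeps `q` between `1` and `6`. The
  -- factor `1 - J` below switches the weight off between `T₁` and `T₂`.
  set q : ℝ → ℝ := fun t => 4 - H t - Real.arctan t with hq
  set q' : ℝ → ℝ := fun t => -η t - (1 + t ^ 2)⁻¹ with hq'
  have hqd : ∀ t, HasDerivAt q (q' t) t := fun t => by
    have := (((hasDerivAt_const t (4 : ℝ)).sub (H1 t)).sub (Real.hasDerivAt_arctan t))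
    refine this.congr_deriv ?_
    simp [hq']
  have hq1 : ∀ t, 1 ≤ q t ∧ q t ≤ 6 := fun t => by
    have a1 := Real.arctan_lt_pi_div_two t
    have a2 := Real.neg_pi_div_two_lt_arctan t
    have a3 := Real.pi_lt_four
    have a4 := H4 t
    constructor <;> simp only [hq] <;> linarith [a4.1, a4.2]
  have hinv : ∀ t : ℝ, 0 < (1 + t ^ 2)⁻¹ ∧ (1 + t ^ 2)⁻¹ ≤ 1 := fun t =>
    ⟨by positivity, inv_le_one_of_one_le₀ (by nlinarith [sq_nonneg t])⟩
  have hqle : ∀ t, q' t ≤ -η t := fun t => by simp only [hq']; linarith [(hinv t).1]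
  have hqneg : ∀ t, q' t < 0 := fun t => by simp only [hq']; linarith [(hinv t).1, h0 t]
  have hqb : ∀ t, |q' t| ≤ C' + 1 := fun t => by
    rw [abs_of_neg (hqneg t)]; simp only [hq']; linarith [(hinv t).2, hC' t]
  have hqc : Continuous q := continuous_iff_continuousAt.mpr fun t => (hqd t).continuousAt
  have hJc : Continuous J := continuous_iff_continuousAt.mpr fun t => (J1 t).continuousAt
  have hq'c : Continuous q' := hη.neg.sub
    ((by fun_prop : Continuous fun t : ℝ => 1 + t ^ 2).inv₀ fun t => by positivity)
  refine ⟨C * 6 + (C' + 1), fun t => (1 - J t) * q t,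
    fun t => -φ.normed volume t * q t + (1 - J t) * q' t, fun t => ?_, ?_, fun t => ?_,
    fun t ht => by simp [J3 t ht], fun t => ?_, fun t ht => ?_, fun t => ?_, fun t ht => ?_⟩
  · have := ((J1 t).const_sub 1).mul (hqd t)
    exact this
  · exact (φc.neg.mul hqc).add ((continuous_const.sub hJc).mul hq'c)
  · refine (abs_add_le _ _).trans (add_le_add ?_ ?_)
    · rw [abs_mul, abs_neg, abs_of_nonneg (by linarith [(hq1 t).1] : 0 ≤ q t)]
      exact mul_le_mul (hC t) (hq1 t).2 (by linarith [(hq1 t).1]) ((norm_nonneg _).trans (hC t))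
    · rw [abs_mul, abs_of_nonneg (by linarith [(J4 t).2])]
      calc (1 - J t) * |q' t| ≤ 1 * |q' t| := by gcongr; linarith [(J4 t).1]
        _ ≤ _ := by rw [one_mul]; exact hqb t
  · have := hq1 t
    have := J4 t
    constructor
    · apply mul_nonneg <;> linarith
    · calc (1 - J t) * q t ≤ 1 * 6 := by apply mul_le_mul <;> linarith
        _ = 6 := by norm_num
  · simp only [J2 t ht, sub_zero, one_mul]; exact (hq1 t).1
  · have b1 : 0 ≤ φ.normed volume t * q t :=
      mul_nonneg (φ.nonneg_normed t) (by linarith [(hq1 t).1])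
    have b2 : (1 - J t) * q' t ≤ (1 - J t) * -η t := by
      gcongr
      · linarith [(J4 t).2]
      · exact hqle t
    have b3 : η t * ((1 - J t) * q t) ≤ η t * ((1 - J t) * 6) := by
      have := h0 t
      have := J4 t
      gcongr
      · linarith
      · exact (hq1 t).2
    linarith
  · have b1 : 0 ≤ φ.normed volume t * q t :=
      mul_nonneg (φ.nonneg_normed t) (by linarith [(hq1 t).1])
    simp only [J2 t ht, sub_zero, one_mul]
    linarith [hqneg t]

/-- A convex function vanishing exactly on `(-∞, 0]`, of at most quadratic growth, with
quadratically bounded derivative. -/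
theorem exists_positive_part_entropy : ∃ Φ P P' : ℝ → ℝ, (∀ r, HasDerivAt Φ (P r) r) ∧
    (∀ r, HasDerivAt P (P' r) r) ∧ Continuous P' ∧ (∀ r, 0 ≤ P' r ∧ P' r ≤ 1) ∧
    (∀ r, 0 ≤ P r ∧ P r ≤ max r 0 ∧ P r ≤ (max r 0) ^ 2) ∧ (∀ r, 0 ≤ Φ r ∧ Φ r ≤ (max r 0) ^ 2) ∧
    ∀ r, 0 < r → 0 < Φ r := by
  -- This choice is at most linear, with slope at most `1`, and also at most quadratic. The
  -- quadratic bound makes the term in `P m'` integrable over the unbounded phase space, where only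
  -- `u²/ω` is controlled.
  set P : ℝ → ℝ := fun r => √(1 + (max r 0) ^ 2) - 1 with hP
  set P' : ℝ → ℝ := fun r => max r 0 / √(1 + (max r 0) ^ 2) with hP'
  have hsq : ∀ r : ℝ, HasDerivAt (fun r : ℝ => (max r 0) ^ 2) (2 * max r 0) r := by
    intro r
    rcases lt_trichotomy r 0 with hr | rfl | hr
    · have : HasDerivAt (fun _ : ℝ => (0 : ℝ)) 0 r := hasDerivAt_const r 0
      rw [max_eq_right hr.le, mul_zero]
      refine this.congr_of_eventuallyEq ?_
      filter_upwards [Iio_mem_nhds hr] with s hs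
      simp [max_eq_right (le_of_lt (mem_Iio.mp hs))]
    · rw [max_self, mul_zero, hasDerivAt_iff_isLittleO]
      have : (fun s : ℝ => (max s 0) ^ 2 - (max 0 0) ^ 2 - (s - 0) • (0 : ℝ))
          = fun s => (max s 0) ^ 2 := by funext s; simp
      rw [this]
      simp only [sub_zero]
      refine (Asymptotics.IsBigO.of_bound 1 (Eventually.of_forall fun s => ?_)).trans_isLittleO
        (g := fun s : ℝ => s ^ 2) (Asymptotics.isLittleO_pow_id one_lt_two)
      rw [one_mul, norm_pow, norm_pow]
      refine pow_le_pow_left₀ (norm_nonneg _) ?_ 2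
      rw [Real.norm_of_nonneg (le_max_right _ _)]
      exact max_le (le_abs_self s) (norm_nonneg s)
    · have : HasDerivAt (fun s : ℝ => s ^ 2) (2 * r) r := by simpa using hasDerivAt_pow 2 r
      rw [max_eq_left hr.le]
      refine this.congr_of_eventuallyEq ?_
      filter_upwards [Ioi_mem_nhds hr] with s hs
      rw [max_eq_left (le_of_lt (mem_Ioi.mp hs))]
  have hmax : Continuous fun r : ℝ => max r 0 := continuous_id.max continuous_const
  have hs1 : ∀ r : ℝ, 1 ≤ √(1 + (max r 0) ^ 2) := fun r =>
    Real.one_le_sqrt.mpr (by nlinarith [sq_nonneg (max r 0)])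
  have hPd : ∀ r, HasDerivAt P (P' r) r := fun r => by
    have := (((hsq r).const_add 1).sqrt (by positivity)).sub_const 1
    refine this.congr_deriv ?_
    simp only [hP']
    rw [mul_div_mul_left _ _ two_ne_zero]
  have hPc : Continuous P := continuous_iff_continuousAt.mpr fun r => (hPd r).continuousAt
  have hm0 : ∀ r : ℝ, 0 ≤ max r 0 := fun r => le_max_right _ _
  have hP0 : ∀ r, 0 ≤ P r ∧ P r ≤ max r 0 ∧ P r ≤ (max r 0) ^ 2 := fun r => by
    have h2 := hm0 r
    have h3 : √(1 + (max r 0) ^ 2) ≤ 1 + max r 0 := Real.sqrt_le_iff.mpr ⟨by linarith, by nlinarith⟩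
    have h4 : √(1 + (max r 0) ^ 2) ≤ 1 + (max r 0) ^ 2 :=
      Real.sqrt_le_iff.mpr ⟨by positivity, by nlinarith [sq_nonneg ((max r 0))]⟩
    refine ⟨by simp only [hP]; linarith [hs1 r], by simp only [hP]; linarith,
      by simp only [hP]; linarith⟩
  have hneg : ∀ r, r ≤ 0 → P r = 0 := fun r hr => by simp [hP, max_eq_right hr]
  have hpos : ∀ r, 0 < r → 0 < P r := fun r hr => by
    simp only [hP, max_eq_left hr.le]
    have : 1 < √(1 + r ^ 2) := Real.lt_sqrt (by norm_num) |>.mpr (by nlinarith)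
    linarith
  have hΦ0 : ∀ r, r ≤ 0 → ∫ s in (0 : ℝ)..r, P s = 0 := fun r hr => by
    rw [intervalIntegral.integral_symm, intervalIntegral.integral_of_le hr, neg_eq_zero]
    exact setIntegral_eq_zero_of_forall_eq_zero fun s hs => hneg s hs.2
  refine ⟨fun r => ∫ s in (0 : ℝ)..r, P s, P, P', fun r => ?_, hPd, ?_, fun r => ⟨?_, ?_⟩, hP0,
    fun r => ?_, fun r hr => ?_⟩
  · exact intervalIntegral.integral_hasDerivAt_right (hPc.intervalIntegrable _ _)
      (hPc.stronglyMeasurableAtFilter _ _) hPc.continuousAt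
  · exact hmax.div (continuous_const.add (hmax.pow 2)).sqrt fun r => by linarith [hs1 r]
  · exact div_nonneg (hm0 r) (Real.sqrt_nonneg _)
  · refine div_le_one_of_le₀ ?_ (Real.sqrt_nonneg _)
    exact Real.le_sqrt_of_sq_le (by linarith)
  · rcases le_total r 0 with hr | hr
    · simp [hΦ0 r hr, max_eq_right hr]
    · refine ⟨intervalIntegral.integral_nonneg hr fun s _ => (hP0 s).1, ?_⟩
      rw [max_eq_left hr]
      calc ∫ s in (0 : ℝ)..r, P s ≤ ∫ s in (0 : ℝ)..r, r := by
            refine intervalIntegral.integral_mono_on hr (hPc.intervalIntegrable _ _)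
              (by simp) fun s hs => (hP0 s).2.1.trans (max_le hs.2 hr)
        _ = r ^ 2 := by simp [sq]
  · exact intervalIntegral.intervalIntegral_pos_of_pos_on (hPc.intervalIntegrable _ _)
      (fun s hs => hpos s hs.1) hr

/-! ### The maximum principle for mollified solutions -/

section mollifier
variable {γ θ ε T A : ℝ} {f₀ : ℝ × ℝ → ℝ} {u G : (ℝ × ℝ) × ℝ → ℝ}

theorem IsKineticSolution.neg (h : IsKineticSolution γ θ ε T f₀ u G) :
    IsKineticSolution γ θ ε T (fun q => -f₀ q) (fun p => -u p) (fun p => -G p) where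
  meas_u := h.meas_u.neg
  meas_G := h.meas_G.neg
  meas_f₀ := h.meas_f₀.neg
  memLp_u := by simp_rw [neg_div]; exact h.memLp_u.neg
  memLp_G := by simp_rw [neg_div]; exact h.memLp_G.neg
  memLp_f₀ := by simp_rw [neg_mul]; exact h.memLp_f₀.neg
  weak_u := by
    filter_upwards [h.weak_u] with z hz
    refine ⟨hz.1.neg, hz.2.1.neg, fun φ h1 h2 => ?_⟩
    simp_rw [neg_mul, integral_neg]
    rw [hz.2.2 φ h1 h2]
  equation k ψ h1 h2 h3 h4 h5 := by
    have := h.equation k ψ h1 h2 h3 h4 h5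
    simp_rw [neg_div, neg_mul, integral_neg]
    rw [← this]; ring

variable (h : IsKineticSolution γ θ ε T f₀ u G) (φ : ContDiffBump (0 : ℝ × ℝ))

/-- The time marginal of the mollifier. -/
noncomputable def timeMarginal (φ : ContDiffBump (0 : ℝ × ℝ)) (t : ℝ) : ℝ :=
  ∫ y : ℝ, φ.normed volume (t, y)

theorem continuous_timeMarginal : Continuous (timeMarginal φ) :=
  continuous_integral_slice φ.continuous_normed φ.hasCompactSupport_normed

theorem timeMarginal_nonneg (t : ℝ) : 0 ≤ timeMarginal φ t :=
  integral_nonneg fun _ => φ.nonneg_normed _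

theorem timeMarginal_eq_zero (t : ℝ) (ht : t ∉ Ioo (-φ.rOut) φ.rOut) : timeMarginal φ t = 0 := by
  refine integral_eq_zero_of_ae (Eventually.of_forall fun y => ?_)
  rw [Pi.zero_apply, ← Function.notMem_support, φ.support_normed_eq, mem_ball_zero_iff,
    Prod.norm_def, not_lt]
  refine le_max_of_le_left ?_
  simp only [Real.norm_eq_abs]
  by_contra hn
  exact ht (abs_lt.mp (not_le.mp hn))

theorem integral_timeMarginal : ∫ t, timeMarginal φ t = 1 := by
  have hi : Integrable (φ.normed volume) (volume.prod volume : Measure (ℝ × ℝ)) :=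
    φ.continuous_normed.integrable_of_hasCompactSupport (μ := volume) φ.hasCompactSupport_normed
  have := integral_prod _ hi
  rw [← Measure.volume_eq_prod, φ.integral_normed] at this
  exact this.symm

theorem exists_timeMarginal_le : ∃ C, ∀ t, timeMarginal φ t ≤ C := by
  obtain ⟨C, hC⟩ := (hasCompactSupport_integral_slice φ.continuous_normed
    φ.hasCompactSupport_normed).exists_bound_of_continuous (continuous_timeMarginal φ)
  exact ⟨C, fun t => (le_abs_self _).trans (hC t)⟩

theorem integral_abs_initialKernel (z : ℝ × ℝ) :
    ∫ y, |initialKernel (φ.normed volume) z y| = timeMarginal φ z.1 := by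
  have : ∀ y, |initialKernel (φ.normed volume) z y| = initialKernel (φ.normed volume) z y :=
    fun y => abs_of_nonneg (φ.nonneg_normed _)
  simp_rw [this]
  exact integral_initialKernel φ.continuous_normed φ.hasCompactSupport_normed z

include h

/-- The mollified solution. -/
theorem IsKineticSolution.isRegularSolution_bump :
    IsRegularSolution γ θ ε (T - φ.rOut) (average (convKernel (φ.normed volume)) u)
      (transport θ ε (φ.normed volume) u) (average (convKernel (φ.normed volume)) G)
      (average (initialKernel (φ.normed volume)) f₀) :=
  h.isRegularSolution φ.contDiff_normed φ.hasCompactSupport_normed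
    φ.tsupport_normed_eq.subset

/-- At time `t` the kernel has mass `timeMarginal φ t` in `x`; the mollified datum is thus
controlled by the derivative of the barrier used in `average_le`. -/
theorem IsKineticSolution.average_initial_le (hA : ∀ᵐ q : ℝ × ℝ, |f₀ q * weight γ q.2| ≤ A) :
    ∀ᵐ p : (ℝ × ℝ) × ℝ, average (initialKernel (φ.normed volume)) f₀ p * weight γ p.2
      ≤ A * timeMarginal φ p.1.1 := by
  have h1 : ∀ᵐ v : ℝ, ∀ᵐ y : ℝ, |f₀ (y, v) * weight γ v| ≤ A := by
    have hm : MeasurableSet {q : ℝ × ℝ | |f₀ q * weight γ q.2| ≤ A} :=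
      measurableSet_le (((h.meas_f₀.measurable).mul
        ((continuous_weight γ).comp continuous_snd).measurable).abs) measurable_const
    have h2 : ∀ᵐ y : ℝ, ∀ᵐ v : ℝ, |f₀ (y, v) * weight γ v| ≤ A :=
      (Measure.ae_prod_mem_iff_ae_ae_mem (μ := volume) (ν := volume) hm).mp hA
    exact (Measure.ae_ae_comm (p := fun y v => |f₀ (y, v) * weight γ v| ≤ A) hm).mp h2
  have h3 : ∀ᵐ p : (ℝ × ℝ) × ℝ ∂(volume.prod volume),
      ∀ᵐ y : ℝ, |f₀ (y, p.2) * weight γ p.2| ≤ A :=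
    Measure.quasiMeasurePreserving_snd.ae h1
  filter_upwards [h3] with p hp
  rw [← average_mul_velocity, average]
  have hi : Integrable (initialKernel (φ.normed volume) p.1) volume :=
    (continuous_initialKernel φ.continuous_normed φ.hasCompactSupport_normed
      p.1).integrable_of_hasCompactSupport
      (hasCompactSupport_initialKernel φ.continuous_normed φ.hasCompactSupport_normed p.1)
  have hms : StronglyMeasurable (fun y : ℝ => f₀ (y, p.2) * weight γ p.2) :=
    (h.meas_f₀.comp_measurable measurable_prodMk_right).mul_const _
  calc ∫ y, initialKernel (φ.normed volume) p.1 y * (f₀ (y, p.2) * weight γ p.2)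
      ≤ ∫ y, initialKernel (φ.normed volume) p.1 y * A := by
        refine integral_mono_ae (hi.mul_bdd (c := A) hms.aestronglyMeasurable hp)
          (hi.mul_const A) ?_
        filter_upwards [hp] with y hy
        exact mul_le_mul_of_nonneg_left ((le_abs_self _).trans hy) (φ.nonneg_normed _)
    _ = A * timeMarginal φ p.1.1 := by
        rw [integral_mul_const, mul_comm, integral_initialKernel φ.continuous_normed
          φ.hasCompactSupport_normed]
        rfl

/-- The maximum principle for the mollified solution. -/
theorem IsKineticSolution.average_le (hθ : 0 < θ) (hA0 : 0 ≤ A)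
    (hA : ∀ᵐ q : ℝ × ℝ, |f₀ q * weight γ q.2| ≤ A) :
    ∀ᵐ p : (ℝ × ℝ) × ℝ, p.1.1 ≤ T - 2 * φ.rOut →
      average (convKernel (φ.normed volume)) u p ≤ A := by
  have hr := h.isRegularSolution_bump φ
  have hpos := φ.rOut_pos
  obtain ⟨C, hC⟩ := exists_timeMarginal_le φ
  have hC0 : 0 ≤ C := (timeMarginal_nonneg φ 0).trans (hC 0)
  -- The barrier `m(t) = A H(t)` rises from `0` to `A` while the mollified datum is being injected,
  -- and `m'/ω` dominates that source.
  obtain ⟨H, H1, -, -, H4⟩ := exists_step (continuous_timeMarginal φ) (timeMarginal_nonneg φ)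
    (timeMarginal_eq_zero φ) (integral_timeMarginal φ)
  obtain ⟨M, χ, χ', w1, w2, w3, w4, w5, w6, w7, w8⟩ := exists_time_weight
    (T₁ := T - 2 * φ.rOut) (T₂ := T - φ.rOut)
    (continuous_timeMarginal φ) (timeMarginal_nonneg φ)
    (timeMarginal_eq_zero φ) (integral_timeMarginal φ) ⟨C, hC⟩ (by linarith)
  obtain ⟨Φ, P, P', p1, p2, p3, p4, p5, p6, p7⟩ := exists_positive_part_entropy
  have hM0 : 0 ≤ M := (abs_nonneg _).trans (w3 0)
  have hmax : ∀ t r, 0 ≤ max (r - A * H t) 0 ∧ max (r - A * H t) 0 ≤ |r| := fun t r =>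
    ⟨le_max_right _ _, max_le (by linarith [le_abs_self r, mul_nonneg hA0 (H4 t).1]) (abs_nonneg r)⟩
  have hmax2 : ∀ t r, (max (r - A * H t) 0) ^ 2 ≤ r ^ 2 := fun t r => by
    rw [← sq_abs r]; exact pow_le_pow_left₀ (hmax t r).1 (hmax t r).2 2
  have he : IsEntropy (T - φ.rOut) (M + 6 + A * C) Φ P P' χ χ' (fun t => A * H t)
      (fun t => A * timeMarginal φ t) :=
    { hasDerivAt_Φ := p1
      hasDerivAt_P := p2
      continuous_P' := p3
      abs_P'_le := fun r => by rw [abs_of_nonneg (p4 r).1]; exact (p4 r).2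
      hasDerivAt_χ := w1
      hasDerivAt_m := fun t => (H1 t).const_mul A
      continuous_χ' := w2
      continuous_m' := continuous_const.mul (continuous_timeMarginal φ)
      abs_χ_le := fun t => by
        rw [abs_of_nonneg (w5 t).1]; linarith [(w5 t).2, mul_nonneg hA0 hC0]
      abs_χ'_le := fun t => by linarith [w3 t, mul_nonneg hA0 hC0]
      χ_eq_zero := w4
      abs_P_le := fun t r => by
        rw [abs_of_nonneg (p5 _).1]; exact (p5 _).2.1.trans (hmax t r).2
      abs_Φ_le := fun t r => by
        rw [abs_of_nonneg (p6 _).1]; exact (p6 _).2.trans (hmax2 t r)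
      abs_P_mul_le := fun t r => by
        have h1 : 0 ≤ A * timeMarginal φ t := mul_nonneg hA0 (timeMarginal_nonneg φ t)
        rw [abs_of_nonneg (mul_nonneg (p5 _).1 h1), mul_comm]
        have h2 : A * timeMarginal φ t ≤ M + 6 + A * C := by
          linarith [mul_le_mul_of_nonneg_left (hC t) hA0]
        exact mul_le_mul h2 ((p5 _).2.2.trans (hmax2 t r)) (p5 _).1 (h1.trans h2) }
  have hint := hr.integrable_entropyProduction he
  have hzero := hr.integral_entropyProduction he
  have hterm : ∀ p, 0 ≤ -θ * (χ' p.1.1 * Φ (average (convKernel (φ.normed volume)) u p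
      - A * H p.1.1) / weight γ p.2) := fun p => by
    have h1 : χ' p.1.1 ≤ 0 := (w7 _).trans (by
      have := mul_nonneg (timeMarginal_nonneg φ p.1.1) (w5 p.1.1).1
      linarith)
    rw [neg_mul, ← mul_neg, ← neg_div, ← neg_mul]
    exact mul_nonneg hθ.le (div_nonneg (mul_nonneg (by linarith) (p6 _).1) (weight_pos γ _).le)
  have hnn : ∀ᵐ p : (ℝ × ℝ) × ℝ,
      -θ * (χ' p.1.1 * Φ (average (convKernel (φ.normed volume)) u p
        - A * H p.1.1) / weight γ p.2) ≤ entropyProduction γ θ Φ P P' χ χ' (fun t => A * H t)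
          (fun t => A * timeMarginal φ t) (average (convKernel (φ.normed volume)) u)
          (average (convKernel (φ.normed volume)) G)
          (average (initialKernel (φ.normed volume)) f₀) p := by
    filter_upwards [h.average_initial_le φ hA] with p hp
    have hw := weight_pos γ p.2
    have b1 := mul_nonneg (mul_nonneg (w5 p.1.1).1 (p4 (average (convKernel (φ.normed volume)) u p
      - A * H p.1.1)).1) (div_nonneg (sq_nonneg (average (convKernel (φ.normed volume)) G p)) hw.le)
    have b2 : 0 ≤ θ * (χ p.1.1 * P (average (convKernel (φ.normed volume)) u p - A * H p.1.1)
        * (A * timeMarginal φ p.1.1 / weight γ p.2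
          - average (initialKernel (φ.normed volume)) f₀ p)) := by
      refine mul_nonneg hθ.le (mul_nonneg (mul_nonneg (w5 _).1 (p5 _).1) ?_)
      rw [sub_nonneg, le_div_iff₀ hw]
      exact hp
    simp only [entropyProduction]
    have e : θ * (χ p.1.1 * P (average (convKernel (φ.normed volume)) u p - A * H p.1.1)
        * (A * timeMarginal φ p.1.1 / weight γ p.2
          - average (initialKernel (φ.normed volume)) f₀ p))
        = θ * (χ p.1.1 * (P (average (convKernel (φ.normed volume)) u p - A * H p.1.1)
            * (A * timeMarginal φ p.1.1)) / weight γ p.2)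
          - θ * (χ p.1.1 * P (average (convKernel (φ.normed volume)) u p - A * H p.1.1)
            * average (initialKernel (φ.normed volume)) f₀ p) := by ring
    linarith
  -- Dissipation, barrier minus source, and the term in `χ'` are all nonnegative, yet their total
  -- integral is zero. Where `χ' < 0` this forces `Φ(u - m) = 0`, that is `u ≤ m ≤ A`.
  have hae := (integral_eq_zero_iff_of_nonneg_ae
    (hnn.mono fun p hp => (hterm p).trans hp) hint).mp hzero
  filter_upwards [hae, hnn] with p hp hp' hpt
  rw [hp, Pi.zero_apply] at hp'
  by_contra hcon
  have h1 : 0 < average (convKernel (φ.normed volume)) u p - A * H p.1.1 := by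
    have := mul_le_mul_of_nonneg_left (H4 p.1.1).2 hA0
    linarith
  have h2 : 0 < -θ * (χ' p.1.1 * Φ (average (convKernel (φ.normed volume)) u p
      - A * H p.1.1) / weight γ p.2) := by
    rw [neg_mul, ← mul_neg, ← neg_div, ← neg_mul]
    exact mul_pos hθ (div_pos (mul_pos (by linarith [w8 _ hpt]) (p7 _ h1)) (weight_pos γ _))
  linarith

end mollifier

/-! ### The energy estimate for mollified solutions -/

section energy
variable {γ θ ε T A : ℝ} {f₀ : ℝ × ℝ → ℝ} {u G : (ℝ × ℝ) × ℝ → ℝ}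
  (h : IsKineticSolution γ θ ε T f₀ u G) (φ : ContDiffBump (0 : ℝ × ℝ))
include h

theorem IsKineticSolution.meas_f₀_mul_sqrt :
    StronglyMeasurable (fun q : ℝ × ℝ => f₀ q * √(weight γ q.2)) :=
  h.meas_f₀.mul (((continuous_weight γ).comp continuous_snd).sqrt).stronglyMeasurable

/-- The energy estimate for the mollified solution. -/
theorem IsKineticSolution.lintegral_average_le (hθ : 0 < θ) :
    ∫⁻ p in {p : (ℝ × ℝ) × ℝ | p.1.1 ≤ T - 2 * φ.rOut},
        ENNReal.ofReal (average (convKernel (φ.normed volume)) G p ^ 2 / weight γ p.2)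
      ≤ ENNReal.ofReal (18 * θ * ∫ q, (f₀ q * √(weight γ q.2)) ^ 2) := by
  have hr := h.isRegularSolution_bump φ
  have hpos := φ.rOut_pos
  obtain ⟨M, χ, χ', w1, w2, w3, w4, w5, w6, w7, w8⟩ := exists_time_weight
    (T₁ := T - 2 * φ.rOut) (T₂ := T - φ.rOut)
    (continuous_timeMarginal φ) (timeMarginal_nonneg φ)
    (timeMarginal_eq_zero φ) (integral_timeMarginal φ) (exists_timeMarginal_le φ) (by linarith)
  obtain ⟨L, B, hκ⟩ := isAveragingKernel_initialKernel φ.continuous_normed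
    (φ.hasCompactSupport_normed (μ := volume))
  have hM0 : 0 ≤ M := (abs_nonneg _).trans (w3 0)
  set U := average (convKernel (φ.normed volume)) u with hU
  set V := average (convKernel (φ.normed volume)) G with hV
  set S := average (initialKernel (φ.normed volume)) f₀ with hS
  set K := average (fun z y => |initialKernel (φ.normed volume) z y|)
    (fun q => (f₀ q * √(weight γ q.2)) ^ 2) with hK
  have he : IsEntropy (T - φ.rOut) (M + 6) (fun r => r ^ 2 / 2) (fun r => r) (fun _ => 1) χ χ'
      (fun _ => 0) (fun _ => 0) :=
    { hasDerivAt_Φ := fun r => by simpa using (hasDerivAt_pow 2 r).div_const 2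
      hasDerivAt_P := fun r => hasDerivAt_id r
      continuous_P' := continuous_const
      abs_P'_le := fun r => by simp
      hasDerivAt_χ := w1
      hasDerivAt_m := fun t => hasDerivAt_const t 0
      continuous_χ' := w2
      continuous_m' := continuous_const
      abs_χ_le := fun t => by rw [abs_of_nonneg (w5 t).1]; linarith [(w5 t).2]
      abs_χ'_le := fun t => by linarith [w3 t]
      χ_eq_zero := w4
      abs_P_le := fun t r => by simp
      abs_Φ_le := fun t r => by
        rw [sub_zero, abs_of_nonneg (by positivity)]; linarith [sq_nonneg r]
      abs_P_mul_le := fun t r => by rw [mul_zero, abs_zero]; positivity }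
  have hint := hr.integrable_entropyProduction he
  have hzero := hr.integral_entropyProduction he
  have hVi : Integrable (fun p => χ p.1.1 * (V p ^ 2 / weight γ p.2)) volume := by
    simpa using hr.integrable_term_P' he
  have hKi : Integrable K volume :=
    hκ.abs.integrable_average h.memLp_f₀.integrable_sq (h.meas_f₀_mul_sqrt.pow 2)
  have hKv : ∫ p, K p = ∫ q, (f₀ q * √(weight γ q.2)) ^ 2 := by
    rw [hK, hκ.abs.integral_average h.memLp_f₀.integrable_sq (h.meas_f₀_mul_sqrt.pow 2) (c := 1),
      one_mul]
    intro y
    have e : ∀ z, |initialKernel (φ.normed volume) z y| = φ.normed volume (z - (0, y)) :=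
      fun z => abs_of_nonneg (φ.nonneg_normed _)
    simp_rw [e]
    rw [integral_sub_right_eq_self (fun z => φ.normed volume z), φ.integral_normed]
  -- Cauchy–Schwarz retains the kernel mass `timeMarginal φ`, the same function that bounds the
  -- decay of `χ` from below.
  have hcs : ∀ᵐ p : (ℝ × ℝ) × ℝ ∂(volume.prod volume),
      (S p * √(weight γ p.2)) ^ 2 ≤ timeMarginal φ p.1.1 * K p := by
    have h1 := hκ.sq_average_le h.memLp_f₀
    filter_upwards [Measure.quasiMeasurePreserving_snd.ae h1] with p hp
    have := hp p.1
    rwa [average_mul_velocity (fun v => √(weight γ v)), integral_abs_initialKernel] at this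
  have hle : ∀ᵐ p : (ℝ × ℝ) × ℝ, χ p.1.1 * (V p ^ 2 / weight γ p.2) - 18 * θ * K p
      ≤ entropyProduction γ θ (fun r => r ^ 2 / 2) (fun r => r) (fun _ => 1) χ χ'
          (fun _ => 0) (fun _ => 0) U V S p := by
    filter_upwards [hcs] with p hp
    have hw := weight_pos γ p.2
    have hws := Real.sqrt_pos.mpr hw
    set x := U p / √(weight γ p.2) with hx
    set y := S p * √(weight γ p.2) with hy
    have exy : U p * S p = x * y := by rw [hx, hy]; field_simp
    have ex2 : U p ^ 2 / weight γ p.2 = x ^ 2 := (div_sqrt_sq hw _).symm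
    have hη := timeMarginal_nonneg φ p.1.1
    have hK0 : 0 ≤ K p := integral_nonneg fun y => mul_nonneg (abs_nonneg _) (sq_nonneg _)
    have hχ := w5 p.1.1
    -- Young's inequality with `4 · (1/12) · 3 = 1`. The part in `x²` is absorbed by `χ' x²/2 ≤ -η χ
    -- x²/12`, with `η` the time marginal; the part `3 K` times `χ ≤ 6` produces the constant `18`.
    have hxy : x * y ≤ timeMarginal φ p.1.1 * x ^ 2 / 12 + 3 * K p := by
      refine le_of_abs_le (abs_le_of_sq_le_sq ?_ (by positivity))
      have h1 : x ^ 2 * y ^ 2 ≤ x ^ 2 * (timeMarginal φ p.1.1 * K p) :=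
        mul_le_mul_of_nonneg_left hp (sq_nonneg x)
      nlinarith [sq_nonneg (timeMarginal φ p.1.1 * x ^ 2 / 12 - 3 * K p)]
    have h1 : χ' p.1.1 * (x ^ 2 / 2) ≤ -(timeMarginal φ p.1.1 * χ p.1.1 / 6) * (x ^ 2 / 2) :=
      mul_le_mul_of_nonneg_right (w7 _) (by positivity)
    have h2 : χ p.1.1 * (x * y) ≤ χ p.1.1 * (timeMarginal φ p.1.1 * x ^ 2 / 12 + 3 * K p) :=
      mul_le_mul_of_nonneg_left hxy hχ.1
    have h3 : χ p.1.1 * (3 * K p) ≤ 6 * (3 * K p) :=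
      mul_le_mul_of_nonneg_right hχ.2 (by positivity)
    have h4 : θ * (χ' p.1.1 * (x ^ 2 / 2) + χ p.1.1 * (x * y)) ≤ θ * (18 * K p) :=
      mul_le_mul_of_nonneg_left (by linarith) hθ.le
    have e : entropyProduction γ θ (fun r => r ^ 2 / 2) (fun r => r) (fun _ => 1) χ χ'
          (fun _ => 0) (fun _ => 0) U V S p
        = χ p.1.1 * (V p ^ 2 / weight γ p.2)
          - θ * (χ' p.1.1 * (x ^ 2 / 2) + χ p.1.1 * (x * y)) := by
      simp only [entropyProduction, sub_zero]
      rw [← exy, ← ex2]; ring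
    rw [e]; linarith
  have hfin : ∫ p, χ p.1.1 * (V p ^ 2 / weight γ p.2)
      ≤ 18 * θ * ∫ q, (f₀ q * √(weight γ q.2)) ^ 2 := by
    have h1 := integral_mono_ae (hVi.sub (hKi.const_mul (18 * θ))) hint hle
    rw [hzero] at h1
    simp only [Pi.sub_apply] at h1
    rw [integral_sub hVi (hKi.const_mul (18 * θ)), integral_const_mul, hKv] at h1
    linarith
  have hnn : ∀ p : (ℝ × ℝ) × ℝ, 0 ≤ V p ^ 2 / weight γ p.2 := fun p =>
    div_nonneg (sq_nonneg _) (weight_pos γ p.2).le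
  have hms : MeasurableSet {p : (ℝ × ℝ) × ℝ | p.1.1 ≤ T - 2 * φ.rOut} :=
    measurableSet_le (by fun_prop) measurable_const
  calc _ ≤ ∫⁻ p in {p : (ℝ × ℝ) × ℝ | p.1.1 ≤ T - 2 * φ.rOut},
        ENNReal.ofReal (χ p.1.1 * (V p ^ 2 / weight γ p.2)) := by
        refine setLIntegral_mono' hms fun p hp => ENNReal.ofReal_le_ofReal ?_
        exact le_mul_of_one_le_left (hnn p) (w6 _ hp)
    _ ≤ ∫⁻ p, ENNReal.ofReal (χ p.1.1 * (V p ^ 2 / weight γ p.2)) := setLIntegral_le_lintegral _ _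
    _ = ENNReal.ofReal (∫ p, χ p.1.1 * (V p ^ 2 / weight γ p.2)) :=
        (ofReal_integral_eq_lintegral_ofReal hVi (Eventually.of_forall fun p =>
          mul_nonneg (w5 _).1 (hnn p))).symm
    _ ≤ _ := ENNReal.ofReal_le_ofReal hfin

end energy

/-! ### Removal of the mollifier -/

/-- A sequence of mollifiers. -/
noncomputable def bump (n : ℕ) : ContDiffBump (0 : ℝ × ℝ) where
  rIn := ((n : ℝ) + 1)⁻¹ / 2
  rOut := ((n : ℝ) + 1)⁻¹
  rIn_pos := by positivity
  rIn_lt_rOut := half_lt_self (by positivity)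

theorem tendsto_bump_rOut : Tendsto (fun n => (bump n).rOut) atTop (𝓝 0) := by
  simpa [bump] using tendsto_one_div_add_atTop_nhds_zero_nat (𝕜 := ℝ)

theorem ae_tendsto_average {γ : ℝ} {h : (ℝ × ℝ) × ℝ → ℝ} (hm : StronglyMeasurable h)
    (hh : MemLp (fun p => h p / √(weight γ p.2)) 2 volume) :
    ∀ᵐ p, Tendsto (fun n => average (convKernel ((bump n).normed volume)) h p) atTop (𝓝 (h p)) := by
  have h2 : Integrable (fun p => (h p / √(weight γ p.2)) ^ 2) (volume.prod volume) :=
    hh.integrable_sq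
  have h1 : ∀ᵐ v : ℝ, ∀ᵐ z : ℝ × ℝ, Tendsto
      (fun n => average (convKernel ((bump n).normed volume)) h (z, v)) atTop (𝓝 (h (z, v))) := by
    filter_upwards [h2.prod_left_ae] with v hv
    have hsm : StronglyMeasurable (fun y : ℝ × ℝ => h (y, v)) :=
      hm.comp_measurable measurable_prodMk_right
    have hmem : MemLp (fun y : ℝ × ℝ => h (y, v)) 2 volume := by
      rw [memLp_two_iff_integrable_sq hsm.aestronglyMeasurable]
      refine (hv.mul_const (weight γ v)).congr (Eventually.of_forall fun y => ?_)
      simp only [div_sqrt_sq (weight_pos γ v)]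
      exact div_mul_cancel₀ _ (weight_pos γ v).ne'
    -- Lebesgue differentiation on almost every velocity slice; the bumps have `rOut = 2 rIn`, hence
    -- the ratio `K = 2`.
    have := ContDiffBump.ae_convolution_tendsto_right_of_locallyIntegrable (K := 2)
      tendsto_bump_rOut (Eventually.of_forall fun n => by simp only [bump]; linarith)
      (hmem.locallyIntegrable (by norm_num))
    filter_upwards [this] with z hz
    simpa only [average_convKernel_eq_convolution] using hz
  have hms : MeasurableSet {p : (ℝ × ℝ) × ℝ | Tendsto
      (fun n => average (convKernel ((bump n).normed volume)) h p) atTop (𝓝 (h p))} := by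
    refine measurableSet_tendsto_fun (fun n => ?_) hm.measurable
    obtain ⟨B, hB⟩ := isAveragingKernel_convKernel (bump n).continuous_normed
      ((bump n).hasCompactSupport_normed (μ := volume))
    exact (hB.stronglyMeasurable_average hm).measurable
  rw [Measure.volume_eq_prod]
  refine (Measure.ae_prod_mem_iff_ae_ae_mem hms).mpr ?_
  exact (Measure.ae_ae_comm (p := fun z v => Tendsto
    (fun n => average (convKernel ((bump n).normed volume)) h (z, v)) atTop (𝓝 (h (z, v)))) hms).mpr h1

section bounds
variable {γ θ ε T A : ℝ} {f₀ : ℝ × ℝ → ℝ} {u G : (ℝ × ℝ) × ℝ → ℝ}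
  (h : IsKineticSolution γ θ ε T f₀ u G)
include h

theorem IsKineticSolution.le_of_initial_le (hθ : 0 < θ) (hA0 : 0 ≤ A)
    (hA : ∀ᵐ q : ℝ × ℝ, |f₀ q * weight γ q.2| ≤ A) :
    ∀ᵐ p : (ℝ × ℝ) × ℝ, p.1.1 < T → u p ≤ A := by
  have h1 : ∀ᵐ p : (ℝ × ℝ) × ℝ, ∀ n, p.1.1 ≤ T - 2 * (bump n).rOut →
      average (convKernel ((bump n).normed volume)) u p ≤ A :=
    ae_all_iff.mpr fun n => h.average_le (bump n) hθ hA0 hA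
  filter_upwards [h1, ae_tendsto_average h.meas_u h.memLp_u] with p hp hlim hpt
  have h2 : ∀ᶠ n in atTop, p.1.1 ≤ T - 2 * (bump n).rOut := by
    have := (tendsto_bump_rOut.const_mul 2).const_sub T
    simp only [mul_zero, sub_zero] at this
    exact (this.eventually (lt_mem_nhds hpt)).mono fun n hn => hn.le
  exact le_of_tendsto hlim (h2.mono fun n hn => hp n hn)

/-- The maximum principle. -/
theorem IsKineticSolution.abs_le (hθ : 0 < θ) (hA0 : 0 ≤ A)
    (hA : ∀ᵐ q : ℝ × ℝ, |f₀ q * weight γ q.2| ≤ A) :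
    ∀ᵐ p : (ℝ × ℝ) × ℝ, p.1.1 < T → |u p| ≤ A := by
  have hA' : ∀ᵐ q : ℝ × ℝ, |-f₀ q * weight γ q.2| ≤ A := by simpa using hA
  filter_upwards [h.le_of_initial_le hθ hA0 hA, h.neg.le_of_initial_le hθ hA0 hA']
    with p h1 h2 hp
  exact _root_.abs_le.mpr ⟨by linarith [h2 hp], h1 hp⟩

/-- The energy estimate. -/
theorem IsKineticSolution.lintegral_le (hθ : 0 < θ) :
    ∫⁻ p in {p : (ℝ × ℝ) × ℝ | p.1.1 < T}, ENNReal.ofReal (G p ^ 2 / weight γ p.2)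
      ≤ ENNReal.ofReal (18 * θ * ∫ q, (f₀ q * √(weight γ q.2)) ^ 2) := by
  set s : ℕ → Set ((ℝ × ℝ) × ℝ) := fun n => {p | p.1.1 ≤ T - 2 * (bump n).rOut} with hs
  have hsm : ∀ n, MeasurableSet (s n) := fun n => measurableSet_le (by fun_prop) measurable_const
  have hsT : MeasurableSet {p : (ℝ × ℝ) × ℝ | p.1.1 < T} :=
    measurableSet_lt (by fun_prop) measurable_const
  set g : ℕ → (ℝ × ℝ) × ℝ → ℝ≥0∞ := fun n => (s n).indicator fun p => ENNReal.ofReal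
    (average (convKernel ((bump n).normed volume)) G p ^ 2 / weight γ p.2) with hg
  have hgm : ∀ n, Measurable (g n) := fun n => by
    obtain ⟨B, hB⟩ := isAveragingKernel_convKernel (bump n).continuous_normed
      ((bump n).hasCompactSupport_normed (μ := volume))
    refine Measurable.indicator (ENNReal.measurable_ofReal.comp ?_) (hsm n)
    exact ((hB.stronglyMeasurable_average h.meas_G).measurable.pow_const 2).div
      ((continuous_weight γ).comp continuous_snd).measurable
  have hgle : ∀ n, ∫⁻ p, g n p
      ≤ ENNReal.ofReal (18 * θ * ∫ q, (f₀ q * √(weight γ q.2)) ^ 2) := fun n => by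
    rw [hg, lintegral_indicator (hsm n)]
    exact h.lintegral_average_le (bump n) hθ
  rw [← lintegral_indicator hsT]
  -- Fatou's lemma: the sets `t ≤ T - 2 rOut` exhaust `t < T`, and the mollified dissipations
  -- converge almost everywhere under a uniform bound.
  calc _ ≤ ∫⁻ p, liminf (fun n => g n p) atTop := by
        refine lintegral_mono_ae ?_
        filter_upwards [ae_tendsto_average h.meas_G h.memLp_G] with p hlim
        rw [indicator_apply]
        split_ifs with hp
        · have h2 : ∀ᶠ n in atTop, p ∈ s n := by
            have := (tendsto_bump_rOut.const_mul 2).const_sub T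
            simp only [mul_zero, sub_zero] at this
            exact (this.eventually (lt_mem_nhds hp)).mono fun n hn => hn.le
          have h3 : Tendsto (fun n => g n p) atTop
              (𝓝 (ENNReal.ofReal (G p ^ 2 / weight γ p.2))) := by
            have h4 : Tendsto (fun n => ENNReal.ofReal
                (average (convKernel ((bump n).normed volume)) G p ^ 2 / weight γ p.2)) atTop
                (𝓝 (ENNReal.ofReal (G p ^ 2 / weight γ p.2))) :=
              (ENNReal.continuous_ofReal.tendsto _).comp ((hlim.pow 2).div_const _)
            refine h4.congr' (h2.mono fun n hn => ?_)
            simp only [hg, indicator_of_mem hn]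
          exact h3.liminf_eq.ge
        · exact zero_le
    _ ≤ liminf (fun n => ∫⁻ p, g n p) atTop := lintegral_liminf_le hgm
    _ ≤ _ := liminf_le_of_frequently_le' (Frequently.of_forall hgle)

end bounds

/-! ### Extension by zero of solutions on the slab -/

theorem IsWeakDeriv.congr {u u' w w' : ℝ → ℝ} (h : IsWeakDeriv u u') (hu : u =ᵐ[volume] w)
    (hu' : u' =ᵐ[volume] w') : IsWeakDeriv w w' := by
  refine ⟨h.1.congr hu, h.2.1.congr hu', fun φ h1 h2 => ?_⟩
  have e1 : ∫ v, w v * deriv φ v = ∫ v, u v * deriv φ v :=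
    integral_congr_ae (by filter_upwards [hu] with v hv; rw [hv])
  have e2 : ∫ v, w' v * φ v = ∫ v, u' v * φ v :=
    integral_congr_ae (by filter_upwards [hu'] with v hv; rw [hv])
  rw [e1, e2]
  exact h.2.2 φ h1 h2

theorem measurableSet_slab (T : ℝ) : MeasurableSet (slab T) :=
  measurableSet_Ioo.prod MeasurableSet.univ

/-- Re-association of the phase space coordinates. -/
def assoc (p : (ℝ × ℝ) × ℝ) : ℝ × ℝ × ℝ := (p.1.1, p.1.2, p.2)

theorem assoc_velocity (p : (ℝ × ℝ) × ℝ) : (assoc p).2.2 = p.2 := rfl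

theorem measurePreserving_assoc : MeasurePreserving assoc volume volume :=
  (volume_preserving_prodAssoc : MeasurePreserving
    (MeasurableEquiv.prodAssoc : (ℝ × ℝ) × ℝ ≃ᵐ ℝ × ℝ × ℝ) volume volume)

theorem measurableEmbedding_assoc : MeasurableEmbedding assoc :=
  (MeasurableEquiv.prodAssoc : (ℝ × ℝ) × ℝ ≃ᵐ ℝ × ℝ × ℝ).measurableEmbedding

/-- The measurable extension by zero of a function on the slab, in the coordinates `((t, x), v)`. -/
noncomputable def extension {T : ℝ} {f : ℝ × ℝ × ℝ → ℝ}
    (hf : AEStronglyMeasurable f (volume.restrict (slab T))) (p : (ℝ × ℝ) × ℝ) : ℝ :=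
  (slab T).indicator (hf.mk f) (assoc p)

section extension
variable {T : ℝ} {f : ℝ × ℝ × ℝ → ℝ} (hf : AEStronglyMeasurable f (volume.restrict (slab T)))

theorem stronglyMeasurable_extension : StronglyMeasurable (extension hf) :=
  (hf.stronglyMeasurable_mk.indicator (measurableSet_slab T)).comp_measurable
    measurePreserving_assoc.measurable

theorem extension_eq_zero {p : (ℝ × ℝ) × ℝ} (hp : p.1.1 ∉ Ioo 0 T) : extension hf p = 0 :=
  indicator_of_notMem (fun h => hp h.1) _

theorem ae_eq_extension : ∀ᵐ z : ℝ × ℝ, z.1 ∈ Ioo 0 T →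
    (fun v => f (z.1, z.2, v)) =ᵐ[volume] fun v => extension hf (z, v) := by
  have h1 : ∀ᵐ p : ℝ × ℝ × ℝ, p ∈ slab T → f p = hf.mk f p :=
    (ae_restrict_iff' (measurableSet_slab T)).mp hf.ae_eq_mk
  have h2 : ∀ᵐ p : (ℝ × ℝ) × ℝ ∂(volume.prod volume),
      assoc p ∈ slab T → f (assoc p) = hf.mk f (assoc p) :=
    measurePreserving_assoc.quasiMeasurePreserving.ae h1
  filter_upwards [Measure.ae_ae_of_ae_prod h2] with z hz hzT
  filter_upwards [hz] with v hv
  have hm : assoc (z, v) ∈ slab T := ⟨hzT, mem_univ _⟩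
  rw [extension, indicator_of_mem hm]
  exact hv hm

theorem setIntegral_slab_eq (X : ℝ × ℝ × ℝ → ℝ) :
    ∫ p in slab T, f p * X p = ∫ p, extension hf p * X (assoc p) := by
  have h1 : ∫ p in slab T, f p * X p = ∫ p in slab T, hf.mk f p * X p := by
    refine integral_congr_ae ?_
    filter_upwards [hf.ae_eq_mk] with p hp
    rw [hp]
  rw [h1, ← integral_indicator (measurableSet_slab T),
    ← measurePreserving_assoc.integral_comp measurableEmbedding_assoc]
  refine integral_congr_ae (Eventually.of_forall fun p => ?_)
  by_cases hp : assoc p ∈ slab T <;> simp [extension, hp]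

/-- The condition `X 0 v = 0` ensures that the zero extension contributes nothing outside the slab.
-/
theorem lintegral_extension (X : ℝ → ℝ → ℝ≥0∞) (h0 : ∀ v, X 0 v = 0) :
    ∫⁻ p, X (extension hf p) p.2 = ∫⁻ p in slab T, X (f p) p.2.2 := by
  have h1 : ∫⁻ p in slab T, X (f p) p.2.2 = ∫⁻ p in slab T, X (hf.mk f p) p.2.2 := by
    refine lintegral_congr_ae ?_
    filter_upwards [hf.ae_eq_mk] with p hp
    rw [hp]
  rw [h1, ← lintegral_indicator (measurableSet_slab T),
    ← measurePreserving_assoc.lintegral_comp_emb measurableEmbedding_assoc]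
  refine lintegral_congr fun p => ?_
  by_cases hp : assoc p ∈ slab T <;> simp [extension, hp, h0, assoc_velocity]

end extension

theorem memLp_two_of_lintegral {α : Type*} [MeasurableSpace α] {μ : Measure α} {g k : α → ℝ}
    (hm : AEStronglyMeasurable g μ) (hk : ∀ x, g x ^ 2 = k x)
    (h : ∫⁻ x, ENNReal.ofReal (k x) ∂μ < ⊤) : MemLp g 2 μ := by
  rw [memLp_two_iff_integrable_sq hm]
  refine ⟨hm.pow 2, ?_⟩
  rw [hasFiniteIntegral_iff_ofReal (Eventually.of_forall fun x => sq_nonneg _)]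
  simpa only [hk] using h

theorem fderiv_tensor {k : ℝ × ℝ → ℝ} {ψ : ℝ → ℝ} (hk : Differentiable ℝ k)
    (hψ : Differentiable ℝ ψ) (p w : ℝ × ℝ × ℝ) :
    fderiv ℝ (fun q : ℝ × ℝ × ℝ => k (q.1, q.2.1) * ψ q.2.2) p w
      = fderiv ℝ k (p.1, p.2.1) (w.1, w.2.1) * ψ p.2.2
        + k (p.1, p.2.1) * (deriv ψ p.2.2 * w.2.2) := by
  have h1 : HasFDerivAt (fun q : ℝ × ℝ × ℝ => (q.1, q.2.1))
      ((ContinuousLinearMap.fst ℝ ℝ (ℝ × ℝ)).prod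
        ((ContinuousLinearMap.fst ℝ ℝ ℝ).comp (ContinuousLinearMap.snd ℝ ℝ (ℝ × ℝ)))) p :=
    ((ContinuousLinearMap.fst ℝ ℝ (ℝ × ℝ)).prod
        ((ContinuousLinearMap.fst ℝ ℝ ℝ).comp (ContinuousLinearMap.snd ℝ ℝ (ℝ × ℝ)))).hasFDerivAt
  have h2 : HasFDerivAt (fun q : ℝ × ℝ × ℝ => q.2.2)
      ((ContinuousLinearMap.snd ℝ ℝ ℝ).comp (ContinuousLinearMap.snd ℝ ℝ (ℝ × ℝ))) p :=
    ((ContinuousLinearMap.snd ℝ ℝ ℝ).comp (ContinuousLinearMap.snd ℝ ℝ (ℝ × ℝ))).hasFDerivAt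
  have h3 := ((hk (p.1, p.2.1)).hasFDerivAt.comp p h1).mul
    ((hψ p.2.2).hasDerivAt.comp_hasFDerivAt p h2)
  have h4 : fderiv ℝ (fun q : ℝ × ℝ × ℝ => k (q.1, q.2.1) * ψ q.2.2) p = _ := h3.fderiv
  rw [h4]
  simp
  ring

/-- The extension by zero of a weak solution. -/
theorem IsSolution.isKineticSolution {γ θ ε T : ℝ} {f₀ : ℝ × ℝ → ℝ} {f : ℝ × ℝ × ℝ → ℝ}
    (hf₀ : AEStronglyMeasurable f₀ volume) (hf₀n : normSqY2 γ f₀ < ⊤)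
    (h : IsSolution γ θ ε T f₀ f) :
    ∃ (G : ℝ × ℝ × ℝ → ℝ) (hf : AEStronglyMeasurable f (volume.restrict (slab T)))
      (hG : AEStronglyMeasurable G (volume.restrict (slab T))),
      IsKineticSolution γ θ ε T (hf₀.mk f₀) (fun p => extension hf p * weight γ p.2)
        (extension hG) := by
  obtain ⟨-, G, ⟨hf, hG, hw, hf2, hG2⟩, heq⟩ := h
  refine ⟨G, hf, hG, ?_⟩
  have hwm : Measurable (weight γ) := (continuous_weight γ).measurable
  have hw2 : Measurable fun p : (ℝ × ℝ) × ℝ => weight γ p.2 := hwm.comp measurable_snd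
  have hsf : StronglyMeasurable fun p => extension hf p * weight γ p.2 :=
    (stronglyMeasurable_extension hf).mul hw2.stronglyMeasurable
  refine ⟨hsf, stronglyMeasurable_extension hG, hf₀.stronglyMeasurable_mk, ?_, ?_, ?_, ?_, ?_⟩
  · refine memLp_two_of_lintegral (k := fun p => extension hf p ^ 2 * weight γ p.2)
      (hsf.measurable.div hw2.sqrt).aestronglyMeasurable (fun p => ?_) ?_
    · rw [div_sqrt_sq (weight_pos γ p.2), mul_pow, sq (weight γ p.2), ← mul_assoc]
      exact mul_div_cancel_right₀ _ (weight_pos γ p.2).ne'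
    · rw [lintegral_extension hf (fun a v => ENNReal.ofReal (a ^ 2 * weight γ v))
        (by simp)]
      exact hf2
  · refine memLp_two_of_lintegral (k := fun p => extension hG p ^ 2 / weight γ p.2)
      ((stronglyMeasurable_extension hG).measurable.div hw2.sqrt).aestronglyMeasurable
      (fun p => div_sqrt_sq (weight_pos γ p.2) _) ?_
    rw [lintegral_extension hG (fun a v => ENNReal.ofReal (a ^ 2 / weight γ v))
      (by simp)]
    exact hG2
  · refine memLp_two_of_lintegral (k := fun q => hf₀.mk f₀ q ^ 2 * weight γ q.2)
      (hf₀.stronglyMeasurable_mk.measurable.mul (hwm.comp measurable_snd).sqrt).aestronglyMeasurable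
      (fun q => by rw [mul_pow, Real.sq_sqrt (weight_pos γ q.2).le]) ?_
    refine lt_of_eq_of_lt (lintegral_congr_ae ?_) hf₀n
    filter_upwards [hf₀.ae_eq_mk] with q hq
    rw [hq]
  · have hw' : ∀ᵐ z : ℝ × ℝ, z ∈ Ioo 0 T ×ˢ univ →
        IsWeakDeriv (fun v => f (z.1, z.2, v) * weight γ v) (fun v => G (z.1, z.2, v)) :=
      (ae_restrict_iff' (measurableSet_Ioo.prod MeasurableSet.univ)).mp hw
    filter_upwards [hw', ae_eq_extension hf, ae_eq_extension hG] with z h1 h2 h3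
    by_cases hz : z.1 ∈ Ioo 0 T
    · refine (h1 ⟨hz, mem_univ _⟩).congr ?_ (h3 hz)
      filter_upwards [h2 hz] with v hv
      rw [hv]
    · have e1 : ∀ v, extension hf (z, v) = 0 := fun v => extension_eq_zero hf hz
      have e2 : ∀ v, extension hG (z, v) = 0 := fun v => extension_eq_zero hG hz
      simp_rw [e1, e2, zero_mul]
      exact ⟨locallyIntegrable_const 0, locallyIntegrable_const 0, fun φ _ _ => by simp⟩
  -- The formulation on the slab is specialised to the test function `k(t, x) ψ(v)`; such tensor
  -- products are all that mollification in `(t, x)` requires.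
  · intro k ψ hk hkc hks hψ hψc
    have hφ : ContDiff ℝ (⊤ : ℕ∞) (fun q : ℝ × ℝ × ℝ => k (q.1, q.2.1) * ψ q.2.2) :=
      (hk.comp (by fun_prop)).mul (hψ.comp (by fun_prop))
    have hsub : tsupport (fun q : ℝ × ℝ × ℝ => k (q.1, q.2.1) * ψ q.2.2)
        ⊆ (fun q : ℝ × ℝ × ℝ => (((q.1, q.2.1), q.2.2) : (ℝ × ℝ) × ℝ)) ⁻¹'
          (tsupport k ×ˢ tsupport ψ) := by
      refine closure_minimal (fun q hq => ?_) (((isClosed_tsupport k).prod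
        (isClosed_tsupport ψ)).preimage (by fun_prop))
      exact ⟨subset_tsupport _ (left_ne_zero_of_mul hq), subset_tsupport _ (right_ne_zero_of_mul hq)⟩
    have hφc : HasCompactSupport (fun q : ℝ × ℝ × ℝ => k (q.1, q.2.1) * ψ q.2.2) :=
      (hasCompactSupport_tensor hkc hψc).comp_homeomorph (Homeomorph.prodAssoc ℝ ℝ ℝ).symm
    have hφs : tsupport (fun q : ℝ × ℝ × ℝ => k (q.1, q.2.1) * ψ q.2.2) ⊆ Iio T ×ˢ univ :=
      fun q hq => ⟨(hks (hsub hq).1).1, mem_univ _⟩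
    have key := heq _ hφ hφc hφs
    have hkd : Differentiable ℝ k := hk.differentiable (by simp)
    have hψd : Differentiable ℝ ψ := hψ.differentiable (by simp)
    simp only [div_mul_eq_mul_div, mul_div_assoc] at key
    rw [setIntegral_slab_eq hf (fun p => θ * dt (fun q : ℝ × ℝ × ℝ => k (q.1, q.2.1) * ψ q.2.2) p
      + ε * p.2.2 * dx (fun q : ℝ × ℝ × ℝ => k (q.1, q.2.1) * ψ q.2.2) p),
      setIntegral_slab_eq hG (fun p =>
        dv (fun q : ℝ × ℝ × ℝ => k (q.1, q.2.1) * ψ q.2.2) p / weight γ p.2.2)] at key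
    have e1 : ∫ p, extension hf p * weight γ p.2 / weight γ p.2 *
          ((θ * fderiv ℝ k p.1 (1, 0) + ε * p.2 * fderiv ℝ k p.1 (0, 1)) * ψ p.2)
        = ∫ p, extension hf p * (θ * dt (fun q : ℝ × ℝ × ℝ => k (q.1, q.2.1) * ψ q.2.2) (assoc p)
          + ε * (assoc p).2.2 * dx (fun q : ℝ × ℝ × ℝ => k (q.1, q.2.1) * ψ q.2.2) (assoc p)) := by
      refine integral_congr_ae (Eventually.of_forall fun p => ?_)
      simp only [dt, dx, fderiv_tensor hkd hψd, assoc]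
      rw [mul_div_cancel_right₀ _ (weight_pos γ p.2).ne']
      ring
    have e2 : ∫ p, extension hG p / weight γ p.2 * (k p.1 * deriv ψ p.2)
        = ∫ p, extension hG p * (dv (fun q : ℝ × ℝ × ℝ => k (q.1, q.2.1) * ψ q.2.2) (assoc p)
          / weight γ (assoc p).2.2) := by
      refine integral_congr_ae (Eventually.of_forall fun p => ?_)
      simp only [dv, fderiv_tensor hkd hψd, assoc]
      rw [show (((0 : ℝ), (0 : ℝ)) : ℝ × ℝ) = 0 from rfl, map_zero]
      ring
    have e3 : ∫ q : ℝ × ℝ, hf₀.mk f₀ q * (k (0, q.1) * ψ q.2)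
        = ∫ q : ℝ × ℝ, f₀ q * (k (0, q.1) * ψ q.2) := by
      refine integral_congr_ae ?_
      filter_upwards [hf₀.ae_eq_mk] with q hq
      rw [hq]
    rw [e1, e2, e3]
    linarith

end HeavyTail

/-! ### The convergence rate -/

open HeavyTail
theorem mainTheorem8 (γ : ℝ) (hγ : 1 / 2 < γ) (A B : ℝ) :
    ∃ C : ℝ, 0 < C ∧
      ∀ f₀ : ℝ × ℝ → ℝ, AEStronglyMeasurable f₀ volume →
        normSqY2 γ f₀ ≤ ENNReal.ofReal B →
        (∀ᵐ q : ℝ × ℝ, |f₀ q * weight γ q.2| ≤ A) →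
      ∀ T : ℝ, 0 < T → ∀ ε : ℝ, 0 < ε →
      ∀ f : ℝ × ℝ × ℝ → ℝ, IsSolution γ (ε ^ ((2 * γ + 1) / 3)) ε T f₀ f →
        (∀ᵐ z : ℝ × ℝ ∂(volume.restrict (Ioo 0 T ×ˢ univ)),
          Integrable (fun v : ℝ => f (z.1, z.2, v)) volume) ∧
        ∫⁻ s in Ioo 0 T, ∫⁻ y : ℝ,
            (∫⁻ v : ℝ, ENNReal.ofReal
              (|rescaled γ f s y v - density f s y * equilibrium γ v ^ (1 / 2 : ℝ)| ^ 2))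
              ^ ((2 * γ + 1) / (2 * γ - 1))
          ≤ ENNReal.ofReal (C * ε ^ ((2 * γ + 1) / 3)) := by
  set A' := max A 0 with hA'
  set B' := max B 0 with hB'
  set c := ((∫ v, (weight γ v)⁻¹) * (2 + 8 * A' ^ 2 / (2 * γ - 1)))
    ^ ((2 * γ + 1) / (2 * γ - 1)) with hc
  have hA0 : 0 ≤ A' := le_max_right _ _
  have hB0 : 0 ≤ B' := le_max_right _ _
  have hc0 : 0 ≤ c := by
    have h1 := integral_inv_weight_pos hγ
    have h2 : 0 < 2 * γ - 1 := by linarith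
    positivity
  -- The constant `c` comes from the weak Poincaré inequality and `18 B'` from the energy estimate;
  -- adding `1` keeps the total positive even if `B' = 0`.
  refine ⟨c * (18 * B') + 1, by positivity, fun f₀ hf₀ hf₀B hf₀A T hT ε hε f hsol => ?_⟩
  set θ := ε ^ ((2 * γ + 1) / 3) with hθdef
  have hθ : 0 < θ := Real.rpow_pos_of_pos hε _
  obtain ⟨G, hf, hG, hk⟩ := hsol.isKineticSolution hf₀ (hf₀B.trans_lt ENNReal.ofReal_lt_top)
  have hAmk : ∀ᵐ q : ℝ × ℝ, |hf₀.mk f₀ q * weight γ q.2| ≤ A' := by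
    filter_upwards [hf₀A, hf₀.ae_eq_mk] with q hq hq'
    rw [← hq']; exact hq.trans (le_max_left _ _)
  have hbound : ∀ᵐ z : ℝ × ℝ, ∀ᵐ v : ℝ, z.1 < T → |extension hf (z, v) * weight γ v| ≤ A' :=
    Measure.ae_ae_of_ae_prod (hk.abs_le hθ hA0 hAmk)
  have hfi : Integrable (fun p => (extension hf p * weight γ p.2 / √(weight γ p.2)) ^ 2)
      (volume.prod volume) := hk.memLp_u.integrable_sq
  have hGi : Integrable (fun p => (extension hG p / √(weight γ p.2)) ^ 2) (volume.prod volume) :=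
    hk.memLp_G.integrable_sq
  have hmain : ∀ᵐ z : ℝ × ℝ, z.1 ∈ Ioo 0 T → Integrable (fun v => f (z.1, z.2, v)) volume ∧
      (∫⁻ v : ℝ, ENNReal.ofReal (|rescaled γ f z.1 z.2 v
          - density f z.1 z.2 * equilibrium γ v ^ (1 / 2 : ℝ)| ^ 2))
            ^ ((2 * γ + 1) / (2 * γ - 1))
        ≤ ENNReal.ofReal c * ∫⁻ v, ENNReal.ofReal (extension hG (z, v) ^ 2 / weight γ v) := by
    filter_upwards [hbound, hfi.prod_right_ae, hGi.prod_right_ae, hk.weak_u, ae_eq_extension hf]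
      with z h1 h2 h3 h4 h5 hz
    have hint : Integrable (fun v => f (z.1, z.2, v)) volume := by
      have hm : StronglyMeasurable fun v => extension hf (z, v) :=
        (stronglyMeasurable_extension hf).comp_measurable measurable_prodMk_left
      refine (integrable_of_sq_weight hγ hm.aestronglyMeasurable (h2.congr
        (Filter.Eventually.of_forall fun v => ?_))).congr (h5 hz).symm
      simp only
      rw [div_sqrt_sq (weight_pos γ v), mul_pow, sq (weight γ v), ← mul_assoc]
      exact mul_div_cancel_right₀ _ (weight_pos γ v).ne'
    refine ⟨hint, ?_⟩
    refine lintegral_deviation_rpow_le hγ (h4.congr ?_ Filter.EventuallyEq.rfl) ?_ hint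
      (h3.congr (Filter.Eventually.of_forall fun v => div_sqrt_sq (weight_pos γ v) _))
    · filter_upwards [h5 hz] with v hv
      rw [hv]
    · filter_upwards [h5 hz, h1] with v hv hv'
      rw [hv]; exact hv' hz.2
  constructor
  · rw [ae_restrict_iff' (measurableSet_Ioo.prod MeasurableSet.univ)]
    filter_upwards [hmain] with z hz hzT
    exact (hz hzT.1).1
  · have hmg : Measurable fun p : (ℝ × ℝ) × ℝ =>
        ENNReal.ofReal (extension hG p ^ 2 / weight γ p.2) :=
      (((stronglyMeasurable_extension hG).measurable.pow_const 2).div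
        ((continuous_weight γ).comp continuous_snd).measurable).ennreal_ofReal
    have h1 : ∀ᵐ s : ℝ, ∀ᵐ y : ℝ, s ∈ Ioo 0 T →
        (∫⁻ v : ℝ, ENNReal.ofReal (|rescaled γ f s y v
          - density f s y * equilibrium γ v ^ (1 / 2 : ℝ)| ^ 2)) ^ ((2 * γ + 1) / (2 * γ - 1))
        ≤ ENNReal.ofReal c * ∫⁻ v, ENNReal.ofReal (extension hG ((s, y), v) ^ 2 / weight γ v) :=
      Measure.ae_ae_of_ae_prod (hmain.mono fun z hz hzT => (hz hzT).2)
    have hf₀B' : ∫ q, (hf₀.mk f₀ q * √(weight γ q.2)) ^ 2 ≤ B' := by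
      rw [integral_eq_lintegral_of_nonneg_ae (Filter.Eventually.of_forall fun q => sq_nonneg _)
        hk.memLp_f₀.integrable_sq.aestronglyMeasurable]
      refine ENNReal.toReal_le_of_le_ofReal hB0 (le_trans (le_of_eq (lintegral_congr_ae ?_))
        (hf₀B.trans (ENNReal.ofReal_le_ofReal (le_max_left _ _))))
      filter_upwards [hf₀.ae_eq_mk] with q hq
      rw [← hq, mul_pow, Real.sq_sqrt (weight_pos γ q.2).le]
    -- The extension of `G` vanishes for `t ≥ T`, so the energy bound on `t < T` is a bound on the
    -- whole space.
    have hG0 : ∫⁻ p, ENNReal.ofReal (extension hG p ^ 2 / weight γ p.2)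
        ≤ ENNReal.ofReal (18 * θ * B') := by
      refine le_trans (le_of_eq ?_) ((hk.lintegral_le hθ).trans (ENNReal.ofReal_le_ofReal
        (mul_le_mul_of_nonneg_left hf₀B' (by positivity))))
      rw [← lintegral_indicator (measurableSet_lt (by fun_prop) measurable_const)]
      refine lintegral_congr fun p => ?_
      rw [indicator_apply]
      split_ifs with hp
      · rfl
      · rw [extension_eq_zero hG fun h => hp h.2]; simp
    calc _ ≤ ∫⁻ s in Ioo 0 T, ∫⁻ y : ℝ, ENNReal.ofReal c *
            ∫⁻ v, ENNReal.ofReal (extension hG ((s, y), v) ^ 2 / weight γ v) := by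
          refine lintegral_mono_ae ((ae_restrict_iff' measurableSet_Ioo).mpr ?_)
          filter_upwards [h1] with s hs hsT
          refine lintegral_mono_ae ?_
          filter_upwards [hs] with y hy using hy hsT
      _ ≤ ∫⁻ s, ∫⁻ y : ℝ, ENNReal.ofReal c *
            ∫⁻ v, ENNReal.ofReal (extension hG ((s, y), v) ^ 2 / weight γ v) :=
          setLIntegral_le_lintegral _ _
      _ = ENNReal.ofReal c * ∫⁻ p, ENNReal.ofReal (extension hG p ^ 2 / weight γ p.2) := by
          rw [Measure.volume_eq_prod (ℝ × ℝ) ℝ, lintegral_prod _ hmg.aemeasurable,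
            Measure.volume_eq_prod ℝ ℝ, lintegral_prod _ hmg.lintegral_prod_right'.aemeasurable,
            ← lintegral_const_mul' _ _ ENNReal.ofReal_ne_top]
          refine lintegral_congr fun s => ?_
          rw [lintegral_const_mul' _ _ ENNReal.ofReal_ne_top]
      _ ≤ ENNReal.ofReal c * ENNReal.ofReal (18 * θ * B') := by gcongr
      _ = ENNReal.ofReal (c * (18 * θ * B')) := (ENNReal.ofReal_mul hc0).symm
      _ ≤ ENNReal.ofReal ((c * (18 * B') + 1) * θ) :=
          ENNReal.ofReal_le_ofReal (by nlinarith)
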